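/- **Setting.** Let $k\ge 4$, let $\sigma$ be a regular $k$-gon in $\mathbb R^2$ and let $P\subset\mathbb R^2$ be a set of $n$ points, known in advance. The centre and diameter of a regular $k$-gon are those of its smallest enclosing disk. Homothetic copies of $\sigma$ (closed regions $\lambda\sigma+v$, $\lambda>0$) with diameters in $[1,M]$, $M\ge 1$, arrive one at a time; when an object containing a point of $P$ arrives, the algorithm must make sure that its hitting set $\mathcal H\subseteq P$, from which points are never removed, contains a point of the object. Objects containing no point of $P$ are ignored. $\mathrm{OPT}$ is the minimum size of a subset of $P$ that hits all arrived objects containing a point of $P$. **Tiles.** For translates of a copy of $\sigma$ with diameter $2$, put $\ell_\sigma=\tfrac12$, $t_\sigma=\tfrac52$ if $k=4$ or $k\ge7$, and $\ell_\sigma=\tfrac14$, $t_\sigma=\tfrac94$ if $k\in\{5,6\}$; for other diameters these lengths are scaled proportionally. Partition the plane into (half-open) square tiles of side $\ell_\sigma$ such that every point of $P$ is in the interior of a tile; if $k=4$ the tiles are parallel to the squares. The directions of the tiles are the same for all diameters. Let $m_\sigma$ be the maximum number of tiles that a translate of $\sigma$ can intersect. For a tile $s$ let $o_1,\dots,o_4$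 be the centres of the four quadrants, in counterclockwise order, of the square of side $t_\sigma$ concentric with and parallel to $s$. **Extreme points and ranking.** Let $d_\sigma$ be the convex distance function of $\sigma$ (with $\sigma$ centred at the origin, $d_\sigma(x,y)=\min\{\lambda\ge0: y\in x+\lambda\sigma\}$), and for $p\in P\cap s$ let $\mathrm{Cell}(p)=\{x: d_\sigma(x,p)\le d_\sigma(x,q)\ \forall q\in P\cap s\}$. A point $p\in P\cap s$ belongs to $V_{s,\tau}$ if $(o_\tau-\sigma)\cap\partial(p-\sigma)\cap\mathrm{int}\,\mathrm{Cell}(p)\neq\emptyset$ and no other point of $P\cap s$ lies on the segment from $o_\tau$ to $p$. Join the points of $V_{s,\tau}$ to a path in the order of the angles of the rays from $o_\tau$, measured in the coordinate system of the tiles with values in $(-\pi,\pi]$, and let $c_{s,\tau}$ be a vertex ranking of this path with colours $1,\dots,\lfloor\log_2(2|V_{s,\tau}|)\rfloor$: every path between two distinct vertices of equal colour has an internal vertex of larger colour. **Algorithm ES** (translates of one $k$-gon). If the arriving object $\sigma'$ contains a point of the current hitting set, do nothing. Otherwise, for every tile $s$ with $\sigma'\cap P\cap s\ne\emptyset$,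 let $\tau=\min\{\tau: o_\tau\in\sigma'\}$ and add the point of $\sigma'\cap V_{s,\tau}$ with the largest colour $c_{s,\tau}$. **Algorithm HHR.** Keep a hitting set $\mathcal H_j$ for every layer $j\ge 0$ (objects with diameter in $[2^j,2^{j+1})$), and $\mathcal H=\bigcup_j\mathcal H_j$. If the arriving object, of diameter $w$ in layer $j$, is hit by $\mathcal H$, do nothing. Otherwise form its shrunk set: the object alone if $w=2^j$, and else the concentric copy of diameter $2^j$ together with the $k$ copies of diameter $2^j$ obtained by shrinking the object towards each of its corners. Feed the shrunk set, in a uniformly random order chosen independently for each object, to ES for the $k$-gon of diameter $2^j$ with hitting set $\mathcal H_j$. (HHR does not know $M$.) **Theorem.** The preprocessing (partitions and rankings) can always be carried out. For every such choice and every finite input sequence of homothetic copies of $\sigma$ with diameters in $[1,M]$, fixed in advance, the output $\mathcal H\subseteq P$ of HHR always hits every object that contains a point of $P$, and $$\mathbb E\,|\mathcal H|\ \le\ 4\,m_\sigma\,(k+1)^2\,\lfloor\log_2 2M\rfloor\,\lfloor\log_2 2n\rfloor\cdot \mathrm{OPT}.$$ Moreover $m_\sigma$ is bounded by a constant depending only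 on $k$; hence, for $n\ge2$ and $M\ge2$, $\mathbb E|\mathcal H|\le C_k\,\log n\,\log M\cdot\mathrm{OPT}$ with $C_k$ depending only on $k$. -/

import Mathlib

open scoped ENNReal

namespace OnlineHitting

noncomputable section

/-! The Euclidean plane is `ℂ`.  All objects are homothetic copies of one regular `k`-gon, whose
orientation is given by the direction `φ` of one of its vertices, seen from its centre. -/

/-- The unit vector in direction `θ`. -/
def dir (θ : ℝ) : ℂ := Complex.exp (θ * Complex.I)

/-- A homothetic copy of the fixed regular `k`-gon: its centre and its diameter (centre and
diameter of the smallest enclosing disk, so that the diameter is twice the circumradius). -/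
structure KGon where
  center : ℂ
  diam : ℝ

/-- The `k` corners. -/
def KGon.corner (k : ℕ) (φ : ℝ) (σ : KGon) (i : Fin k) : ℂ :=
  σ.center + (σ.diam / 2 : ℝ) * dir (φ + 2 * Real.pi * (i : ℕ) / k)

/-- The closed polygonal region. -/
def KGon.body (k : ℕ) (φ : ℝ) (σ : KGon) : Set ℂ :=
  convexHull ℝ (Set.range (σ.corner k φ))

/-- `⌊log₂ x⌋`. -/
def floorLog2 (x : ℝ) : ℕ := ⌊Real.logb 2 x⌋₊

/-! ### Hitting sets -/

/-- `T` hits every object of `I` that contains a point of `P` (the others cannot be hit and are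
ignored). -/
def Hits (k : ℕ) (φ : ℝ) (P : Finset ℂ) (I : List KGon) (T : Set ℂ) : Prop :=
  ∀ σ ∈ I, (σ.body k φ ∩ P).Nonempty → (σ.body k φ ∩ T).Nonempty

/-- The size of an optimum offline hitting set (contained in `P`) for `I`. -/
def opt (k : ℕ) (φ : ℝ) (P : Finset ℂ) (I : List KGon) : ℕ :=
  sInf {n | ∃ T : Finset ℂ, T ⊆ P ∧ Hits k φ P I T ∧ T.card = n}

/-! ### Tiles -/

/-- Side length of the tiles for a `k`-gon of diameter `2`. -/
def tileSide (k : ℕ) : ℝ := if k = 5 ∨ k = 6 then 1 / 4 else 1 / 2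

/-- Side length of the super-squares for a `k`-gon of diameter `2`. -/
def superSide (k : ℕ) : ℝ := if k = 5 ∨ k = 6 then 9 / 4 else 5 / 2

/-- The tile with index `t` of the partition of the plane into half-open squares of side `ℓ`
whose sides have directions `ψ` and `ψ + π / 2` and one of which has the corner `z₀`. -/
def tile (ψ : ℝ) (z₀ : ℂ) (ℓ : ℝ) (t : ℤ × ℤ) : Set ℂ :=
  {z | t.1 * ℓ ≤ ((z - z₀) * dir (-ψ)).re ∧ ((z - z₀) * dir (-ψ)).re < (t.1 + 1) * ℓ ∧
       t.2 * ℓ ≤ ((z - z₀) * dir (-ψ)).im ∧ ((z - z₀) * dir (-ψ)).im < (t.2 + 1) * ℓ}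

/-- The centre of a tile. -/
def tileCenter (ψ : ℝ) (z₀ : ℂ) (ℓ : ℝ) (t : ℤ × ℤ) : ℂ :=
  z₀ + dir ψ * ⟨(t.1 + 1 / 2) * ℓ, (t.2 + 1 / 2) * ℓ⟩

/-- The maximum number of tiles that a translate of the `k`-gon can intersect.  It does not depend
on the scale or on the position of the partition, so it is taken for diameter `2`. -/
def maxTiles (k : ℕ) (φ ψ : ℝ) : ℕ :=
  ⨆ x : ℂ, {t : ℤ × ℤ | (KGon.body k φ ⟨x, 2⟩ ∩ tile ψ 0 (tileSide k) t).Nonempty}.ncard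

/-! ### Extreme points -/

/-- The convex distance function induced by `C` (centred at the origin). -/
def convexDist (C : Set ℂ) (x y : ℂ) : ℝ := gauge C (y - x)

/-- The Voronoi cell of `p` with respect to the sites `Q`. -/
def cell (C Q : Set ℂ) (p : ℂ) : Set ℂ :=
  {x | ∀ q ∈ Q, convexDist C x p ≤ convexDist C x q}

/-- The copy of `-C` centred at `c`. -/
def reflectedCopy (C : Set ℂ) (c : ℂ) : Set ℂ := (fun z => c - z) '' C

/-- The extreme points among `Q` (the points of a tile) for translates of `C` that contain `o`:
some point of the Voronoi cell's interior is the centre of a translate of `C` that contains `o`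
and has `p` on its boundary; of several points on one ray from `o` only the nearest counts. -/
def extremePoints (C Q : Set ℂ) (o : ℂ) : Set ℂ :=
  {p | p ∈ Q ∧
    (reflectedCopy C o ∩ frontier (reflectedCopy C p) ∩ interior (cell C Q p)).Nonempty ∧
    ∀ q ∈ Q, q ∈ segment ℝ o p → q = p}

/-! ### Vertex rankings -/

/-- The path graph on `V` in which the elements are joined in increasing order of `θ`. -/
def pathGraph (V : Set ℂ) (θ : ℂ → ℝ) : SimpleGraph V :=
  SimpleGraph.fromRel fun p q => θ p < θ q ∧ ∀ r ∈ V, ¬ (θ p < θ r ∧ θ r < θ q)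

/-- `c` is a vertex ranking of `G` with colours in `{1, …, N}`. -/
def IsVertexRanking {W : Type} (G : SimpleGraph W) (N : ℕ) (c : W → ℕ) : Prop :=
  (∀ v, 1 ≤ c v ∧ c v ≤ N) ∧
  ∀ x y : W, x ≠ y → ∀ w : G.Walk x y, w.IsPath → c x = c y →
    ∃ z ∈ w.support, z ≠ x ∧ z ≠ y ∧ c x < c z

/-! ### Preprocessing of the layers

Layer `j` holds the objects with diameter in `[2 ^ j, 2 ^ (j + 1))`; its tiles, super-squares and
extreme points are those for the `k`-gon of diameter `2 ^ j`. -/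

/-- The layer of an object of diameter `w`. -/
def layer (w : ℝ) : ℕ := floorLog2 w

/-- The scaling factor from diameter `2` to diameter `2 ^ j`. -/
def layerScale (j : ℕ) : ℝ := 2 ^ j / 2

/-- The tiles of layer `j`. -/
def layerTile (k : ℕ) (ψ : ℝ) (z₀ : ℂ) (j : ℕ) (t : ℤ × ℤ) : Set ℂ :=
  tile ψ z₀ (layerScale j * tileSide k) t

/-- The centre `o_τ` of the quadrant `τ` of the super-square of a tile of layer `j`. -/
def quadCenter (k : ℕ) (ψ : ℝ) (z₀ : ℂ) (j : ℕ) (t : ℤ × ℤ) (τ : Fin 4) : ℂ :=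
  tileCenter ψ z₀ (layerScale j * tileSide k) t +
    dir ψ * ((layerScale j * superSide k / 4 : ℝ) * ((1 + Complex.I) * Complex.I ^ (τ : ℕ)))

/-- The set `V_{s,τ}` of extreme points in layer `j`. -/
def layerExtreme (k : ℕ) (φ ψ : ℝ) (P : Finset ℂ) (z₀ : ℂ) (j : ℕ) (t : ℤ × ℤ) (τ : Fin 4) :
    Set ℂ :=
  extremePoints (KGon.body k φ ⟨0, 2 ^ j⟩) (P ∩ layerTile k ψ z₀ j t) (quadCenter k ψ z₀ j t τ)

/-- The angle of the ray from `o_τ` to `p`, measured in the directions of the tiles. -/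
def quadAngle (k : ℕ) (ψ : ℝ) (z₀ : ℂ) (j : ℕ) (t : ℤ × ℤ) (τ : Fin 4) (p : ℂ) : ℝ :=
  Complex.arg ((p - quadCenter k ψ z₀ j t τ) * dir (-ψ))

/-- The choices made in the preprocessing of the layers: a partition with all points of `P` in the
interiors of tiles, and vertex rankings with few colours. -/
structure Preprocessing (k : ℕ) (φ ψ : ℝ) (P : Finset ℂ) where
  origin : ℕ → ℂ
  mem_interior : ∀ j, ∀ p ∈ P, ∃ t, p ∈ interior (layerTile k ψ (origin j) j t)
  rank : ∀ (j : ℕ) (t : ℤ × ℤ) (τ : Fin 4), layerExtreme k φ ψ P (origin j) j t τ → ℕ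
  isRanking : ∀ j t τ,
    IsVertexRanking
      (pathGraph (layerExtreme k φ ψ P (origin j) j t τ) (quadAngle k ψ (origin j) j t τ))
      (floorLog2 (2 * (layerExtreme k φ ψ P (origin j) j t τ).ncard)) (rank j t τ)

/-! ### Algorithm ES for the translates of diameter `2 ^ j` -/

section Algorithms

variable {k : ℕ} {φ ψ : ℝ} {P : Finset ℂ}

/-- `τ` is the type of `σ` with respect to the tile `t`: the least `τ` with `o_τ ∈ σ`. -/
def IsType (D : Preprocessing k φ ψ P) (j : ℕ) (t : ℤ × ℤ) (σ : KGon) (τ : Fin 4) : Prop :=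
  quadCenter k ψ (D.origin j) j t τ ∈ σ.body k φ ∧
    ∀ τ' < τ, quadCenter k ψ (D.origin j) j t τ' ∉ σ.body k φ

/-- `v` is the extreme point with the largest colour in `σ`, for the tile `t` and the type of `σ`. -/
def IsSelected (D : Preprocessing k φ ψ P) (j : ℕ) (t : ℤ × ℤ) (σ : KGon) (v : ℂ) : Prop :=
  ∃ τ, IsType D j t σ τ ∧
    ∃ hv : v ∈ layerExtreme k φ ψ P (D.origin j) j t τ, v ∈ σ.body k φ ∧
      ∀ (w : ℂ) (hw : w ∈ layerExtreme k φ ψ P (D.origin j) j t τ), w ∈ σ.body k φ →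
        D.rank j t τ ⟨w, hw⟩ ≤ D.rank j t τ ⟨v, hv⟩

open Classical in
/-- One step of ES: nothing happens if `σ` is already stabbed; otherwise the selected point of every
tile that contains a point of `σ ∩ P` is added. -/
def esStep (D : Preprocessing k φ ψ P) (j : ℕ) (H : Finset ℂ) (σ : KGon) : Finset ℂ :=
  if ∃ p ∈ H, p ∈ σ.body k φ then H
  else H ∪ P.filter fun v =>
    ∃ t, (σ.body k φ ∩ P ∩ layerTile k ψ (D.origin j) j t).Nonempty ∧ IsSelected D j t σ v

/-! ### Algorithm HHR -/

open Classical in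
/-- The shrunk set of `σ`: only `σ` itself if its diameter `w` is `2 ^ j`, where `j` is its layer;
otherwise the concentric copy of diameter `2 ^ j` and, for each corner `c`, the image of `σ` under
the homothety with centre `c` and ratio `2 ^ j / w`. -/
def shrunkSet (k : ℕ) (φ : ℝ) (σ : KGon) : List KGon :=
  if σ.diam = 2 ^ layer σ.diam then [σ]
  else ⟨σ.center, 2 ^ layer σ.diam⟩ :: List.ofFn fun i : Fin k =>
    ⟨σ.corner k φ i + ((2 ^ layer σ.diam / σ.diam : ℝ) : ℂ) * (σ.center - σ.corner k φ i),
      2 ^ layer σ.diam⟩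

/-- The state is the family `(H_j)` of the hitting sets of the layers; this is `⋃ j, H_j`. -/
def output (H : ℕ → Finset ℂ) : Set ℂ := ⋃ j, (H j : Set ℂ)

open Classical in
/-- One step of HHR: nothing happens if `σ` is already hit; otherwise the shrunk set of `σ` is fed
to ES in its layer, in an order that is chosen uniformly at random. -/
def hhrStep (D : Preprocessing k φ ψ P) (H : ℕ → Finset ℂ) (σ : KGon) :
    PMF (ℕ → Finset ℂ) :=
  if (σ.body k φ ∩ output H).Nonempty then PMF.pure H
  else (PMF.uniformOfFintype (Equiv.Perm (Fin (shrunkSet k φ σ).length))).map fun π =>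
    Function.update H (layer σ.diam)
      ((List.ofFn fun i => (shrunkSet k φ σ).get (π i)).foldl (esStep D (layer σ.diam))
        (H (layer σ.diam)))

/-- HHR on the remaining input, from a given state. -/
def hhrFrom (D : Preprocessing k φ ψ P) : (ℕ → Finset ℂ) → List KGon → PMF (ℕ → Finset ℂ)
  | H, [] => PMF.pure H
  | H, σ :: I => (hhrStep D H σ).bind fun H' => hhrFrom D H' I

/-- The law of the final state of HHR on the input sequence `I`. -/
def hhr (D : Preprocessing k φ ψ P) (I : List KGon) : PMF (ℕ → Finset ℂ) :=
  hhrFrom D (fun _ => ∅) I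

end Algorithms

/-- The expected number of points in the hitting set. -/
def expectedSize (μ : PMF (ℕ → Finset ℂ)) : ℝ≥0∞ :=
  ∑' H, μ H * ((output H).encard : ℝ≥0∞)

end

end OnlineHitting

open OnlineHitting

/-!
The proof combines a charging argument for a single layer with the randomisation over the shrunk
sets.

**One layer.** Translates of a `k`-gon of diameter `2 ^ j` are handled tile by tile. A tile is so
small that every translate meeting it contains one of the four quadrant centres
(`exists_quadCenter_mem`), so the translate has a type `τ`. Fix the tile and `o = o_τ`, and describe
a translate containing `o` by its position relative to `o`.

* The translate contains an extreme point of `V_{s,τ}` as soon as it contains a point of `P` in the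
  tile (`exists_layerExtreme_mem`). It can be moved, always containing `o`, to a position where no
  point of the tile is left, in such a way that no point enters it (`Reachable.exists_walk`): first
  along a ray leaving a position `A` that sees the whole tile in its interior, then along the
  positions with `o` on the boundary, to the one opposite to `A`. Shortly before it is empty, its
  last points lie on its boundary, and after a small perturbation on a single edge; these are
  extreme.
* Extreme points in a translate are contiguous, even for two translates together: if two
  translates of type `τ` share a point of `P` in the tile, and contain the extreme points `v₁` and
  `v₂` respectively, then every extreme point seen from `o` between `v₁` and `v₂` lies in one of them
  (`mem_or_mem_of_quadAngle`).

By the second fact and the defining property of a vertex ranking, the largest colours in two such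
translates belong to the same point or are different (`IsTop.eq_of_rank_eq`). Hence each time ES is
given an unstabbed translate that contains `p ∈ P`, it uses a new colour for `p` and the type in
question, and there are at most `⌊log₂ 2n⌋` colours. This is recorded by `potential`, which starts at
most at `4 ⌊log₂ 2n⌋` and drops in such a step (`potential_esStep_lt`).

**All layers.** The at most `k + 1` objects of the shrunk set of `σ` lie in `σ` and cover it
(`exists_mem_shrunkSet`), so HHR does produce a hitting set. Let `T` be an optimum hitting set. If
`σ` is not yet hit, some `p ∈ T ∩ σ` lies in an object of the shrunk set; with probability at least
`1 / (k + 1)` this object comes first in the random order, and then the potential of `p` in the layer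
of `σ` drops (`sum_totalPotential_le`). As the step adds at most `(k + 1) m_σ` points, the expected
size plus `(k + 1) ^ 2 m_σ` times the potential summed over `T` and over the `⌊log₂ 2M⌋` layers does
not increase (`expectedSize_hhrFrom_le`).
-/

open OnlineHitting

namespace OnlineHitting

/-! ### Regular polygons as intersections of half-planes -/

theorem dir_add (a b : ℝ) : dir (a + b) = dir a * dir b := by
  simp [dir, add_mul, Complex.exp_add]

theorem dir_re (a : ℝ) : (dir a).re = Real.cos a := by
  simp [dir, Complex.exp_ofReal_mul_I_re]

theorem dir_im (a : ℝ) : (dir a).im = Real.sin a := by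
  simp [dir, Complex.exp_ofReal_mul_I_im]

theorem norm_dir (a : ℝ) : ‖dir a‖ = 1 := by
  simp [dir, Complex.norm_exp_ofReal_mul_I]

theorem dir_zero : dir 0 = 1 := by simp [dir]

theorem dir_mul_dir_neg (a : ℝ) : dir a * dir (-a) = 1 := by
  rw [← dir_add, add_neg_cancel, dir_zero]

theorem dir_add_int_mul_two_pi (a : ℝ) (n : ℤ) : dir (a + n * (2 * Real.pi)) = dir a := by
  apply Complex.ext
  · rw [dir_re, dir_re, Real.cos_add_int_mul_two_pi]
  · rw [dir_im, dir_im, Real.sin_add_int_mul_two_pi]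

theorem cos_odd_mul_le {k : ℕ} (hk : 0 < k) {m : ℤ} (hm : Odd m) :
    Real.cos (m * (Real.pi / k)) ≤ Real.cos (Real.pi / k) := by
  have hk' : (0 : ℝ) < k := by exact_mod_cast hk
  have hpi := Real.pi_pos
  set q := m / (2 * k) with hq
  set r := m % (2 * k) with hr
  have hmr : m = r + q * (2 * k) := by rw [hq, hr]; exact (Int.emod_add_ediv_mul m (2 * k)).symm
  have h0 : 0 ≤ r := Int.emod_nonneg _ (by omega)
  have h1 : r < 2 * k := Int.emod_lt_of_pos _ (by omega)
  have h2 : r ≠ 0 := by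
    intro h
    rw [h] at hmr
    obtain ⟨a, ha⟩ := hm
    have : (2 : ℤ) ∣ 1 := ⟨q * k - a, by linarith⟩
    norm_num at this
  have e1 : (m : ℝ) * (Real.pi / k) = r * (Real.pi / k) + q * (2 * Real.pi) := by
    rw [hmr]; push_cast; field_simp
  rw [e1, Real.cos_add_int_mul_two_pi]
  have hkk : (k : ℝ) * (Real.pi / k) = Real.pi := by field_simp
  have hpk : 0 < Real.pi / k := by positivity
  have h3 : (1 : ℝ) ≤ r := by exact_mod_cast (by omega : (1 : ℤ) ≤ r)
  by_cases h4 : r ≤ k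
  · have h4' : (r : ℝ) ≤ k := by exact_mod_cast h4
    apply Real.cos_le_cos_of_nonneg_of_le_pi hpk.le <;> nlinarith
  · rw [← Real.cos_two_pi_sub]
    have h5 : (r : ℝ) ≤ 2 * k - 1 := by exact_mod_cast (by omega : r ≤ 2 * k - 1)
    have h6 : (k : ℝ) ≤ r := by exact_mod_cast (by omega : (k : ℤ) ≤ r)
    apply Real.cos_le_cos_of_nonneg_of_le_pi hpk.le <;> nlinarith

/-- The unit vector from the centre of the `k`-gon towards its `i`-th corner, for `i : ℤ`. -/
noncomputable def vtx (k : ℕ) (φ : ℝ) (i : ℤ) : ℂ := dir (φ + 2 * Real.pi * i / k)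

/-- The direction of the outer normal of the edge between the corners `i` and `i + 1`. -/
noncomputable def nrmAngle (k : ℕ) (φ : ℝ) (i : ℤ) : ℝ := φ + (2 * i + 1) * Real.pi / k

/-- The component of `z` in the direction `θ`. -/
noncomputable def comp (θ : ℝ) (z : ℂ) : ℝ := (z * dir (-θ)).re

theorem comp_eq (θ : ℝ) (z : ℂ) : comp θ z = z.re * Real.cos θ + z.im * Real.sin θ := by
  simp [comp, dir_re, dir_im]

theorem comp_add (θ : ℝ) (z w : ℂ) : comp θ (z + w) = comp θ z + comp θ w := by
  simp only [comp_eq, Complex.add_re, Complex.add_im]; ring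

theorem comp_sub (θ : ℝ) (z w : ℂ) : comp θ (z - w) = comp θ z - comp θ w := by
  simp only [comp_eq, Complex.sub_re, Complex.sub_im]; ring

theorem comp_real_mul (θ : ℝ) (x : ℝ) (z : ℂ) : comp θ (x * z) = x * comp θ z := by
  simp only [comp_eq, Complex.re_ofReal_mul, Complex.im_ofReal_mul]; ring

theorem comp_le_norm (θ : ℝ) (z : ℂ) : comp θ z ≤ ‖z‖ := by
  have := Complex.re_le_norm (z * dir (-θ))
  rwa [norm_mul, norm_dir, mul_one] at this

theorem comp_dir (θ a : ℝ) : comp θ (dir a) = Real.cos (a - θ) := by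
  rw [comp, ← dir_add, dir_re, sub_eq_add_neg]

theorem comp_vtx_le {k : ℕ} (hk : 0 < k) (φ : ℝ) (i j : ℤ) :
    comp (nrmAngle k φ i) (vtx k φ j) ≤ Real.cos (Real.pi / k) := by
  rw [vtx, comp_dir]
  have hk' : (0 : ℝ) < k := by exact_mod_cast hk
  have := cos_odd_mul_le hk (m := 2 * (j - i) - 1) (by exact ⟨j - i - 1, by ring⟩)
  convert this using 2
  unfold nrmAngle; push_cast; field_simp; ring

theorem comp_vtx_self {k : ℕ} (hk : 0 < k) (φ : ℝ) (i : ℤ) :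
    comp (nrmAngle k φ i) (vtx k φ i) = Real.cos (Real.pi / k) := by
  rw [vtx, comp_dir, ← Real.cos_neg]
  have hk' : (0 : ℝ) < k := by exact_mod_cast hk
  congr 1
  unfold nrmAngle; field_simp; ring

theorem comp_vtx_succ {k : ℕ} (hk : 0 < k) (φ : ℝ) (i : ℤ) :
    comp (nrmAngle k φ i) (vtx k φ (i + 1)) = Real.cos (Real.pi / k) := by
  rw [vtx, comp_dir]
  have hk' : (0 : ℝ) < k := by exact_mod_cast hk
  congr 1
  unfold nrmAngle; push_cast; field_simp; ring

theorem vtx_add_mul {k : ℕ} (hk : 0 < k) (φ : ℝ) (i q : ℤ) :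
    vtx k φ (i + k * q) = vtx k φ i := by
  have hk' : (0 : ℝ) < k := by exact_mod_cast hk
  rw [vtx, vtx, ← dir_add_int_mul_two_pi (φ + 2 * Real.pi * i / k) q]
  congr 1; push_cast; field_simp; ring

theorem comp_nrmAngle_add_mul {k : ℕ} (hk : 0 < k) (φ : ℝ) (i q : ℤ) (z : ℂ) :
    comp (nrmAngle k φ (i + k * q)) z = comp (nrmAngle k φ i) z := by
  have hk' : (0 : ℝ) < k := by exact_mod_cast hk
  have : nrmAngle k φ (i + k * q) = nrmAngle k φ i + q * (2 * Real.pi) := by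
    unfold nrmAngle; push_cast; field_simp; ring
  rw [comp_eq, comp_eq, this, Real.cos_add_int_mul_two_pi, Real.sin_add_int_mul_two_pi]

theorem exists_fin_add_mul {k : ℕ} (hk : 0 < k) (i : ℤ) :
    ∃ (j : Fin k) (q : ℤ), i = (j : ℕ) + k * q := by
  have h0 : 0 ≤ i % k := Int.emod_nonneg _ (by omega)
  have h1 : i % k < k := Int.emod_lt_of_pos _ (by omega)
  refine ⟨⟨(i % k).toNat, by omega⟩, i / k, ?_⟩
  simp only [Int.toNat_of_nonneg h0]
  exact (Int.emod_add_mul_ediv i k).symm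

/-- Every vector lies in the sector spanned by two consecutive corners. -/
theorem exists_sector {k : ℕ} (hk : 4 ≤ k) (φ : ℝ) (w : ℂ) :
    ∃ (i : ℤ) (s t : ℝ), 0 ≤ s ∧ 0 ≤ t ∧ w = s * vtx k φ i + t * vtx k φ (i + 1) := by
  have hk' : (0 : ℝ) < k := by exact_mod_cast (by omega : 0 < k)
  have hk4 : (4 : ℝ) ≤ k := by exact_mod_cast hk
  have hpi := Real.pi_pos
  set η := Complex.arg w
  set i := ⌊(η - φ) * k / (2 * Real.pi)⌋ with hi
  set α : ℝ := 2 * Real.pi / k with hα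
  have hαpos : 0 < α := by positivity
  have hαpi : α < Real.pi := by rw [hα, div_lt_iff₀ hk']; nlinarith
  set u := η - φ - i * α with hu
  have hq : (η - φ) * k / (2 * Real.pi) = (η - φ) / α := by rw [hα]; field_simp
  have hu0 : 0 ≤ u := by
    have := Int.floor_le ((η - φ) * k / (2 * Real.pi))
    rw [← hi, hq, le_div_iff₀ hαpos] at this; linarith
  have hu1 : u ≤ α := by
    have := (Int.lt_floor_add_one ((η - φ) * k / (2 * Real.pi))).le
    rw [← hi, hq, div_le_iff₀ hαpos] at this; linarith
  have hsin : 0 < Real.sin α := Real.sin_pos_of_pos_of_lt_pi hαpos hαpi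
  have hw : w = ‖w‖ * dir (φ + i * α) * dir u := by
    rw [mul_assoc, ← dir_add, show φ + i * α + u = η by rw [hu]; ring]
    exact (Complex.norm_mul_exp_arg_mul_I w).symm
  have hv0 : vtx k φ i = dir (φ + i * α) := by
    rw [vtx]; congr 1; rw [hα]; ring
  have hv1 : vtx k φ (i + 1) = dir (φ + i * α) * dir α := by
    rw [vtx, ← dir_add]; congr 1; rw [hα]; push_cast; ring
  refine ⟨i, ‖w‖ * Real.sin (α - u) / Real.sin α, ‖w‖ * Real.sin u / Real.sin α, ?_, ?_, ?_⟩
  · have : 0 ≤ Real.sin (α - u) := Real.sin_nonneg_of_nonneg_of_le_pi (by linarith) (by linarith)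
    positivity
  · have : 0 ≤ Real.sin u := Real.sin_nonneg_of_nonneg_of_le_pi (by linarith) (by linarith)
    positivity
  · rw [hv0, hv1]
    have key : dir u = (Real.sin (α - u) / Real.sin α : ℝ) + (Real.sin u / Real.sin α : ℝ) * dir α := by
      apply Complex.ext
      · simp only [Complex.add_re, Complex.ofReal_re, Complex.re_ofReal_mul, dir_re]
        rw [Real.sin_sub]; field_simp; ring
      · simp only [Complex.add_im, Complex.ofReal_im, Complex.im_ofReal_mul, dir_im]
        field_simp; ring
    conv_lhs => rw [hw, key]
    push_cast; ring

theorem cos_pi_div_pos {k : ℕ} (hk : 4 ≤ k) : 0 < Real.cos (Real.pi / k) := by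
  have hk4 : (4 : ℝ) ≤ k := by exact_mod_cast hk
  have hpi := Real.pi_pos
  apply Real.cos_pos_of_mem_Ioo
  constructor
  · have : 0 < Real.pi / k := by positivity
    linarith
  · rw [div_lt_iff₀ (by linarith)]; nlinarith

theorem range_corner {k : ℕ} (hk : 0 < k) (φ : ℝ) (σ : KGon) :
    Set.range (σ.corner k φ) =
      Set.range fun i : ℤ => σ.center + (σ.diam / 2 : ℝ) * vtx k φ i := by
  ext z
  constructor
  · rintro ⟨i, rfl⟩
    exact ⟨(i : ℕ), by simp [KGon.corner, vtx]⟩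
  · rintro ⟨i, rfl⟩
    obtain ⟨j, q, rfl⟩ := exists_fin_add_mul hk i
    exact ⟨j, by simp only [vtx_add_mul hk]; simp [KGon.corner, vtx]⟩

theorem vertex_mem_body {k : ℕ} (hk : 0 < k) (φ : ℝ) (σ : KGon) (i : ℤ) :
    σ.center + (σ.diam / 2 : ℝ) * vtx k φ i ∈ σ.body k φ := by
  apply subset_convexHull
  rw [range_corner hk]
  exact ⟨i, rfl⟩

theorem convex_body (k : ℕ) (φ : ℝ) (σ : KGon) : Convex ℝ (σ.body k φ) := convex_convexHull _ _

theorem body_subset_halfplanes {k : ℕ} (hk : 0 < k) {φ : ℝ} {σ : KGon} (hd : 0 ≤ σ.diam) {z : ℂ}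
    (hz : z ∈ σ.body k φ) (i : ℤ) :
    comp (nrmAngle k φ i) (z - σ.center) ≤ σ.diam / 2 * Real.cos (Real.pi / k) := by
  have hconv : Convex ℝ
      {z : ℂ | comp (nrmAngle k φ i) (z - σ.center) ≤ σ.diam / 2 * Real.cos (Real.pi / k)} := by
    intro x hx y hy a b ha hb hab
    simp only [Set.mem_ofPred_eq] at *
    have : a • x + b • y - σ.center = (a : ℂ) * (x - σ.center) + (b : ℂ) * (y - σ.center) := by
      have : (a : ℂ) + b = 1 := by exact_mod_cast hab
      simp only [Complex.real_smul]; linear_combination σ.center * this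
    rw [this, comp_add, comp_real_mul, comp_real_mul]
    calc _ ≤ a * (σ.diam / 2 * Real.cos (Real.pi / k)) + b * (σ.diam / 2 * Real.cos (Real.pi / k)) := by
          gcongr
      _ = _ := by rw [← add_mul, hab, one_mul]
  refine convexHull_min ?_ hconv hz
  rw [range_corner hk]
  rintro _ ⟨j, rfl⟩
  simp only [Set.mem_ofPred_eq, add_sub_cancel_left, comp_real_mul]
  exact mul_le_mul_of_nonneg_left (comp_vtx_le hk φ i j) (by positivity)

theorem center_mem_body {k : ℕ} (hk : 4 ≤ k) (φ : ℝ) (σ : KGon) :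
    σ.center ∈ σ.body k φ := by
  -- `-v₀` lies in the sector of two corners, hence `0` is a positive combination of corners.
  obtain ⟨i, s, t, hs, ht, h⟩ := exists_sector hk φ (-vtx k φ 0)
  have hk0 : 0 < k := by omega
  have m0 := vertex_mem_body hk0 φ σ 0
  have m1 := vertex_mem_body hk0 φ σ i
  have m2 := vertex_mem_body hk0 φ σ (i + 1)
  have hpos : 0 < 1 + s + t := by positivity
  have := (convex_body k φ σ).sum_mem (t := (Finset.univ : Finset (Fin 3)))
    (w := ![1 / (1 + s + t), s / (1 + s + t), t / (1 + s + t)])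
    (z := ![_, _, _]) ?_ ?_ (by
      intro j _
      fin_cases j
      exacts [m0, m1, m2])
  · convert this using 1
    have hpos' : (1 + s + t : ℂ) ≠ 0 := by exact_mod_cast hpos.ne'
    simp only [Fin.sum_univ_three, Matrix.cons_val, Complex.real_smul]
    push_cast
    field_simp
    linear_combination (σ.diam : ℂ) * h
  · intro j _
    fin_cases j <;> simp <;> positivity
  · simp only [Fin.sum_univ_three, Matrix.cons_val]
    field_simp

theorem sector_mem_body {k : ℕ} (hk : 4 ≤ k) (φ : ℝ) (σ : KGon) (i : ℤ)
    {s t : ℝ} (hs : 0 ≤ s) (ht : 0 ≤ t) (hst : s + t ≤ 1) :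
    σ.center + (σ.diam / 2 : ℝ) * ((s : ℂ) * vtx k φ i + t * vtx k φ (i + 1)) ∈ σ.body k φ := by
  have hk0 : 0 < k := by omega
  have m0 := center_mem_body hk φ σ
  have m1 := vertex_mem_body hk0 φ σ i
  have m2 := vertex_mem_body hk0 φ σ (i + 1)
  have := (convex_body k φ σ).sum_mem (t := (Finset.univ : Finset (Fin 3)))
    (w := ![1 - s - t, s, t]) (z := ![_, _, _]) ?_ ?_ (by
      intro j _
      fin_cases j
      exacts [m0, m1, m2])
  · convert this using 1
    simp only [Fin.sum_univ_three, Matrix.cons_val, Complex.real_smul]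
    push_cast
    ring
  · intro j _
    fin_cases j <;> simp <;> linarith
  · simp only [Fin.sum_univ_three, Matrix.cons_val]
    ring

theorem mem_body_iff {k : ℕ} (hk : 4 ≤ k) (φ : ℝ) {σ : KGon} (hd : 0 < σ.diam) {z : ℂ} :
    z ∈ σ.body k φ ↔
      ∀ i : ℤ, comp (nrmAngle k φ i) (z - σ.center) ≤ σ.diam / 2 * Real.cos (Real.pi / k) := by
  refine ⟨fun h i => body_subset_halfplanes (by omega) hd.le h i, fun h => ?_⟩
  obtain ⟨i, s, t, hs, ht, hw⟩ := exists_sector hk φ ((z - σ.center) / (σ.diam / 2 : ℝ))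
  have hd' : ((σ.diam / 2 : ℝ) : ℂ) ≠ 0 := by exact_mod_cast (by positivity : σ.diam / 2 ≠ 0)
  have hz : z = σ.center + (σ.diam / 2 : ℝ) * ((s : ℂ) * vtx k φ i + t * vtx k φ (i + 1)) := by
    rw [← hw]; field_simp; ring
  have hc := cos_pi_div_pos hk
  have h1 := h i
  rw [hz, add_sub_cancel_left, comp_real_mul, comp_add, comp_real_mul, comp_real_mul,
    comp_vtx_self (by omega), comp_vtx_succ (by omega), ← add_mul] at h1
  have h2 := le_of_mul_le_mul_left h1 (by positivity)
  have h3 : s + t ≤ 1 := by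
    by_contra hcon
    push Not at hcon
    nlinarith
  rw [hz]
  exact sector_mem_body hk φ σ i hs ht h3

theorem mem_body_of_norm_le {k : ℕ} (hk : 4 ≤ k) (φ : ℝ) {σ : KGon} (hd : 0 < σ.diam) {z : ℂ}
    (h : ‖z - σ.center‖ ≤ σ.diam / 2 * Real.cos (Real.pi / k)) : z ∈ σ.body k φ :=
  (mem_body_iff hk φ hd).2 fun _ => (comp_le_norm _ _).trans h

theorem norm_le_of_mem_body {k : ℕ} {φ : ℝ} {σ : KGon} (hd : 0 ≤ σ.diam) {z : ℂ}
    (h : z ∈ σ.body k φ) : ‖z - σ.center‖ ≤ σ.diam / 2 := by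
  have : σ.body k φ ⊆ Metric.closedBall σ.center (σ.diam / 2) := by
    refine convexHull_min ?_ (convex_closedBall _ _)
    rintro _ ⟨i, rfl⟩
    rw [Metric.mem_closedBall, dist_eq_norm]
    simp only [KGon.corner, add_sub_cancel_left, norm_mul, norm_dir, mul_one, Complex.norm_real,
      Real.norm_eq_abs]
    rw [abs_of_nonneg (by positivity)]
  simpa [dist_eq_norm] using this h

/-! ### The gauge of a polygon given by linear inequalities -/

section PolyGauge

open Topology

variable {ι : Type} [Fintype ι] [Nonempty ι] (n : ι → ℂ →L[ℝ] ℝ)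

/-- The gauge of the polygon `{z | ∀ i, n i z ≤ 1}`. -/
noncomputable def polyGauge (z : ℂ) : ℝ :=
  Finset.univ.sup' Finset.univ_nonempty fun i => n i z

theorem polyGauge_le_iff {z : ℂ} {c : ℝ} : polyGauge n z ≤ c ↔ ∀ i, n i z ≤ c := by
  simp [polyGauge]

theorem polyGauge_lt_iff {z : ℂ} {c : ℝ} : polyGauge n z < c ↔ ∀ i, n i z < c := by
  simp [polyGauge]

theorem le_polyGauge (i : ι) (z : ℂ) : n i z ≤ polyGauge n z :=
  (polyGauge_le_iff n).1 le_rfl i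

theorem exists_polyGauge_eq (z : ℂ) : ∃ i, polyGauge n z = n i z := by
  obtain ⟨i, -, hi⟩ := Finset.exists_mem_eq_sup' (s := (Finset.univ : Finset ι))
    Finset.univ_nonempty fun i => n i z
  exact ⟨i, hi⟩

theorem polyGauge_add_le (z w : ℂ) : polyGauge n (z + w) ≤ polyGauge n z + polyGauge n w := by
  rw [polyGauge_le_iff]
  intro i
  rw [map_add]
  exact add_le_add (le_polyGauge n i z) (le_polyGauge n i w)

theorem polyGauge_smul {c : ℝ} (hc : 0 ≤ c) (z : ℂ) :
    polyGauge n (c • z) = c * polyGauge n z := by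
  apply le_antisymm
  · rw [polyGauge_le_iff]
    intro i
    rw [map_smul, smul_eq_mul]
    exact mul_le_mul_of_nonneg_left (le_polyGauge n i z) hc
  · obtain ⟨i, hi⟩ := exists_polyGauge_eq n z
    rw [hi, ← smul_eq_mul, ← map_smul]
    exact le_polyGauge n i _

theorem polyGauge_zero : polyGauge n 0 = 0 := by
  have := polyGauge_smul n le_rfl 0
  simpa using this

theorem polyGauge_combo_le {a b : ℝ} (ha : 0 ≤ a) (hb : 0 ≤ b) (z w : ℂ) :
    polyGauge n (a • z + b • w) ≤ a * polyGauge n z + b * polyGauge n w := by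
  refine (polyGauge_add_le n _ _).trans_eq ?_
  rw [polyGauge_smul n ha, polyGauge_smul n hb]

theorem continuous_polyGauge : Continuous (polyGauge n) :=
  Continuous.finset_sup'_apply _ fun i _ => (n i).continuous

theorem polyGauge_pos (hpos : ∀ z, z ≠ 0 → ∃ i, 0 < n i z) {z : ℂ} (hz : z ≠ 0) :
    0 < polyGauge n z := by
  obtain ⟨i, hi⟩ := hpos z hz
  exact hi.trans_le (le_polyGauge n i z)

/-- Turning a translate about a common point of its boundary uncovers points monotonically.  The
vectors `A`, `T`, `B` on the boundary are in this order and `e` does not point into the cone of `A`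
and `B`; if `A + e` and `B + e` lie in the polygon, the first in its interior, then so does `T + e`. -/
theorem polyGauge_add_le_one_of_between {A B T e : ℂ} {s t x y : ℝ}
    (hA : polyGauge n A = 1) (hB : polyGauge n B = 1) (hT : polyGauge n T = 1)
    (hs : 0 ≤ s) (ht : 0 ≤ t) (hTe : T = s • A + t • B)
    (he : e = x • A + y • B) (hxy : ¬ (0 ≤ x ∧ 0 ≤ y))
    (hAe : polyGauge n (A + e) < 1) (hBe : polyGauge n (B + e) ≤ 1) :
    polyGauge n (T + e) ≤ 1 := by
  -- `T` is not inside the chord from `A` to `B`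
  have hst : 1 ≤ s + t := by
    have := polyGauge_combo_le n hs ht A B
    rw [← hTe, hA, hB, hT] at this
    linarith
  -- If `0 ≤ x + y`, then `A` or `B` is a mean of points of the polygon, one of them interior.
  rcases le_or_gt 0 (x + y) with hN | hN
  · exfalso
    rcases lt_or_ge y 0 with hy | hy
    · have h1 : (1 + x) • A = (1 : ℝ) • (A + e) + (-y) • B := by rw [he]; module
      have h2 := polyGauge_combo_le n zero_le_one (by linarith : 0 ≤ -y) (A + e) B
      rw [← h1, polyGauge_smul n (by linarith), hA, hB] at h2
      linarith
    · have hx : x < 0 := by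
        by_contra h
        exact hxy ⟨by linarith, hy⟩
      have h1 : (1 + y) • B = (1 : ℝ) • (B + e) + (-x) • A := by rw [he]; module
      have h2 := polyGauge_combo_le n zero_le_one (by linarith : 0 ≤ -x) (B + e) A
      rw [← h1, polyGauge_smul n (by linarith), hA, hB] at h2
      have hx' : x = -y := by linarith
      subst hx'
      have hy0 : 0 < y := by linarith
      rcases le_or_gt 1 y with h3 | h3
      · have h4 : y • B = (1 : ℝ) • (A + e) + (y - 1) • A := by rw [he]; module
        have h5 := polyGauge_combo_le n zero_le_one (by linarith : 0 ≤ y - 1) (A + e) A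
        rw [← h4, polyGauge_smul n hy, hA, hB] at h5
        linarith
      · have h4 : B = y • (A + e) + (1 - y) • (B + e) := by rw [he]; module
        have h5 := polyGauge_combo_le n hy (by linarith : 0 ≤ 1 - y) (A + e) (B + e)
        rw [← h4, hB] at h5
        nlinarith
  -- Otherwise `T + l e = p A + (1 - p) B` is on the line of `A` and `B`.
  · set l := (s + t - 1) / (-(x + y)) with hl
    have hl0 : 0 ≤ l := div_nonneg (by linarith) (by linarith)
    have hlN : l * (x + y) = 1 - s - t := by
      have : -(x + y) ≠ 0 := by linarith
      rw [hl, div_mul_eq_mul_div, div_eq_iff this]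
      ring
    set p := s + l * x with hp
    have hq : 1 - p = t + l * y := by rw [hp]; linarith
    rcases lt_or_ge p 0 with hp0 | hp0
    · exfalso
      have hlpos : 0 < l := by
        rcases hl0.lt_or_eq with h | h
        · exact h
        · rw [← h] at hp; linarith
      set m := min l (-p) with hm
      have hm0 : 0 < m := lt_min hlpos (by linarith)
      have hm1 : m ≤ l := min_le_left _ _
      have hm2 : m ≤ -p := min_le_right _ _
      have h1 : (1 - p + l - m) • B
          = (1 : ℝ) • ((1 : ℝ) • T + (-p - m) • A) + (1 : ℝ) • (m • (A + e) + (l - m) • (B + e)) := by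
        have h : (1 - p) • B = T + (-p) • A + l • e := by
          rw [hq, hTe, he, hp]; module
        have : (1 - p + l - m) • B = (1 - p) • B + (l - m) • B := by module
        rw [this, h]; module
      have h2 := polyGauge_combo_le n zero_le_one zero_le_one
        ((1 : ℝ) • T + (-p - m) • A) (m • (A + e) + (l - m) • (B + e))
      have h3 := polyGauge_combo_le n zero_le_one (by linarith : 0 ≤ -p - m) T A
      have h4 := polyGauge_combo_le n hm0.le (by linarith : 0 ≤ l - m) (A + e) (B + e)
      rw [← h1, polyGauge_smul n (by linarith), hB] at h2
      rw [hT, hA] at h3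
      have h5 : (l - m) * polyGauge n (B + e) ≤ l - m :=
        mul_le_of_le_one_right (by linarith) hBe
      have h6 : m * polyGauge n (A + e) < m := mul_lt_of_lt_one_right hm0 hAe
      linarith
    · rcases le_or_gt p 1 with hp1 | hp1
      · -- `T + e` is a mean of `T` and a point of the segment from `A + e` to `B + e`
        have h1 : (1 + l) • (T + e) = (1 : ℝ) • (p • (A + e) + (1 - p) • (B + e)) + l • T := by
          have : p • A + (1 - p) • B = T + l • e := by
            rw [hq, hTe, he, hp]; module
          have h : (1 : ℝ) • (p • (A + e) + (1 - p) • (B + e)) + l • T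
              = (p • A + (1 - p) • B) + e + l • T := by module
          rw [h, this]; module
        have h2 := polyGauge_combo_le n zero_le_one hl0 (p • (A + e) + (1 - p) • (B + e)) T
        have h3 := polyGauge_combo_le n hp0 (by linarith : 0 ≤ 1 - p) (A + e) (B + e)
        rw [← h1, polyGauge_smul n (by linarith), hT] at h2
        have h4 : p * polyGauge n (A + e) ≤ p := mul_le_of_le_one_right hp0 hAe.le
        have h5 : (1 - p) * polyGauge n (B + e) ≤ 1 - p :=
          mul_le_of_le_one_right (by linarith) hBe
        by_contra hcon
        push Not at hcon
        nlinarith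
      · exfalso
        have hlpos : 0 < l := by
          rcases hl0.lt_or_eq with h | h
          · exact h
          · rw [← h] at hq; linarith
        have h1 : (p + l) • A = (1 : ℝ) • ((1 : ℝ) • T + (p - 1) • B) + l • (A + e) := by
          have h : p • A = T + (p - 1) • B + l • e := by
            have : (p - 1) = -(t + l * y) := by linarith
            rw [this, hTe, he, hp]; module
          have : (p + l) • A = p • A + l • A := by module
          rw [this, h]; module
        have h2 := polyGauge_combo_le n zero_le_one hl0 ((1 : ℝ) • T + (p - 1) • B) (A + e)
        have h3 := polyGauge_combo_le n zero_le_one (by linarith : 0 ≤ p - 1) T B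
        rw [← h1, polyGauge_smul n (by linarith), hA] at h2
        rw [hT, hB] at h3
        have h6 : l * polyGauge n (A + e) < l := mul_lt_of_lt_one_right hlpos hAe
        linarith

/-- The cross product of two plane vectors. -/
def cross (z w : ℂ) : ℝ := z.re * w.im - z.im * w.re

theorem eq_coords_of_cross_ne_zero {A B : ℂ} (h : cross A B ≠ 0) (e : ℂ) :
    e = (cross e B / cross A B) • A + (cross A e / cross A B) • B := by
  apply Complex.ext
  · simp only [Complex.add_re, Complex.smul_re, smul_eq_mul]
    field_simp
    simp only [cross]; ring
  · simp only [Complex.add_im, Complex.smul_im, smul_eq_mul]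
    field_simp
    simp only [cross]; ring

theorem exists_smul_of_cross_eq_zero {A B : ℂ} (hA : A ≠ 0) (h : cross A B = 0) :
    ∃ c : ℝ, B = c • A := by
  have hN : A.re * A.re + A.im * A.im ≠ 0 := by
    have := Complex.normSq_pos.2 hA
    rw [Complex.normSq_apply] at this
    exact this.ne'
  simp only [cross] at h
  refine ⟨(B.re * A.re + B.im * A.im) / (A.re * A.re + A.im * A.im), ?_⟩
  apply Complex.ext
  · simp only [Complex.smul_re, smul_eq_mul]
    rw [div_mul_eq_mul_div, eq_div_iff hN]
    linear_combination (-A.im) * h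
  · simp only [Complex.smul_im, smul_eq_mul]
    rw [div_mul_eq_mul_div, eq_div_iff hN]
    linear_combination A.re * h

theorem cross_self (A : ℂ) : cross A A = 0 := by simp only [cross]; ring

theorem cross_add_right (A B D : ℂ) : cross A (B + D) = cross A B + cross A D := by
  simp only [cross, Complex.add_re, Complex.add_im]; ring

theorem cross_smul_right (A B : ℂ) (c : ℝ) : cross A (c • B) = c * cross A B := by
  simp only [cross, Complex.smul_re, Complex.smul_im, smul_eq_mul]; ring

end PolyGauge

/-! ### Moving a translate until its points lie on its boundary -/

section Moving

open Topology

variable {ι : Type} [Fintype ι] [Nonempty ι] (n : ι → ℂ →L[ℝ] ℝ)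

/-- A position `a` outside the line of `A` can be pushed away from `A` onto the boundary. -/
theorem exists_ray_exit (hpos : ∀ z, z ≠ 0 → ∃ i, 0 < n i z) {A a : ℂ} (hne : a ≠ A)
    (ha : polyGauge n a ≤ 1) :
    ∃ T : ℝ, 1 ≤ T ∧ polyGauge n (A + T • (a - A)) = 1 := by
  set d := polyGauge n (a - A) with hd
  have hd0 : 0 < d := polyGauge_pos n hpos (sub_ne_zero.2 hne)
  set S := max 1 ((1 + polyGauge n (-A)) / d) with hS
  have hS1 : 1 ≤ S := le_max_left _ _
  have hS2 : 1 + polyGauge n (-A) ≤ S * d := by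
    rw [← div_le_iff₀ hd0]; exact le_max_right _ _
  have hcont : ContinuousOn (fun T : ℝ => polyGauge n (A + T • (a - A))) (Set.Icc 1 S) :=
    ((continuous_polyGauge n).comp (by fun_prop)).continuousOn
  have h1 : polyGauge n (A + (1 : ℝ) • (a - A)) ≤ 1 := by simpa using ha
  have h2 : 1 ≤ polyGauge n (A + S • (a - A)) := by
    have := polyGauge_add_le n (A + S • (a - A)) (-A)
    rw [show A + S • (a - A) + -A = S • (a - A) by abel, polyGauge_smul n (by linarith)] at this
    linarith
  obtain ⟨T, hT, hT'⟩ := intermediate_value_Icc hS1 hcont ⟨h1, h2⟩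
  exact ⟨T, hT.1, hT'⟩

/-- The hypotheses on the possible positions `e` of the points of a tile relative to a quadrant
centre: seen from a suitable point `A` of the boundary all points `A + e` lie in the interior of the
polygon, seen from the opposite point of the boundary none lies in it, and whenever `e` is a chord
of the polygon starting in a boundary point `B`, it does not point into the cone of `A` and `B`. -/
structure Reachable (E : Set ℂ) (A : ℂ) : Prop where
  pos : ∀ z, z ≠ 0 → ∃ i, 0 < n i z
  gauge_eq : polyGauge n A = 1
  near : ∀ e ∈ E, polyGauge n (A + e) < 1
  far : ∀ e ∈ E, ∀ κ : ℝ, 0 < κ → polyGauge n (κ • -A) = 1 → 1 < polyGauge n (κ • -A + e)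
  cone : ∀ e ∈ E, ∀ B, polyGauge n B = 1 → polyGauge n (B + e) ≤ 1 →
    ∀ x y : ℝ, e = x • A + y • B → ¬ (0 ≤ x ∧ 0 ≤ y)

variable {n}

/-- From every position of a translate containing the quadrant centre, there is a way to a position
in which it contains no point of the tile, on which no point enters the translate. -/
theorem Reachable.exists_walk {E : Set ℂ} {A : ℂ} (h : Reachable n E A) {a₀ : ℂ}
    (ha₀ : polyGauge n a₀ ≤ 1) :
    ∃ K : Set ℂ, IsCompact K ∧ IsPreconnected K ∧ a₀ ∈ K ∧
      (∃ a₁ ∈ K, ∀ e ∈ E, 1 < polyGauge n (a₁ + e)) ∧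
      ∀ a ∈ K, polyGauge n a ≤ 1 ∧
        ∀ e ∈ E, 1 < polyGauge n (a₀ + e) → 1 < polyGauge n (a + e) := by
  have hA0 : A ≠ 0 := by
    rintro rfl
    have := h.gauge_eq
    rw [polyGauge_zero] at this
    norm_num at this
  have hg0 : 0 < polyGauge n (-A) := polyGauge_pos n h.pos (neg_ne_zero.2 hA0)
  set κ := (polyGauge n (-A))⁻¹ with hκ
  have hκ0 : 0 < κ := inv_pos.2 hg0
  have hκ1 : polyGauge n (κ • -A) = 1 := by
    rw [polyGauge_smul n hκ0.le, hκ, inv_mul_cancel₀ hg0.ne']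
  have hfar : ∀ e ∈ E, 1 < polyGauge n (κ • -A + e) := fun e he => h.far e he κ hκ0 hκ1
  -- On a ray from `A`, points only leave the translate.
  have hray : ∀ a : ℂ, ∀ w : ℝ, 0 ≤ w → w ≤ 1 → a₀ = w • A + (1 - w) • a →
      ∀ e ∈ E, 1 < polyGauge n (a₀ + e) → 1 < polyGauge n (a + e) := by
    intro a w hw0 hw1 ha e he hlt
    by_contra hcon
    push Not at hcon
    have h1 : a₀ + e = w • (A + e) + (1 - w) • (a + e) := by rw [ha]; module
    have h2 := polyGauge_combo_le n hw0 (by linarith : 0 ≤ 1 - w) (A + e) (a + e)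
    rw [← h1] at h2
    have h3 : w * polyGauge n (A + e) ≤ w := mul_le_of_le_one_right hw0 (h.near e he).le
    have h4 : (1 - w) * polyGauge n (a + e) ≤ 1 - w := mul_le_of_le_one_right (by linarith) hcon
    linarith
  have hseg : ∀ a b : ℂ, IsCompact (segment ℝ a b) := by
    intro a b
    rw [segment_eq_image]
    exact isCompact_Icc.image (by fun_prop)
  have hconvball : ∀ a b : ℂ, polyGauge n a ≤ 1 → polyGauge n b ≤ 1 → ∀ s t : ℝ, 0 ≤ s → 0 ≤ t →
      s + t = 1 → polyGauge n (s • a + t • b) ≤ 1 := by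
    intro a b ha hb s t hs ht hst
    have h2 := polyGauge_combo_le n hs ht a b
    have h3 : s * polyGauge n a ≤ s := mul_le_of_le_one_right hs ha
    have h4 : t * polyGauge n b ≤ t := mul_le_of_le_one_right ht hb
    linarith
  -- On the line of `A`, it suffices to move straight to the position opposite to `A`; otherwise the
  -- walk continues along the boundary from the end `B` of the ray.
  by_cases hcr : cross A a₀ = 0
  · obtain ⟨c, rfl⟩ := exists_smul_of_cross_eq_zero hA0 hcr
    have hc1 : c ≤ 1 := by
      rcases le_or_gt 0 c with hc | hc
      · rw [polyGauge_smul n hc, h.gauge_eq] at ha₀; linarith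
      · linarith
    have hcκ : -κ ≤ c := by
      rcases le_or_gt 0 c with hc | hc
      · linarith
      · have : c • A = (-c) • (-A) := by module
        rw [this, polyGauge_smul n (by linarith)] at ha₀
        have : -c ≤ κ := by
          rw [hκ, ← one_div, le_div_iff₀ hg0]; exact ha₀
        linarith
    refine ⟨segment ℝ (c • A) (κ • -A), hseg _ _, (convex_segment _ _).isPreconnected,
      left_mem_segment _ _ _, ⟨_, right_mem_segment _ _ _, hfar⟩, ?_⟩
    rintro _ ⟨s, t, hs, ht, hst, rfl⟩
    refine ⟨hconvball _ _ ha₀ hκ1.le s t hs ht hst, ?_⟩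
    have hval : s * c - t * κ ≤ c := by nlinarith
    rcases hval.eq_or_lt with heq | hlt
    · have : s • c • A + t • κ • -A = c • A := by
        rw [show s • c • A + t • κ • -A = (s * c - t * κ) • A by module, heq]
      rw [this]
      exact fun _ _ h => h
    · have hden : 0 < 1 - (s * c - t * κ) := by linarith
      refine hray _ ((c - (s * c - t * κ)) / (1 - (s * c - t * κ))) ?_ ?_ ?_
      · exact div_nonneg (by linarith) hden.le
      · rw [div_le_one hden]; linarith
      · have e1 : s • c • A + t • κ • -A = (s * c - t * κ) • A := by module
        rw [e1, smul_smul, ← add_smul]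
        congr 1
        generalize s * c - t * κ = q at hden
        have hden' : 1 - q ≠ 0 := hden.ne'
        field_simp
        ring
  · have hne : a₀ ≠ A := by
      rintro rfl
      exact hcr (cross_self _)
    obtain ⟨T, hT1, hTB⟩ := exists_ray_exit n h.pos hne ha₀
    set B := A + T • (a₀ - A) with hB
    have hcrB : cross A B = T * cross A a₀ := by
      have : B = (1 - T) • A + T • a₀ := by rw [hB]; module
      rw [this, cross_add_right, cross_smul_right, cross_smul_right, cross_self]; ring
    have hcrB' : cross A B ≠ 0 := by
      rw [hcrB]; exact mul_ne_zero (by linarith) hcr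
    have hBE : ∀ e ∈ E, 1 < polyGauge n (a₀ + e) → 1 < polyGauge n (B + e) := by
      refine hray B (1 - 1 / T) ?_ ?_ ?_
      · rw [sub_nonneg, div_le_one (by linarith)]; exact hT1
      · have : 0 < 1 / T := by positivity
        linarith
      · have hT0 : T ≠ 0 := by linarith
        have e1 : (1 - (1 - 1 / T)) • B = (1 / T) • A + (1 / T * T) • (a₀ - A) := by
          rw [hB]; module
        rw [e1, one_div_mul_cancel hT0]; module
    have hvne : ∀ v ∈ segment ℝ B (κ • -A), v ≠ 0 := by
      rintro _ ⟨s, t, hs, ht, hst, rfl⟩ h0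
      rcases hs.lt_or_eq with hs | rfl
      · have := congrArg (cross A) h0
        rw [cross_add_right, cross_smul_right, cross_smul_right,
          show κ • -A = (-κ) • A by module, cross_smul_right, cross_self] at this
        have h0' : cross A 0 = 0 := by simp [cross]
        rw [h0'] at this
        have : s * cross A B = 0 := by linarith
        rcases mul_eq_zero.1 this with h | h
        · linarith
        · exact hcrB' h
      · rw [zero_add] at hst
        rw [hst, zero_smul, zero_add, one_smul] at h0
        rw [h0, polyGauge_zero] at hκ1
        norm_num at hκ1
    -- the arc of the boundary is the radial projection of a chord
    set f : ℂ → ℂ := fun v => (polyGauge n v)⁻¹ • v with hf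
    have hfc : ContinuousOn f (segment ℝ B (κ • -A)) := by
      refine ContinuousOn.smul (ContinuousOn.inv₀ (continuous_polyGauge n).continuousOn ?_)
        continuousOn_id
      intro v hv
      exact (polyGauge_pos n h.pos (hvne v hv)).ne'
    have hfB : f B = B := by simp only [hf, hTB, inv_one, one_smul]
    have hfA : f (κ • -A) = κ • -A := by simp only [hf, hκ1, inv_one, one_smul]
    refine ⟨segment ℝ a₀ B ∪ f '' segment ℝ B (κ • -A),
      (hseg _ _).union ((hseg _ _).image_of_continuousOn hfc),
      IsPreconnected.union B (right_mem_segment _ _ _) ⟨B, left_mem_segment _ _ _, hfB⟩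
        (convex_segment _ _).isPreconnected ((convex_segment _ _).isPreconnected.image _ hfc),
      Or.inl (left_mem_segment _ _ _), ⟨κ • -A, Or.inr ⟨_, right_mem_segment _ _ _, hfA⟩, hfar⟩, ?_⟩
    rintro a (⟨s, t, hs, ht, hst, rfl⟩ | ⟨v, hv, rfl⟩)
    · refine ⟨hconvball _ _ ha₀ hTB.le s t hs ht hst, ?_⟩
      set q := s + t * T with hq
      have hq1 : 1 ≤ q := by nlinarith
      refine hray _ (1 - 1 / q) ?_ ?_ ?_
      · rw [sub_nonneg, div_le_one (by linarith)]; exact hq1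
      · have : 0 < 1 / q := by positivity
        linarith
      · have hq0 : q ≠ 0 := by linarith
        have e0 : s • a₀ + t • B = A + q • (a₀ - A) := by
          have : s • a₀ + t • B = (s + t) • A + q • (a₀ - A) := by rw [hB, hq]; module
          rw [this, hst, one_smul]
        have e1 : (1 - (1 - 1 / q)) • (A + q • (a₀ - A)) = (1 / q) • A + (1 / q * q) • (a₀ - A) := by
          module
        rw [e0, e1, one_div_mul_cancel hq0]; module
    · have hgv := polyGauge_pos n h.pos (hvne v hv)
      have hga : polyGauge n (f v) = 1 := by
        simp only [hf]
        rw [polyGauge_smul n (inv_nonneg.2 hgv.le), inv_mul_cancel₀ hgv.ne']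
      refine ⟨hga.le, fun e he hlt => ?_⟩
      obtain ⟨s, t, hs, ht, hst, rfl⟩ := hv
      rcases hs.lt_or_eq with hs | rfl
      · set v := s • B + t • κ • -A with hv
        by_contra hcon
        push Not at hcon
        have hcrv : cross A (f v) ≠ 0 := by
          have hcv : cross A v = s * cross A B := by
            rw [hv, cross_add_right, cross_smul_right, cross_smul_right,
              show κ • -A = (-κ) • A by module, cross_smul_right, cross_self]
            ring
          simp only [hf]
          rw [cross_smul_right, hcv]
          exact mul_ne_zero (inv_ne_zero hgv.ne') (mul_ne_zero hs.ne' hcrB')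
        have hBeq : B = (t * κ / s) • A + (polyGauge n v / s) • f v := by
          have e1 : (polyGauge n v / s) • f v = (1 / s) • v := by
            simp only [hf]
            rw [smul_smul]
            congr 1
            field_simp
          have e2 : (1 / s) • v = (1 / s * s) • B + (-(t * κ / s)) • A := by
            rw [hv]; module
          rw [e1, e2, one_div_mul_cancel hs.ne']; module
        have hco := eq_coords_of_cross_ne_zero hcrv e
        have := polyGauge_add_le_one_of_between n h.gauge_eq hga hTB (by positivity) (by positivity)
          hBeq hco (h.cone e he _ hga hcon _ _ hco) (h.near e he) hcon
        exact absurd (hBE e he hlt) (not_lt.2 this)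
      · rw [zero_add] at hst
        rw [hst, zero_smul, zero_add, one_smul, hfA]
        exact hfar e he

end Moving

section Extreme

open Topology Pointwise

variable {ι : Type} [Fintype ι] [Nonempty ι] {n : ι → ℂ →L[ℝ] ℝ}

theorem exists_level_point {K E : Set ℂ} (hK : IsPreconnected K) (hE : E.Finite)
    (h0 : ∃ a ∈ K, ∃ e ∈ E, polyGauge n (a + e) < 1)
    (h1 : ∃ a ∈ K, ∀ e ∈ E, 1 < polyGauge n (a + e)) :
    ∃ a ∈ K, (∀ e ∈ E, 1 ≤ polyGauge n (a + e)) ∧ ∃ e ∈ E, polyGauge n (a + e) = 1 := by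
  have hc : ∀ e : ℂ, Continuous fun a => polyGauge n (a + e) := fun e =>
    (continuous_polyGauge n).comp (by fun_prop)
  have hU0 : IsOpen {a : ℂ | ∃ e ∈ E, polyGauge n (a + e) < 1} := by
    simp only [← exists_prop, Set.ofPred_exists]
    exact isOpen_iUnion fun e => isOpen_iUnion fun _ => isOpen_lt (hc e) continuous_const
  have hU1 : IsOpen {a : ℂ | ∀ e ∈ E, 1 < polyGauge n (a + e)} := by
    simp only [Set.ofPred_forall]
    exact hE.isOpen_biInter fun e _ => isOpen_lt continuous_const (hc e)
  by_contra! hcon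
  obtain ⟨a, -, ha0, ha1⟩ := hK _ _ hU0 hU1 (by
    intro a ha
    by_cases hlt : ∃ e ∈ E, polyGauge n (a + e) < 1
    · exact Or.inl hlt
    · push Not at hlt
      exact Or.inr fun e he => lt_of_le_of_ne (hlt e he) (hcon a ha hlt e he).symm) h0 h1
  obtain ⟨e, he, hlt⟩ := ha0
  exact absurd (ha1 e he) (not_lt.2 hlt.le)

theorem isPreconnected_ball_diff_finite (c : ℂ) {r : ℝ} (hr : 0 < r) {S : Set ℂ} (hS : S.Finite) :
    IsPreconnected (Metric.ball c r \ S) := by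
  set f := OpenPartialHomeomorph.univBall c r with hf
  have hinj : Function.Injective f := by
    have := f.injOn
    rwa [OpenPartialHomeomorph.univBall_source, Set.injOn_univ] at this
  have hcount : (f ⁻¹' S).Countable := (hS.preimage hinj.injOn).countable
  have hconn := (hcount.isConnected_compl_of_one_lt_rank
    (Complex.rank_real_complex ▸ Nat.one_lt_ofNat)).isPreconnected
  have himg : f '' (f ⁻¹' S)ᶜ = Metric.ball c r \ S := by
    rw [← Set.preimage_compl, Set.image_preimage_eq_inter_range, Set.inter_comm,
      ← Set.image_univ, ← OpenPartialHomeomorph.univBall_source c r, f.image_source_eq_target,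
      OpenPartialHomeomorph.univBall_target c hr]
    rfl
  rw [← himg]
  exact hconn.image _ (OpenPartialHomeomorph.continuous_univBall c r).continuousOn

/-- The walk, pushed slightly inwards, passes a position in which the quadrant centre is in the
interior of the translate while the points of the tile in the translate lie on its boundary. -/
theorem Reachable.exists_level_position {E : Set ℂ} {A : ℂ} (h : Reachable n E A) (hE : E.Finite)
    {a₀ : ℂ} (ha₀ : polyGauge n a₀ ≤ 1) (hex : ∃ e ∈ E, polyGauge n (a₀ + e) ≤ 1) :
    ∃ a, polyGauge n a < 1 ∧ (∀ e ∈ E, 1 ≤ polyGauge n (a + e)) ∧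
      (∃ e ∈ E, polyGauge n (a + e) = 1) ∧
      ∀ e ∈ E, 1 < polyGauge n (a₀ + e) → 1 < polyGauge n (a + e) := by
  have hgc := continuous_polyGauge n
  obtain ⟨K, hKc, hKp, ha₀K, ⟨a₁, ha₁K, ha₁⟩, hK⟩ := h.exists_walk ha₀
  -- a position slightly inside `A`, in which all points are still covered
  obtain ⟨z, hz, hzE⟩ : ∃ z, polyGauge n z < 1 ∧ ∀ e ∈ E, polyGauge n (z + e) < 1 := by
    have hev : ∀ᶠ η in 𝓝[>] (0 : ℝ), ∀ e ∈ E, polyGauge n ((1 - η) • A + e) < 1 := by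
      rw [hE.eventually_all]
      intro e he
      have hcont : Continuous fun η : ℝ => polyGauge n ((1 - η) • A + e) := hgc.comp (by fun_prop)
      have : ∀ᶠ η in 𝓝 (0 : ℝ), polyGauge n ((1 - η) • A + e) < 1 := by
        apply hcont.tendsto 0 |>.eventually_lt_const
        simpa using h.near e he
      exact this.filter_mono nhdsWithin_le_nhds
    have hev' : ∀ᶠ η in 𝓝[>] (0 : ℝ), η ∈ Set.Ioo (0 : ℝ) 1 := Ioo_mem_nhdsGT one_pos
    obtain ⟨η, h1, h2⟩ := (hev.and hev').exists
    refine ⟨(1 - η) • A, ?_, h1⟩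
    rw [polyGauge_smul n (by linarith [h2.2]), h.gauge_eq]
    linarith [h2.1]
  have hev1 : ∀ᶠ ε in 𝓝 (0 : ℝ), ∀ a ∈ K, ∀ e ∈ E, 1 < polyGauge n (a₀ + e) →
      1 < polyGauge n ((1 - ε) • a + ε • z + e) := by
    apply hKc.eventually_forall_of_forall_eventually
    intro a ha
    rw [hE.eventually_all]
    intro e he
    by_cases hlt : 1 < polyGauge n (a₀ + e)
    · have hcont : Continuous fun p : ℝ × ℂ => polyGauge n ((1 - p.1) • p.2 + p.1 • z + e) :=
        hgc.comp (by fun_prop)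
      have := (hcont.tendsto (0, a)).eventually_const_lt (u := 1) (by
        simpa using (hK a ha).2 e he hlt)
      filter_upwards [this] with p hp _ using hp
    · exact Filter.Eventually.of_forall fun _ h => absurd h hlt
  have hev2 : ∀ᶠ ε in 𝓝 (0 : ℝ), ∀ e ∈ E, 1 < polyGauge n ((1 - ε) • a₁ + ε • z + e) := by
    rw [hE.eventually_all]
    intro e he
    have hcont : Continuous fun ε : ℝ => polyGauge n ((1 - ε) • a₁ + ε • z + e) :=
      hgc.comp (by fun_prop)
    exact (hcont.tendsto 0).eventually_const_lt (u := 1) (by simpa using ha₁ e he)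
  have hev3 : ∀ᶠ ε in 𝓝[>] (0 : ℝ), ε ∈ Set.Ioo (0 : ℝ) 1 := Ioo_mem_nhdsGT one_pos
  obtain ⟨ε, ⟨h1, h2⟩, h3, h4⟩ :=
    (((hev1.and hev2).filter_mono nhdsWithin_le_nhds).and hev3).exists
  have hcomb : ∀ a b : ℂ, polyGauge n a ≤ 1 → polyGauge n b < 1 →
      polyGauge n ((1 - ε) • a + ε • b) < 1 := by
    intro a b ha hb
    have := polyGauge_combo_le n (by linarith : 0 ≤ 1 - ε) h3.le a b
    nlinarith
  have hpre : IsPreconnected ((fun a => (1 - ε) • a + ε • z) '' K) :=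
    hKp.image _ (by fun_prop)
  obtain ⟨_, ⟨a, ha, rfl⟩, hge, hone⟩ := exists_level_point (n := n) hpre hE
    ⟨_, ⟨a₀, ha₀K, rfl⟩, by
      obtain ⟨e, he, hle⟩ := hex
      refine ⟨e, he, ?_⟩
      rw [show (1 - ε) • a₀ + ε • z + e = (1 - ε) • (a₀ + e) + ε • (z + e) by module]
      exact hcomb _ _ hle (hzE e he)⟩
    ⟨_, ⟨a₁, ha₁K, rfl⟩, h2⟩
  exact ⟨_, hcomb _ _ (hK a ha).1 hz, hge, hone, h1 a ha⟩

/-- As only finitely many positions put points of the tile on two different edges, a position with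
the points on a single edge can be chosen. -/
theorem Reachable.exists_generic_position {E : Set ℂ} {A : ℂ} (h : Reachable n E A) (hE : E.Finite)
    (hbad : ∀ i j, n i ≠ n j → ∀ e ∈ E, ∀ e' ∈ E,
      {a : ℂ | n i (a + e) = 1 ∧ n j (a + e') = 1}.Subsingleton)
    {a₀ : ℂ} (ha₀ : polyGauge n a₀ ≤ 1) (hex : ∃ e ∈ E, polyGauge n (a₀ + e) ≤ 1) :
    ∃ a, polyGauge n a < 1 ∧ (∀ e ∈ E, 1 ≤ polyGauge n (a + e)) ∧
      (∃ e ∈ E, polyGauge n (a + e) = 1) ∧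
      (∀ e ∈ E, 1 < polyGauge n (a₀ + e) → 1 < polyGauge n (a + e)) ∧
      ∀ i j, ∀ e ∈ E, ∀ e' ∈ E, n i (a + e) = 1 → n j (a + e') = 1 → n i = n j := by
  have hgc := continuous_polyGauge n
  obtain ⟨b, hb, hbE, ⟨e₀, he₀, hbe₀⟩, hbσ⟩ := h.exists_level_position hE ha₀ hex
  -- the finitely many positions to avoid
  set S : Set ℂ := ⋃ i, ⋃ j, ⋃ e ∈ E, ⋃ e' ∈ E,
    {a : ℂ | n i ≠ n j ∧ n i (a + e) = 1 ∧ n j (a + e') = 1} with hS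
  have hSfin : S.Finite := by
    refine Set.finite_iUnion fun i => Set.finite_iUnion fun j => hE.biUnion fun e he =>
      hE.biUnion fun e' he' => ?_
    by_cases hij : n i = n j
    · simp [hij]
    · exact ((hbad i j hij e he e' he').anti fun a ha => ha.2).finite
  have hO : IsOpen {a : ℂ | polyGauge n a < 1 ∧
      ∀ e ∈ E, 1 < polyGauge n (a₀ + e) → 1 < polyGauge n (a + e)} := by
    rw [Set.ofPred_and]
    refine (isOpen_lt hgc continuous_const).inter ?_
    simp only [Set.ofPred_forall]
    refine hE.isOpen_biInter fun e _ => isOpen_iInter_of_finite fun _ => ?_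
    exact isOpen_lt continuous_const (hgc.comp (by fun_prop))
  obtain ⟨r, hr, hball⟩ := Metric.isOpen_iff.1 hO b ⟨hb, hbσ⟩
  have hmeet : ∀ U : Set ℂ, IsOpen U → (∃ a ∈ Metric.ball b r, a ∈ U) →
      ∃ a ∈ Metric.ball b r \ S, a ∈ U := by
    rintro U hU ⟨a, ha, haU⟩
    have hinf : (Metric.ball b r ∩ U).Infinite :=
      infinite_of_mem_nhds a ((Metric.isOpen_ball.inter hU).mem_nhds ⟨ha, haU⟩)
    obtain ⟨x, hx⟩ := (hinf.sdiff hSfin).nonempty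
    exact ⟨x, ⟨hx.1.1, hx.2⟩, hx.1.2⟩
  -- Moving from `b` towards `A` puts `e₀` in the interior, and moving away from `A` puts all points
  -- outside; a ball without the positions to avoid is still connected.
  have hcA : Continuous fun η : ℝ => b + η • (A - b) := by fun_prop
  have hev : ∀ᶠ η in 𝓝 (0 : ℝ), b + η • (A - b) ∈ Metric.ball b r :=
    (hcA.tendsto 0).eventually (by
      rw [zero_smul, add_zero]; exact Metric.ball_mem_nhds b hr)
  obtain ⟨δ, hδ, hδr⟩ := Metric.eventually_nhds_iff.1 hev
  set η := min (δ / 2) (1 / 2) with hη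
  have hη0 : 0 < η := by positivity
  have hη1 : η ≤ 1 / 2 := min_le_right _ _
  have hηδ : η < δ := (min_le_left _ _).trans_lt (by linarith)
  have hp : b + η • (A - b) ∈ Metric.ball b r := hδr (by
    rw [dist_zero_right, Real.norm_eq_abs, abs_of_pos hη0]; exact hηδ)
  have hm : b + (-η) • (A - b) ∈ Metric.ball b r := hδr (by
    rw [dist_zero_right, Real.norm_eq_abs, abs_neg, abs_of_pos hη0]; exact hηδ)
  have hU0 : IsOpen {a : ℂ | polyGauge n (a + e₀) < 1} :=
    isOpen_lt (hgc.comp (by fun_prop)) continuous_const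
  have hU1 : IsOpen {a : ℂ | ∀ e ∈ E, 1 < polyGauge n (a + e)} := by
    simp only [Set.ofPred_forall]
    exact hE.isOpen_biInter fun e _ => isOpen_lt continuous_const (hgc.comp (by fun_prop))
  obtain ⟨x, hx, hxU⟩ := hmeet _ hU0 ⟨_, hp, by
    have e1 : b + η • (A - b) + e₀ = (1 - η) • (b + e₀) + η • (A + e₀) := by module
    have e2 := polyGauge_combo_le n (by linarith : 0 ≤ 1 - η) hη0.le (b + e₀) (A + e₀)
    have e3 := h.near e₀ he₀
    change polyGauge n (b + η • (A - b) + e₀) < 1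
    rw [e1]
    rw [hbe₀] at e2
    nlinarith⟩
  obtain ⟨y, hy, hyU⟩ := hmeet _ hU1 ⟨_, hm, by
    intro e he
    have e1 : (1 + η) • (b + e) = (1 : ℝ) • (b + (-η) • (A - b) + e) + η • (A + e) := by module
    have e2 := polyGauge_combo_le n zero_le_one hη0.le (b + (-η) • (A - b) + e) (A + e)
    have e3 := h.near e he
    have e4 := hbE e he
    rw [← e1, polyGauge_smul n (by linarith)] at e2
    nlinarith⟩
  obtain ⟨a, ⟨haB, haS⟩, hge, hone⟩ := exists_level_point (n := n)
    (isPreconnected_ball_diff_finite b hr hSfin) hE ⟨x, hx, e₀, he₀, hxU⟩ ⟨y, hy, hyU⟩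
  refine ⟨a, (hball haB).1, hge, hone, (hball haB).2, ?_⟩
  intro i j e he e' he' h1 h2
  by_contra hij
  apply haS
  simp only [hS, Set.mem_iUnion]
  exact ⟨i, j, e, he, e', he', hij, h1, h2⟩

theorem convex_polyGauge_le (n : ι → ℂ →L[ℝ] ℝ) : Convex ℝ {z | polyGauge n z ≤ 1} := by
  intro x hx y hy a b ha hb hab
  have := polyGauge_combo_le n ha hb x y
  change polyGauge n x ≤ 1 at hx
  change polyGauge n y ≤ 1 at hy
  change polyGauge n (a • x + b • y) ≤ 1
  nlinarith

theorem polyGauge_le_mem_nhds_zero (n : ι → ℂ →L[ℝ] ℝ) : {z | polyGauge n z ≤ 1} ∈ 𝓝 (0 : ℂ) := by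
  have : {z | polyGauge n z < 1} ∈ 𝓝 (0 : ℂ) :=
    (isOpen_lt (continuous_polyGauge n) continuous_const).mem_nhds (by
      change polyGauge n 0 < 1
      rw [polyGauge_zero]; exact one_pos)
  exact Filter.mem_of_superset this fun z (hz : polyGauge n z < 1) => hz.le

theorem gauge_eq_polyGauge (hpos : ∀ z, z ≠ 0 → ∃ i, 0 < n i z) (z : ℂ) :
    gauge {z | polyGauge n z ≤ 1} z = polyGauge n z := by
  have hmem : ∀ r : ℝ, 0 < r → (z ∈ r • {z | polyGauge n z ≤ 1} ↔ polyGauge n z ≤ r) := by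
    intro r hr
    rw [Set.mem_smul_set_iff_inv_smul_mem₀ hr.ne']
    change polyGauge n (r⁻¹ • z) ≤ 1 ↔ _
    rw [polyGauge_smul n (inv_nonneg.2 hr.le), inv_mul_le_iff₀ hr, mul_one]
  apply le_antisymm
  · rcases eq_or_ne z 0 with rfl | hz
    · rw [gauge_zero, polyGauge_zero]
    · have := polyGauge_pos n hpos hz
      exact gauge_le_of_mem this.le ((hmem _ this).2 le_rfl)
  · rw [gauge_def]
    have hmax : 0 < max 1 (polyGauge n z) := lt_max_of_lt_left one_pos
    refine le_csInf ⟨max 1 (polyGauge n z), hmax, (hmem _ hmax).2 (le_max_right _ _)⟩ ?_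
    · rintro r ⟨hr, hr'⟩
      exact (hmem r hr).1 hr'

theorem mem_frontier_iff_polyGauge (hpos : ∀ z, z ≠ 0 → ∃ i, 0 < n i z) {z : ℂ} :
    z ∈ frontier {z | polyGauge n z ≤ 1} ↔ polyGauge n z = 1 := by
  rw [← gauge_eq_one_iff_mem_frontier (convex_polyGauge_le n) (polyGauge_le_mem_nhds_zero n),
    gauge_eq_polyGauge hpos]

theorem mem_reflectedCopy {C : Set ℂ} {c x : ℂ} : x ∈ reflectedCopy C c ↔ c - x ∈ C := by
  constructor
  · rintro ⟨z, hz, rfl⟩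
    simpa using hz
  · intro h
    exact ⟨c - x, h, by simp⟩

theorem mem_frontier_reflectedCopy {C : Set ℂ} {c x : ℂ} :
    x ∈ frontier (reflectedCopy C c) ↔ c - x ∈ frontier C := by
  have : reflectedCopy C c = (Homeomorph.subLeft c) ⁻¹' C := by
    ext z; rw [mem_reflectedCopy]; rfl
  rw [this, ← Homeomorph.preimage_frontier]; rfl

/-- A translate that contains the quadrant centre and a point of the tile contains an extreme
point. -/
theorem Reachable.exists_mem_extremePoints {Q : Set ℂ} {o A : ℂ} (hQ : Q.Finite)
    (h : Reachable n ((fun q => q - o) '' Q) A)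
    (hbad : ∀ i j, n i ≠ n j → ∀ e ∈ (fun q => q - o) '' Q, ∀ e' ∈ (fun q => q - o) '' Q,
      {a : ℂ | n i (a + e) = 1 ∧ n j (a + e') = 1}.Subsingleton)
    {c : ℂ} (ho : polyGauge n (o - c) ≤ 1) (hex : ∃ q ∈ Q, polyGauge n (q - c) ≤ 1) :
    ∃ p ∈ extremePoints {z | polyGauge n z ≤ 1} Q o, polyGauge n (p - c) ≤ 1 := by
  have hgc := continuous_polyGauge n
  obtain ⟨a, ha, hge, ⟨_, ⟨p, hp, rfl⟩, hpa⟩, hσ, hone⟩ := h.exists_generic_position (hQ.image _)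
    hbad (a₀ := o - c) ho (by
      obtain ⟨q, hq, hqc⟩ := hex
      exact ⟨_, ⟨q, hq, rfl⟩, by simpa using hqc⟩)
  simp only [Set.forall_mem_image] at hge hσ hone
  have hcell : o - a ∈ interior (cell {z | polyGauge n z ≤ 1} Q p) := by
    rw [mem_interior_iff_mem_nhds]
    -- near `o - a`, the distances of the nearest points are given by one linear functional
    obtain ⟨i, hi⟩ := exists_polyGauge_eq n (a + (p - o))
    rw [hpa] at hi
    have hloc : ∀ q ∈ Q, polyGauge n (a + (q - o)) = 1 → ∀ᶠ x in 𝓝 (o - a),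
        polyGauge n (q - x) = n i (q - x) := by
      intro q hq hqa
      have hall : ∀ᶠ x in 𝓝 (o - a), ∀ j, n j ≠ n i → n j (q - x) < n i (q - x) := by
        rw [Filter.eventually_all]
        intro j
        by_cases hj : n j = n i
        · simp [hj]
        · have hlt : n j (a + (q - o)) < n i (a + (q - o)) := by
            obtain ⟨l, hl⟩ := exists_polyGauge_eq n (a + (q - o))
            rw [hqa] at hl
            have hli : n i = n l := hone i l hp hq hi.symm hl.symm
            rw [hli, ← hl]
            refine lt_of_le_of_ne ((le_polyGauge n j _).trans_eq hqa) fun h1 => hj ?_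
            rw [hli]
            exact hone j l hq hq h1 hl.symm
          have hc1 : Continuous fun x => n j (q - x) := (n j).continuous.comp (by fun_prop)
          have hc2 : Continuous fun x => n i (q - x) := (n i).continuous.comp (by fun_prop)
          have := (isOpen_lt hc1 hc2).mem_nhds (x := o - a) (by
            change n j (q - (o - a)) < n i (q - (o - a))
            rwa [show q - (o - a) = a + (q - o) by ring])
          filter_upwards [this] with x hx _ using hx
      filter_upwards [hall] with x hx
      refine le_antisymm ((polyGauge_le_iff n).2 fun j => ?_) (le_polyGauge n i _)
      by_cases hj : n j = n i
      · rw [hj]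
      · exact (hx j hj).le
    have : ∀ᶠ x in 𝓝 (o - a), ∀ q ∈ Q, polyGauge n (p - x) ≤ polyGauge n (q - x) := by
      rw [hQ.eventually_all]
      intro q hq
      rcases (hge hq).eq_or_lt with heq | hlt
      · filter_upwards [hloc p hp hpa, hloc q hq heq.symm] with x hxp hxq
        rw [hxp, hxq]
        have hival : n i (a + (q - o)) = 1 := by
          obtain ⟨l, hl⟩ := exists_polyGauge_eq n (a + (q - o))
          rw [← heq] at hl
          rw [hone i l hp hq hi.symm hl.symm, ← hl]
        simp only [map_add, map_sub] at hi hival ⊢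
        linarith
      · have hc1 : Continuous fun x => polyGauge n (p - x) := hgc.comp (by fun_prop)
        have hc2 : Continuous fun x => polyGauge n (q - x) := hgc.comp (by fun_prop)
        have := (isOpen_lt hc1 hc2).mem_nhds (x := o - a) (by
          change polyGauge n (p - (o - a)) < polyGauge n (q - (o - a))
          rwa [show q - (o - a) = a + (q - o) by ring, show p - (o - a) = a + (p - o) by ring, hpa])
        filter_upwards [this] with x hx using le_of_lt hx
    filter_upwards [this] with x hx q hq
    rw [convexDist, convexDist, gauge_eq_polyGauge h.pos, gauge_eq_polyGauge h.pos]
    exact hx q hq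
  refine ⟨p, ⟨hp, ⟨o - a, ⟨?_, ?_⟩, hcell⟩, ?_⟩, ?_⟩
  · rw [mem_reflectedCopy, sub_sub_cancel]
    exact ha.le
  · rw [mem_frontier_reflectedCopy, mem_frontier_iff_polyGauge h.pos, ← hpa]
    congr 1; ring
  · -- a nearer point on the ray would lie in the interior of the translate
    rintro q hq ⟨s, t, hs, ht, hst, rfl⟩
    rcases hs.eq_or_lt with rfl | hs
    · rw [zero_add] at hst
      simp [hst]
    · exfalso
      have h1 := hge hq
      have e1 : a + (s • o + t • p - o) = s • a + t • (a + (p - o)) := by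
        have : s = 1 - t := by linarith
        rw [this]; module
      have h2 := polyGauge_combo_le n hs.le ht a (a + (p - o))
      rw [← e1, hpa] at h2
      nlinarith
  · by_contra hcon
    push Not at hcon
    have := hσ hp (by simpa using hcon)
    rw [hpa] at this
    exact lt_irrefl _ this

end Extreme

/-! ### Extreme points between two points of a translate -/

section Between

variable {ι : Type} [Fintype ι] [Nonempty ι] {n : ι → ℂ →L[ℝ] ℝ}

/-- If `a + z` and `b + p` lie in the polygon, then `a + p` is a strict mean of `a + z`, `b + p` and
`a`, and so lies in its interior. -/
theorem not_exit_of_mem {a b p v z : ℂ} {s t x y : ℝ}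
    (ht : 0 < t) (hz : z = s • p + t • v) (hpv : cross p v ≠ 0) (hd : a = b + x • p + y • v)
    (hy : 0 < y) (hx : 1 < s - t / y * x) (ha : polyGauge n a ≤ 1) (haz : polyGauge n (a + z) ≤ 1)
    (hbp : polyGauge n (b + p) ≤ 1) : polyGauge n (a + p) < 1 := by
  by_contra! hap
  set l := t / y with hl
  have hl0 : 0 < l := div_pos ht hy
  have hly : l * y = t := div_mul_cancel₀ _ hy.ne'
  obtain ⟨i, hi⟩ := exists_polyGauge_eq n (a + p)
  have h1 := (le_polyGauge n i a).trans ha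
  have h2 := (le_polyGauge n i _).trans haz
  have h3 := (le_polyGauge n i _).trans hbp
  rw [hi] at hap
  set q := s - l * x with hq
  have key : (q + l) • (a + p) = (a + z) + l • (b + p) + (q - 1) • a := by
    have hb : b = a - x • p - y • v := by rw [hd]; module
    have e1 : (a + z) + l • (b + p) + (q - 1) • a
        = (q + l) • a + (s - l * x + l) • p + (t - l * y) • v := by rw [hb, hz]; module
    rw [e1, hly, ← hq]; module
  have key' := congrArg (n i) key
  simp only [map_add, map_smul, smul_eq_mul] at key' h2 h3 hap
  have hz' : n i z = s * n i p + t * n i v := by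
    rw [hz]; simp only [map_add, map_smul, smul_eq_mul]
  have g1 : n i a = 1 := by nlinarith
  have g2 : n i p = 0 := by nlinarith
  have g3 : n i z = 0 := by nlinarith
  have g4 : n i v = 0 := by
    rw [hz', g2] at g3
    have : t * n i v = 0 := by linarith
    exact (mul_eq_zero.1 this).resolve_left ht.ne'
  have g5 := congrArg (n i) (eq_coords_of_cross_ne_zero hpv a)
  simp only [map_add, map_smul, g2, g4, g1] at g5
  norm_num at g5

/-- There is no room in the tile for two of its points to lie beyond two nearly opposite edges. -/
def NoSqueeze (n : ι → ℂ →L[ℝ] ℝ) (E : Set ℂ) : Prop :=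
  ∀ i j, ∀ p ∈ E, ∀ v ∈ E, cross p v ≠ 0 → ∀ a, polyGauge n a ≤ 1 →
    ∀ x y : ℝ, 0 ≤ x → 0 ≤ y → 0 < x + y →
    1 ≤ n i (a + p) → 1 ≤ n j (a + v) → 0 ≤ n i p → n i v ≤ 0 → 0 ≤ n j v → n j p ≤ 0 →
    n i (x • p + y • v) ≤ 0 → n j (x • p + y • v) ≤ 0 → False

/-- If a translate contains the quadrant centre and two points `p`, `v` of the tile, then it also
contains every point in the angle between them that lies in another translate containing the
quadrant centre, but neither `p` nor `v` in its interior. -/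
theorem NoSqueeze.polyGauge_le_one {E : Set ℂ} (hE : NoSqueeze n E) {a b p v z : ℂ} {s t : ℝ}
    (hp : p ∈ E) (hv : v ∈ E) (hs : 0 < s) (ht : 0 < t) (hz : z = s • p + t • v)
    (hpv : cross p v ≠ 0) (ha : polyGauge n a ≤ 1) (haz : polyGauge n (a + z) ≤ 1)
    (hap : 1 ≤ polyGauge n (a + p)) (hav : 1 ≤ polyGauge n (a + v))
    (hb : polyGauge n b ≤ 1) (hbp : polyGauge n (b + p) ≤ 1) (hbv : polyGauge n (b + v) ≤ 1) :
    polyGauge n (b + z) ≤ 1 := by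
  by_contra! hbz
  have hconv : ∀ c d : ℂ, polyGauge n c ≤ 1 → polyGauge n d ≤ 1 → ∀ w : ℝ, 0 ≤ w → w ≤ 1 →
      polyGauge n (w • c + (1 - w) • d) ≤ 1 := fun c d hc hd w h0 h1 =>
    convex_polyGauge_le n hc hd h0 (by linarith) (by ring)
  -- `z` is beyond the line of `p` and `v`, as otherwise `b + z` would be in the convex hull of `b`,
  -- `b + p` and `b + v`
  have hst : 1 < s + t := by
    by_contra! hst
    have e1 : b + z = (1 : ℝ) • (s • (b + p) + t • (b + v)) + (1 - s - t) • b := by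
      rw [hz]; module
    have e2 := polyGauge_combo_le n zero_le_one (by linarith : 0 ≤ 1 - s - t)
      (s • (b + p) + t • (b + v)) b
    have e3 := polyGauge_combo_le n hs.le ht.le (b + p) (b + v)
    rw [← e1] at e2
    have e4 : s * polyGauge n (b + p) ≤ s := mul_le_of_le_one_right hs.le hbp
    have e5 : t * polyGauge n (b + v) ≤ t := mul_le_of_le_one_right ht.le hbv
    have e6 : (1 - s - t) * polyGauge n b ≤ 1 - s - t := mul_le_of_le_one_right (by linarith) hb
    linarith
  obtain ⟨x, y, hxy⟩ : ∃ x y : ℝ, a - b = x • p + y • v :=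
    ⟨_, _, eq_coords_of_cross_ne_zero hpv (a - b)⟩
  have hd : a = b + x • p + y • v := by rw [add_assoc, ← hxy]; ring
  have hd' : a = b + y • v + x • p := by rw [hd]; ring
  have hz' : z = t • v + s • p := by rw [hz]; ring
  have hvp : cross v p ≠ 0 := by
    have : cross v p = -cross p v := by simp only [cross]; ring
    rw [this]; exact neg_ne_zero.2 hpv
  -- Neither `a + p` nor `a + v` is in the interior of the polygon, which restricts the displacement
  -- `x p + y v` from `b` to `a`.
  have hA : ∀ _ : 0 < y, s - t / y * x ≤ 1 := fun hy => by
    by_contra! hcon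
    exact absurd (not_exit_of_mem ht hz hpv hd hy hcon ha haz hbp) (not_lt.2 hap)
  have hB : ∀ _ : 0 < x, t - s / x * y ≤ 1 := fun hx => by
    by_contra! hcon
    exact absurd (not_exit_of_mem hs hz' hvp hd' hx hcon ha haz hbv) (not_lt.2 hav)
  rcases lt_or_ge 0 (x + y) with hN | hN
  · set l := (s + t - 1) / (x + y) with hl
    have hl0 : 0 < l := div_pos (by linarith) hN
    have hlN : l * (x + y) = s + t - 1 := div_mul_cancel₀ _ hN.ne'
    set q := s - l * x with hq
    have hq' : 1 - q = t - l * y := by rw [hq]; linarith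
    rcases lt_or_ge q 0 with hq0 | hq0
    · have hx : 0 < x := by
        by_contra! h
        nlinarith
      have h1 := hB hx
      have h2 : s / x < l := by rw [div_lt_iff₀ hx]; linarith
      have h3 : s / x * x = s := div_mul_cancel₀ _ hx.ne'
      nlinarith
    · rcases le_or_gt q 1 with hq1 | hq1
      · -- `b + z` is between `a + z` and a point of the segment from `b + p` to `b + v`
        have e1 : q • (b + p) + (1 - q) • (b + v) = b + z - l • (x • p + y • v) := by
          have : q • (b + p) + (1 - q) • (b + v)
              = b + (q • p + (1 - q) • v) := by module
          rw [this, hq', hz, hq]; module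
        have h1l : 1 + l ≠ 0 := by linarith
        have e2 : (l / (1 + l)) • (a + z) + (1 - l / (1 + l)) • (b + z - l • (x • p + y • v))
            = b + z := by
          have ha' : a + z = b + z + (x • p + y • v) := by rw [hd]; ring
          have e3 : (1 - l / (1 + l)) * l = l / (1 + l) := by field_simp; ring
          rw [ha', smul_sub, smul_smul, e3]
          module
        have h2 := hconv (a + z) _ haz (hconv _ _ hbp hbv q hq0 hq1) (l / (1 + l)) (by positivity)
          (by rw [div_le_one (by linarith)]; linarith)
        rw [e1, e2] at h2
        exact absurd h2 (not_le.2 hbz)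
      · have hy : 0 < y := by
          by_contra! h
          nlinarith
        have h1 := hA hy
        have h2 : t / y < l := by rw [div_lt_iff₀ hy]; linarith
        have h3 : t / y * y = t := div_mul_cancel₀ _ hy.ne'
        nlinarith
  · rcases lt_or_ge 0 y with hy | hy
    · have h1 := hA hy
      have h2 : 0 < t / y := div_pos ht hy
      have h3 : t / y * y = t := div_mul_cancel₀ _ hy.ne'
      nlinarith
    · rcases lt_or_ge 0 x with hx | hx
      · have h1 := hB hx
        have h2 : 0 < s / x := div_pos hs hx
        have h3 : s / x * x = s := div_mul_cancel₀ _ hx.ne'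
        nlinarith
      · rcases hN.lt_or_eq with hN | hN
        · -- `x, y ≤ 0`: the edges violated by `a + p` and by `a + v` are nearly opposite
          obtain ⟨i, hi⟩ := exists_polyGauge_eq n (a + p)
          obtain ⟨j, hj⟩ := exists_polyGauge_eq n (a + v)
          rw [hi] at hap
          rw [hj] at hav
          have i1 := (le_polyGauge n i a).trans ha
          have i2 := (le_polyGauge n i _).trans hbp
          have i3 := (le_polyGauge n i _).trans hbv
          have j1 := (le_polyGauge n j a).trans ha
          have j2 := (le_polyGauge n j _).trans hbv
          have j3 := (le_polyGauge n j _).trans hbp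
          have hda := congrArg (n i) hd
          have hdb := congrArg (n j) hd
          simp only [map_add, map_smul, smul_eq_mul] at i2 i3 j2 j3 hda hdb hap hav
          have i4 : 0 ≤ n i p := by linarith
          have j4 : 0 ≤ n j v := by linarith
          have i5 : n i v ≤ 0 := by
            rcases hy.lt_or_eq with hy | rfl
            · by_contra! hcon
              nlinarith
            · have : n i p ≤ 0 := by nlinarith
              have : n i p = 0 := le_antisymm this i4
              rw [this] at hda hap
              linarith
          have j5 : n j p ≤ 0 := by
            rcases hx.lt_or_eq with hx | rfl
            · by_contra! hcon
              nlinarith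
            · have : n j v ≤ 0 := by nlinarith
              have : n j v = 0 := le_antisymm this j4
              rw [this] at hdb hav
              linarith
          refine hE i j p hp v hv hpv a ha (-x) (-y) (by linarith) (by linarith) (by linarith)
            (by rw [map_add]; exact hap) (by rw [map_add]; exact hav) i4 i5 j4 j5 ?_ ?_
          · simp only [map_add, map_smul, smul_eq_mul]; linarith
          · simp only [map_add, map_smul, smul_eq_mul]; linarith
        · have hx0 : x = 0 := by linarith
          have hy0 : y = 0 := by linarith
          rw [hx0, hy0, zero_smul, zero_smul, add_zero, add_zero] at hd
          rw [hd] at haz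
          linarith

/-- Of the translates containing the quadrant centre, let two share a point of the tile.  Then their
union contains every extreme point in the angle between a point of the first and a point of the
second. -/
theorem NoSqueeze.mem_or_mem_of_between (hpos : ∀ z, z ≠ 0 → ∃ i, 0 < n i z) {Q : Set ℂ} {o : ℂ}
    (hE : NoSqueeze n ((fun q => q - o) '' Q)) {L : ℂ →L[ℝ] ℝ} (hL : ∀ q ∈ Q, 0 < L (q - o))
    {c₁ c₂ q v₁ v₂ z : ℂ} (hq : q ∈ Q) (hv₁ : v₁ ∈ Q) (hv₂ : v₂ ∈ Q)
    (hz : z ∈ extremePoints {z | polyGauge n z ≤ 1} Q o)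
    (ho₁ : polyGauge n (o - c₁) ≤ 1) (ho₂ : polyGauge n (o - c₂) ≤ 1)
    (hq₁ : polyGauge n (q - c₁) ≤ 1) (hq₂ : polyGauge n (q - c₂) ≤ 1)
    (hvc₁ : polyGauge n (v₁ - c₁) ≤ 1) (hvc₂ : polyGauge n (v₂ - c₂) ≤ 1)
    (h₁ : 0 < cross (v₁ - o) (z - o)) (h₂ : 0 < cross (z - o) (v₂ - o)) :
    polyGauge n (z - c₁) ≤ 1 ∨ polyGauge n (z - c₂) ≤ 1 := by
  obtain ⟨hzQ, ⟨x, ⟨hxo, hxz⟩, hxc⟩, hnear⟩ := hz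
  rw [mem_reflectedCopy] at hxo
  rw [mem_frontier_reflectedCopy, mem_frontier_iff_polyGauge hpos] at hxz
  have hcell : ∀ q ∈ Q, 1 ≤ polyGauge n (q - x) := fun q hq => by
    have := interior_subset hxc q hq
    rwa [convexDist, convexDist, gauge_eq_polyGauge hpos, gauge_eq_polyGauge hpos, hxz] at this
  have htrans : ∀ a b c : ℂ, 0 < L a → 0 < L b → 0 < L c → 0 < cross a b → 0 < cross b c →
      0 < cross a c := by
    intro a b c ha hb hc hab hbc
    have hid : L b * cross a c = L a * cross b c + L c * cross a b := by
      have hc : ∀ w : ℂ, L w = w.re * L 1 + w.im * L Complex.I := fun w => by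
        have : w = w.re • (1 : ℂ) + w.im • Complex.I := by
          apply Complex.ext <;> simp
        conv_lhs => rw [this, map_add, map_smul, map_smul, smul_eq_mul, smul_eq_mul]
      rw [hc a, hc b, hc c]; simp only [cross]; ring
    have : 0 < L b * cross a c := by rw [hid]; positivity
    exact pos_of_mul_pos_right this hb.le
  -- the translate with centre `c` contains the points `p` and `v` on both sides of `z`
  have hmain : ∀ c p v : ℂ, p ∈ Q → v ∈ Q → polyGauge n (o - c) ≤ 1 → polyGauge n (p - c) ≤ 1 →
      polyGauge n (v - c) ≤ 1 → 0 < cross (p - o) (z - o) → 0 < cross (z - o) (v - o) →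
      polyGauge n (z - c) ≤ 1 := by
    intro c p v hp hv hoc hpc hvc hpz hzv
    have hpv := htrans _ _ _ (hL p hp) (hL z hzQ) (hL v hv) hpz hzv
    have := hE.polyGauge_le_one (a := o - x) (b := o - c) (Set.mem_image_of_mem _ hp)
      (Set.mem_image_of_mem _ hv) (div_pos hzv hpv) (div_pos hpz hpv)
      (eq_coords_of_cross_ne_zero hpv.ne' (z - o)) hpv.ne' hxo (by simpa using hxz.le)
      (by simpa using hcell p hp) (by simpa using hcell v hv) hoc (by simpa using hpc)
      (by simpa using hvc)
    simpa using this
  rcases lt_trichotomy (cross (z - o) (q - o)) 0 with hlt | heq | hgt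
  · refine Or.inr (hmain c₂ q v₂ hq hv₂ ho₂ hq₂ hvc₂ ?_ h₂)
    have : cross (q - o) (z - o) = -cross (z - o) (q - o) := by simp only [cross]; ring
    linarith
  · left
    have hz0 : z - o ≠ 0 := by
      intro h0
      have := hL z hzQ
      rw [h0, map_zero] at this
      exact lt_irrefl _ this
    obtain ⟨l, hl⟩ := exists_smul_of_cross_eq_zero hz0 heq
    have hl0 : 0 < l := by
      have h3 := hL q hq
      rw [hl, map_smul, smul_eq_mul] at h3
      exact pos_of_mul_pos_left h3 (hL z hzQ).le
    rcases le_or_gt l 1 with hl1 | hl1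
    · have : q = z := hnear q hq ⟨1 - l, l, by linarith, hl0.le, by ring, by
        rw [show q = o + (q - o) by ring, hl]; module⟩
      rwa [← this]
    · have e1 : z - c₁ = (1 - 1 / l) • (o - c₁) + (1 / l) • (q - c₁) := by
        have : q - c₁ = (o - c₁) + l • (z - o) := by rw [← hl]; ring
        rw [this, smul_add, smul_smul, one_div_mul_cancel hl0.ne']; module
      rw [e1]
      refine convex_polyGauge_le n ho₁ hq₁ ?_ (by positivity) (by ring)
      rw [sub_nonneg, div_le_one hl0]; exact hl1.le
  · exact Or.inl (hmain c₁ v₁ q hv₁ hq ho₁ hvc₁ hq₁ h₁ hgt)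

end Between

/-! ### The geometry of a tile and a quadrant centre -/

/-- The linear functionals that define the regular `k`-gon of diameter `d` centred at `0`. -/
noncomputable def polyFun (k : ℕ) (φ d : ℝ) (i : Fin k) : ℂ →L[ℝ] ℝ :=
  (d / 2 * Real.cos (Real.pi / k))⁻¹ •
    (Real.cos (nrmAngle k φ (i : ℕ)) • Complex.reCLM + Real.sin (nrmAngle k φ (i : ℕ)) • Complex.imCLM)

theorem polyFun_apply (k : ℕ) (φ d : ℝ) (i : Fin k) (z : ℂ) :
    polyFun k φ d i z = comp (nrmAngle k φ (i : ℕ)) z / (d / 2 * Real.cos (Real.pi / k)) := by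
  simp only [polyFun, comp_eq, smul_apply, add_apply,
    Complex.reCLM_apply, Complex.imCLM_apply, smul_eq_mul]
  ring

instance {k : ℕ} [Fact (4 ≤ k)] : Nonempty (Fin k) :=
  ⟨⟨0, by have : 4 ≤ k := Fact.out; omega⟩⟩

section

variable {k : ℕ} [hk : Fact (4 ≤ k)]

theorem polyGauge_polyFun_le_iff (φ : ℝ) {d : ℝ} (hd : 0 < d) {c : ℝ} {z : ℂ} :
    polyGauge (polyFun k φ d) z ≤ c ↔
      ∀ i : Fin k, comp (nrmAngle k φ (i : ℕ)) z ≤ c * (d / 2 * Real.cos (Real.pi / k)) := by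
  have := cos_pi_div_pos hk.out
  simp only [polyGauge_le_iff, polyFun_apply]
  refine forall_congr' fun i => ?_
  rw [div_le_iff₀ (by positivity)]

theorem mem_body_iff_polyGauge (φ : ℝ) {σ : KGon} (hd : 0 < σ.diam) {z : ℂ} :
    z ∈ σ.body k φ ↔ polyGauge (polyFun k φ σ.diam) (z - σ.center) ≤ 1 := by
  rw [mem_body_iff hk.out φ hd, polyGauge_polyFun_le_iff φ hd, one_mul]
  refine ⟨fun h i => h _, fun h i => ?_⟩
  obtain ⟨j, q, rfl⟩ := exists_fin_add_mul (by have := hk.out; omega : 0 < k) i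
  rw [comp_nrmAngle_add_mul (by have := hk.out; omega)]
  exact h j

theorem body_eq_polyGauge (φ : ℝ) {d : ℝ} (hd : 0 < d) :
    KGon.body k φ ⟨0, d⟩ = {z | polyGauge (polyFun k φ d) z ≤ 1} := by
  ext z
  rw [mem_body_iff_polyGauge φ hd]
  simp

theorem polyGauge_lt_one_of_norm_lt (φ : ℝ) {z : ℂ} (h : ‖z‖ < Real.cos (Real.pi / k)) :
    polyGauge (polyFun k φ 2) z < 1 := by
  have := cos_pi_div_pos hk.out
  rw [polyGauge_lt_iff]
  intro i
  rw [polyFun_apply, div_lt_one (by positivity)]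
  linarith [comp_le_norm (nrmAngle k φ (i : ℕ)) z]

theorem norm_le_one_of_polyGauge_le (φ : ℝ) {z : ℂ} (h : polyGauge (polyFun k φ 2) z ≤ 1) :
    ‖z‖ ≤ 1 := by
  have h1 : z ∈ KGon.body k φ ⟨0, 2⟩ := by rw [body_eq_polyGauge φ two_pos]; exact h
  simpa using norm_le_of_mem_body (by norm_num) h1

theorem polyFun_pos (φ : ℝ) (z : ℂ) (hz : z ≠ 0) : ∃ i, 0 < polyFun k φ 2 i z := by
  by_contra! hcon
  have hz0 : 0 < ‖z‖ := norm_pos_iff.2 hz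
  have h1 : polyGauge (polyFun k φ 2) ((2 / ‖z‖) • z) ≤ 1 := by
    rw [polyGauge_le_iff]
    intro i
    rw [map_smul, smul_eq_mul]
    have := mul_nonpos_of_nonneg_of_nonpos (by positivity : 0 ≤ 2 / ‖z‖) (hcon i)
    linarith
  have h2 := norm_le_one_of_polyGauge_le φ h1
  rw [norm_smul, Real.norm_eq_abs, abs_of_pos (by positivity), div_mul_cancel₀ _ hz0.ne'] at h2
  norm_num at h2

end

/-- The positions of the points of a tile relative to a quadrant centre, in suitable coordinates. -/
def box (lo hi : ℝ) : Set ℂ := {w | lo ≤ w.re ∧ w.re ≤ hi ∧ lo ≤ w.im ∧ w.im ≤ hi}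

theorem le_cos_pi_div {k m : ℕ} (hm : 0 < m) (hk : m ≤ k) :
    1 - (3.1416 / m) ^ 2 / 2 ≤ Real.cos (Real.pi / k) := by
  have hm' : (0 : ℝ) < m := by exact_mod_cast hm
  have hk' : (m : ℝ) ≤ k := by exact_mod_cast hk
  have h0 := Real.pi_pos
  have h1 := Real.pi_lt_d4
  have h2 : Real.pi / k ≤ 3.1416 / m := by gcongr
  have h3 : 0 ≤ Real.pi / k := by positivity
  have h4 := Real.one_sub_sq_div_two_le_cos (x := Real.pi / k)
  nlinarith

theorem half_le_cos_sq {k : ℕ} (hk : 4 ≤ k) : 1 / 2 ≤ Real.cos (Real.pi / k) ^ 2 := by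
  have h4 : (4 : ℝ) ≤ k := by exact_mod_cast hk
  have hpi := Real.pi_pos
  have h1 : Real.cos (Real.pi / 4) ≤ Real.cos (Real.pi / k) := by
    apply Real.cos_le_cos_of_nonneg_of_le_pi (by positivity) (by linarith)
    gcongr
  rw [Real.cos_pi_div_four] at h1
  have h2 : (0 : ℝ) ≤ √2 := Real.sqrt_nonneg 2
  have h3 : √2 ^ 2 = (2 : ℝ) := Real.sq_sqrt (by norm_num)
  nlinarith

theorem norm_sq_eq (z : ℂ) : ‖z‖ ^ 2 = z.re ^ 2 + z.im ^ 2 := by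
  rw [Complex.sq_norm, Complex.normSq_apply]; ring

section

variable {k : ℕ} [hk : Fact (4 ≤ k)]

/-- If the disk inscribed in the `k`-gon is large enough, the requirements for moving translates
hold in every orientation: `A` is taken in the direction opposite to the tile. -/
theorem reachable_box (φ : ℝ) {lo hi : ℝ} (hlo : 3 / 8 ≤ lo) (hhi : hi ≤ 7 / 8)
    (hr : 4 / 5 ≤ Real.cos (Real.pi / k)) (hr' : 1 - Real.cos (Real.pi / k) ^ 2 < 2 * lo ^ 2) :
    ∃ A, Reachable (polyFun k φ 2) (box lo hi) A := by
  set r := Real.cos (Real.pi / k) with hrdef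
  set g := polyGauge (polyFun k φ 2) with hg
  have hpos := polyFun_pos (k := k) φ
  have hone : ∀ z, g z = 1 → r ^ 2 ≤ z.re ^ 2 + z.im ^ 2 := by
    intro z hz
    rw [← norm_sq_eq]
    have : r ≤ ‖z‖ := by
      by_contra! hcon
      have := polyGauge_lt_one_of_norm_lt φ hcon
      rw [← hg, hz] at this
      exact lt_irrefl _ this
    gcongr
  have hle : ∀ z, g z ≤ 1 → z.re ^ 2 + z.im ^ 2 ≤ 1 := by
    intro z hz
    rw [← norm_sq_eq]
    have := norm_le_one_of_polyGauge_le φ hz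
    have h0 := norm_nonneg z
    nlinarith
  -- a chord of direction `e` starts on the side of the polygon that is opposite to `e`
  have hdot : ∀ e ∈ box lo hi, ∀ B, g B = 1 → g (B + e) ≤ 1 → B.re * e.re + B.im * e.im < 0 := by
    rintro e ⟨h1, h2, h3, h4⟩ B hB hBe
    have h5 := hone B hB
    have h6 := hle _ hBe
    simp only [Complex.add_re, Complex.add_im] at h6
    nlinarith
  have hne : (-(1 + Complex.I) : ℂ) ≠ 0 := by
    intro h
    have := congrArg Complex.re h
    simp at this
  have hg0 := polyGauge_pos _ hpos hne
  set κ := (g (-(1 + Complex.I)))⁻¹ with hκ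
  have hκ0 : 0 < κ := inv_pos.2 hg0
  have hA1 : g (κ • -(1 + Complex.I)) = 1 := by
    rw [hg, polyGauge_smul _ hκ0.le, ← hg, hκ, inv_mul_cancel₀ hg0.ne']
  have hre : (κ • -(1 + Complex.I)).re = -κ := by simp
  have him : (κ • -(1 + Complex.I)).im = -κ := by simp
  have hκ1 := hone _ hA1
  have hκ2 := hle _ hA1.le
  rw [hre, him] at hκ1 hκ2
  have hκ3 : 0.56 ≤ κ := by nlinarith
  have hκ4 : κ ≤ 0.71 := by nlinarith
  refine ⟨κ • -(1 + Complex.I), hpos, hA1, ?_, ?_, ?_⟩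
  · rintro e ⟨h1, h2, h3, h4⟩
    apply polyGauge_lt_one_of_norm_lt
    have : ‖κ • -(1 + Complex.I) + e‖ ^ 2 < r ^ 2 := by
      rw [norm_sq_eq, Complex.add_re, Complex.add_im, hre, him]
      nlinarith
    exact lt_of_pow_lt_pow_left₀ 2 (by linarith) this
  · rintro e he l hl hl1
    by_contra! hcon
    have h1 := hdot e he _ hl1 hcon
    obtain ⟨h2, h3, h4, h5⟩ := he
    have e1 : (l • -(κ • -(1 + Complex.I))).re = l * κ := by simp
    have e2 : (l • -(κ • -(1 + Complex.I))).im = l * κ := by simp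
    rw [e1, e2] at h1
    have : 0 < l * κ := mul_pos hl hκ0
    nlinarith
  · rintro e he B hB hBe x y hxy ⟨hx, hy⟩
    have h1 := hdot e he B hB hBe
    obtain ⟨h2, h3, h4, h5⟩ := he
    have e1 := congrArg Complex.re hxy
    have e2 := congrArg Complex.im hxy
    simp only [Complex.add_re, Complex.smul_re, Complex.add_im, Complex.smul_im, smul_eq_mul] at e1 e2
    rw [← smul_eq_mul κ] at *
    have hre' : (-(1 + Complex.I)).re = -1 := by simp
    have him' : (-(1 + Complex.I)).im = -1 := by simp
    rw [hre', smul_eq_mul] at e1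
    rw [him', smul_eq_mul] at e2
    have k1 : 0 < e.re ^ 2 := by nlinarith
    have k2 : e.re ^ 2 + e.im ^ 2 = x * κ * (-(e.re + e.im)) + y * (B.re * e.re + B.im * e.im) := by
      calc _ = e.re * e.re + e.im * e.im := by ring
        _ = (x * (κ * -1) + y * B.re) * e.re + (x * (κ * -1) + y * B.im) * e.im := by
            rw [← e1, ← e2]
        _ = _ := by ring
    have k3 : 0 ≤ x * κ * (e.re + e.im) := by
      have := mul_nonneg hx hκ0.le
      have h' : 0 ≤ e.re + e.im := by linarith
      positivity
    have k4 : y * (B.re * e.re + B.im * e.im) ≤ 0 := mul_nonpos_of_nonneg_of_nonpos hy h1.le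
    nlinarith

/-- The normal of an edge that separates two directions of the box is a vector with coordinates of
opposite signs and of bounded ratio. -/
theorem bounds_of_separating {c s lo hi : ℝ} {p v : ℂ} (hlo : 3 / 8 ≤ lo) (hhi : hi ≤ 7 / 8)
    (hp : p ∈ box lo hi) (hv : v ∈ box lo hi) (hcs : c ^ 2 + s ^ 2 = 1) (hpv : 0 < cross p v)
    (h1 : 0 ≤ p.re * c + p.im * s) (h2 : v.re * c + v.im * s ≤ 0) :
    0.39 ≤ c ∧ c ≤ 0.92 ∧ 0.39 ≤ -s ∧ -s ≤ 0.92 := by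
  obtain ⟨p1, p2, p3, p4⟩ := hp
  obtain ⟨v1, v2, v3, v4⟩ := hv
  simp only [cross] at hpv
  have hc0 : 0 ≤ c := by
    have e1 := mul_nonneg h1 (by linarith : 0 ≤ v.im)
    have e2 := mul_nonneg (neg_nonneg.2 h2) (by linarith : 0 ≤ p.im)
    have : 0 ≤ c * (p.re * v.im - p.im * v.re) := by linarith
    exact nonneg_of_mul_nonneg_left this hpv
  have hs0 : s ≤ 0 := by
    have e1 := mul_nonneg h1 (by linarith : 0 ≤ v.re)
    have e2 := mul_nonneg (neg_nonneg.2 h2) (by linarith : 0 ≤ p.re)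
    have : 0 ≤ -s * (p.re * v.im - p.im * v.re) := by linarith
    linarith [nonneg_of_mul_nonneg_left this hpv]
  have hr1 : 3 * c ≤ 7 * -s := by
    have e1 : c * (3 / 8) ≤ c * v.re := mul_le_mul_of_nonneg_left (by linarith) hc0
    have e2 : -s * v.im ≤ -s * (7 / 8) := mul_le_mul_of_nonneg_left (by linarith) (by linarith)
    linarith
  have hr2 : 3 * -s ≤ 7 * c := by
    have e1 : c * p.re ≤ c * (7 / 8) := mul_le_mul_of_nonneg_left (by linarith) hc0
    have e2 : -s * (3 / 8) ≤ -s * p.im := mul_le_mul_of_nonneg_left (by linarith) (by linarith)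
    linarith
  refine ⟨?_, ?_, ?_, ?_⟩ <;> nlinarith

end

theorem sub_le_of_mem_box {lo hi : ℝ} (hlo : 3 / 8 ≤ lo) (hhi : hi ≤ 7 / 8) {e e' : ℂ}
    (he : e ∈ box lo hi) (he' : e' ∈ box lo hi) {c s : ℝ} (hcs : c ^ 2 + s ^ 2 = 1) :
    (e.re - e'.re) * c + (e.im - e'.im) * s ≤ 0.71 := by
  obtain ⟨p1, p2, p3, p4⟩ := he
  obtain ⟨v1, v2, v3, v4⟩ := he'
  have q1 : (e.re - e'.re) ^ 2 ≤ (1 / 2) ^ 2 := sq_le_sq' (by linarith) (by linarith)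
  have q2 : (e.im - e'.im) ^ 2 ≤ (1 / 2) ^ 2 := sq_le_sq' (by linarith) (by linarith)
  have q3 : ((e.re - e'.re) * c + (e.im - e'.im) * s) ^ 2 ≤ 0.71 ^ 2 := by
    have := sq_nonneg ((e.re - e'.re) * s - (e.im - e'.im) * c)
    have e : ((e.re - e'.re) * c + (e.im - e'.im) * s) ^ 2
        + ((e.re - e'.re) * s - (e.im - e'.im) * c) ^ 2
        = ((e.re - e'.re) ^ 2 + (e.im - e'.im) ^ 2) * (c ^ 2 + s ^ 2) := by ring
    rw [hcs, mul_one] at e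
    norm_num at q1 q2 ⊢
    linarith
  exact (abs_le_of_sq_le_sq' q3 (by norm_num)).2

theorem dot_le_of_norm_le_one {a : ℂ} (ha : ‖a‖ ≤ 1) {x y : ℝ} (hx : |x| ≤ 0.53)
    (hy : |y| ≤ 0.53) : a.re * x + a.im * y ≤ 0.76 := by
  have hnorm : |a.re| ^ 2 + |a.im| ^ 2 ≤ 1 := by
    rw [sq_abs, sq_abs, ← norm_sq_eq]
    exact pow_le_one₀ (norm_nonneg a) ha
  have e1 : a.re * x ≤ |a.re| * 0.53 :=
    (le_abs_self _).trans (by rw [abs_mul]; gcongr)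
  have e2 : a.im * y ≤ |a.im| * 0.53 :=
    (le_abs_self _).trans (by rw [abs_mul]; gcongr)
  have e3 : (|a.re| + |a.im|) ^ 2 ≤ 1.43 ^ 2 := by
    have q3 := sq_nonneg (|a.re| - |a.im|)
    norm_num
    linarith
  have e4 := (abs_le_of_sq_le_sq' e3 (by norm_num)).2
  linarith

section

variable {k : ℕ} [hk : Fact (4 ≤ k)]

/-- Two edges that separate `p` from `v` in opposite senses have nearly opposite normals and are farther
apart than the diameter of the tile. -/
theorem noSqueeze_box (φ : ℝ) {lo hi : ℝ} (hlo : 3 / 8 ≤ lo) (hhi : hi ≤ 7 / 8)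
    (hr : 4 / 5 ≤ Real.cos (Real.pi / k)) : NoSqueeze (polyFun k φ 2) (box lo hi) := by
  intro i j p hp v hv hpv a ha x y hx hy hxy hiap hjav hip hiv hjv hjp hif hjf
  have hr0 := cos_pi_div_pos hk.out
  have ha' := norm_le_one_of_polyGauge_le φ ha
  have hval : ∀ (i : Fin k) (z : ℂ), polyFun k φ 2 i z * Real.cos (Real.pi / k) =
      comp (nrmAngle k φ (i : ℕ)) z := by
    intro i z
    rw [polyFun_apply]
    field_simp
  set r := Real.cos (Real.pi / k)
  set ci := Real.cos (nrmAngle k φ (i : ℕ)) with hci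
  set si := Real.sin (nrmAngle k φ (i : ℕ)) with hsi
  set cj := Real.cos (nrmAngle k φ (j : ℕ)) with hcj
  set sj := Real.sin (nrmAngle k φ (j : ℕ)) with hsj
  have hcsi : ci ^ 2 + si ^ 2 = 1 := by rw [hci, hsi]; exact Real.cos_sq_add_sin_sq _
  have hcsj : cj ^ 2 + sj ^ 2 = 1 := by rw [hcj, hsj]; exact Real.cos_sq_add_sin_sq _
  have hI : ∀ z, comp (nrmAngle k φ (i : ℕ)) z = z.re * ci + z.im * si := fun z => comp_eq _ z
  have hJ : ∀ z, comp (nrmAngle k φ (j : ℕ)) z = z.re * cj + z.im * sj := fun z => comp_eq _ z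
  have m1 : r ≤ (a.re + p.re) * ci + (a.im + p.im) * si := by
    have := hI (a + p)
    rw [Complex.add_re, Complex.add_im] at this
    rw [← this, ← hval]
    exact le_mul_of_one_le_left hr0.le hiap
  have m2 : r ≤ (a.re + v.re) * cj + (a.im + v.im) * sj := by
    have := hJ (a + v)
    rw [Complex.add_re, Complex.add_im] at this
    rw [← this, ← hval]
    exact le_mul_of_one_le_left hr0.le hjav
  have m3 : 0 ≤ p.re * ci + p.im * si := by rw [← hI, ← hval]; positivity
  have m4 : v.re * ci + v.im * si ≤ 0 := by
    rw [← hI, ← hval]; exact mul_nonpos_of_nonpos_of_nonneg hiv hr0.le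
  have m5 : 0 ≤ v.re * cj + v.im * sj := by rw [← hJ, ← hval]; positivity
  have m6 : p.re * cj + p.im * sj ≤ 0 := by
    rw [← hJ, ← hval]; exact mul_nonpos_of_nonpos_of_nonneg hjp hr0.le
  have m7 : x * (p.re * ci + p.im * si) + y * (v.re * ci + v.im * si) ≤ 0 := by
    have e : x * (p.re * ci + p.im * si) + y * (v.re * ci + v.im * si)
        = polyFun k φ 2 i (x • p + y • v) * r := by
      rw [hval, hI]; simp only [Complex.add_re, Complex.smul_re, Complex.add_im, Complex.smul_im,
        smul_eq_mul]; ring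
    rw [e]; exact mul_nonpos_of_nonpos_of_nonneg hif hr0.le
  have m8 : x * (p.re * cj + p.im * sj) + y * (v.re * cj + v.im * sj) ≤ 0 := by
    have e : x * (p.re * cj + p.im * sj) + y * (v.re * cj + v.im * sj)
        = polyFun k φ 2 j (x • p + y • v) * r := by
      rw [hval, hJ]; simp only [Complex.add_re, Complex.smul_re, Complex.add_im, Complex.smul_im,
        smul_eq_mul]; ring
    rw [e]; exact mul_nonpos_of_nonpos_of_nonneg hjf hr0.le
  -- the normals are nearly opposite
  have hsum : (a.re * ci + a.im * si) + (a.re * cj + a.im * sj) ≤ 0.76 := by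
    have hb : |ci + cj| ≤ 0.53 ∧ |si + sj| ≤ 0.53 := by
      rcases lt_or_gt_of_ne hpv with h | h
      · have hvp : 0 < cross v p := by
          have : cross v p = -cross p v := by simp only [cross]; ring
          linarith
        obtain ⟨b1, b2, b3, b4⟩ := bounds_of_separating hlo hhi hv hp hcsj hvp m5 m6
        obtain ⟨d1, d2, d3, d4⟩ := bounds_of_separating (c := -ci) (s := -si) hlo hhi hv hp
          (by rw [neg_sq, neg_sq]; exact hcsi) hvp (by linarith) (by linarith)
        constructor <;> rw [abs_le] <;> constructor <;> linarith
      · obtain ⟨b1, b2, b3, b4⟩ := bounds_of_separating hlo hhi hp hv hcsi h m3 m4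
        obtain ⟨d1, d2, d3, d4⟩ := bounds_of_separating (c := -cj) (s := -sj) hlo hhi hp hv
          (by rw [neg_sq, neg_sq]; exact hcsj) h (by linarith) (by linarith)
        constructor <;> rw [abs_le] <;> constructor <;> linarith
    have := dot_le_of_norm_le_one ha' hb.1 hb.2
    linarith
  -- and the points are close to each other
  have hD : ∀ c s : ℝ, c ^ 2 + s ^ 2 = 1 → (p.re - v.re) * c + (p.im - v.im) * s ≤ 0.71 := fun c s =>
    sub_le_of_mem_box hlo hhi hp hv
  have n1 : (x + y) * (p.re * ci + p.im * si) ≤ y * 0.71 := by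
    have := mul_le_mul_of_nonneg_left (hD ci si hcsi) hy
    linarith
  have n2 : (x + y) * (v.re * cj + v.im * sj) ≤ x * 0.71 := by
    have := mul_le_mul_of_nonneg_left (hD (-cj) (-sj) (by rw [neg_sq, neg_sq]; exact hcsj)) hx
    linarith
  have n3 : (p.re * ci + p.im * si) + (v.re * cj + v.im * sj) ≤ 0.71 := by
    have : (x + y) * ((p.re * ci + p.im * si) + (v.re * cj + v.im * sj)) ≤ (x + y) * 0.71 := by
      linarith
    exact le_of_mul_le_mul_left this hxy
  linarith

/-- At most one position of a translate has two given points of the tile on two given edges: the edges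
are not parallel, as opposite edges are too far apart. -/
theorem subsingleton_two_edges (φ : ℝ) {lo hi : ℝ} (hlo : 3 / 8 ≤ lo) (hhi : hi ≤ 7 / 8)
    {i j : Fin k} (hij : polyFun k φ 2 i ≠ polyFun k φ 2 j) {e e' : ℂ} (he : e ∈ box lo hi)
    (he' : e' ∈ box lo hi) :
    {a : ℂ | polyFun k φ 2 i (a + e) = 1 ∧ polyFun k φ 2 j (a + e') = 1}.Subsingleton := by
  rintro a ⟨ha1, ha2⟩ b ⟨hb1, hb2⟩
  by_contra hab
  have hr0 := cos_pi_div_pos hk.out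
  have hr2 := half_le_cos_sq hk.out
  set r := Real.cos (Real.pi / k)
  have hval : ∀ (i : Fin k) (z : ℂ), polyFun k φ 2 i z =
      (z.re * Real.cos (nrmAngle k φ (i : ℕ)) + z.im * Real.sin (nrmAngle k φ (i : ℕ))) / r := by
    intro i z
    rw [polyFun_apply, comp_eq]
    congr 1; ring
  rw [hval, div_eq_one_iff_eq hr0.ne', Complex.add_re, Complex.add_im] at ha1 ha2 hb1 hb2
  have hcsi := Real.cos_sq_add_sin_sq (nrmAngle k φ (i : ℕ))
  have hcsj := Real.cos_sq_add_sin_sq (nrmAngle k φ (j : ℕ))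
  have hne : ¬ (Real.cos (nrmAngle k φ (i : ℕ)) = Real.cos (nrmAngle k φ (j : ℕ)) ∧
      Real.sin (nrmAngle k φ (i : ℕ)) = Real.sin (nrmAngle k φ (j : ℕ))) := by
    rintro ⟨h1, h2⟩
    apply hij
    ext z
    rw [hval, hval, h1, h2]
  set ci := Real.cos (nrmAngle k φ (i : ℕ))
  set si := Real.sin (nrmAngle k φ (i : ℕ))
  set cj := Real.cos (nrmAngle k φ (j : ℕ))
  set sj := Real.sin (nrmAngle k φ (j : ℕ))
  have hdet : ci * sj - si * cj = 0 := by
    by_contra hdet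
    apply hab
    have e1 : (a.re - b.re) * ci + (a.im - b.im) * si = 0 := by linarith
    have e2 : (a.re - b.re) * cj + (a.im - b.im) * sj = 0 := by linarith
    have e3 : (a.re - b.re) * (ci * sj - si * cj) = 0 := by linear_combination sj * e1 - si * e2
    have e4 : (a.im - b.im) * (ci * sj - si * cj) = 0 := by linear_combination ci * e2 - cj * e1
    apply Complex.ext
    · linarith [(mul_eq_zero.1 e3).resolve_right hdet]
    · linarith [(mul_eq_zero.1 e4).resolve_right hdet]
  have hdot : (ci * cj + si * sj) ^ 2 = 1 := by
    have : (ci * cj + si * sj) ^ 2 + (ci * sj - si * cj) ^ 2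
        = (ci ^ 2 + si ^ 2) * (cj ^ 2 + sj ^ 2) := by ring
    rw [hdet, hcsi, hcsj] at this
    linarith
  have hci : ci = (ci * cj + si * sj) * cj := by
    linear_combination (-ci) * hcsj + sj * hdet
  have hsi : si = (ci * cj + si * sj) * sj := by
    linear_combination (-si) * hcsj - cj * hdet
  rw [sq] at hdot
  rcases mul_self_eq_one_iff.1 hdot with h | h
  · rw [h, one_mul] at hci hsi
    exact hne ⟨hci, hsi⟩
  · -- opposite edges are farther apart than two points of the tile
    rw [h] at hci hsi
    have e1 : (e.re - e'.re) * ci + (e.im - e'.im) * si = 2 * r := by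
      rw [show cj = -ci by linarith, show sj = -si by linarith] at ha2
      linarith
    have e2 := sub_le_of_mem_box hlo hhi he he' hcsi
    nlinarith

end

/-! ### Squares parallel to the tiles -/

theorem comp_int_mul_pi_div_two (j : ℤ) (z : ℂ) :
    comp (j * (Real.pi / 2)) z = z.re ∨ comp (j * (Real.pi / 2)) z = z.im ∨
      comp (j * (Real.pi / 2)) z = -z.re ∨ comp (j * (Real.pi / 2)) z = -z.im := by
  have h4 : j = j % 4 + 4 * (j / 4) := (Int.emod_add_mul_ediv j 4).symm
  have e1 : (j : ℝ) * (Real.pi / 2) = (j % 4 : ℤ) * (Real.pi / 2) + (j / 4 : ℤ) * (2 * Real.pi) := by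
    conv_lhs => rw [h4]
    push_cast; ring
  rw [comp_eq, e1, Real.cos_add_int_mul_two_pi, Real.sin_add_int_mul_two_pi]
  have h0 : 0 ≤ j % 4 := Int.emod_nonneg _ (by norm_num)
  have h1 : j % 4 < 4 := Int.emod_lt_of_pos _ (by norm_num)
  interval_cases j % 4
  · left; simp
  · right; left; simp
  · right; right; left
    have : ((2 : ℤ) : ℝ) * (Real.pi / 2) = Real.pi := by push_cast; ring
    rw [this]; simp
  · right; right; right
    have : ((3 : ℤ) : ℝ) * (Real.pi / 2) = Real.pi / 2 + Real.pi := by push_cast; ring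
    rw [this, Real.cos_add_pi, Real.sin_add_pi]; simp

/-- The square with corner direction `φ` has its sides parallel to the axes. -/
def AxisParallel (φ : ℝ) : Prop := ∃ m : ℤ, φ + Real.pi / 4 = m * (Real.pi / 2)

instance : Fact (4 ≤ 4) := ⟨le_rfl⟩

theorem AxisParallel.nrmAngle_eq {φ : ℝ} (h : AxisParallel φ) :
    ∃ m : ℤ, ∀ i : ℤ, nrmAngle 4 φ i = (m + i : ℤ) * (Real.pi / 2) := by
  obtain ⟨m, hm⟩ := h
  refine ⟨m, fun i => ?_⟩
  unfold nrmAngle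
  push_cast
  linear_combination hm

theorem AxisParallel.polyGauge_le_iff {φ : ℝ} (h : AxisParallel φ) {c : ℝ} {z : ℂ} :
    polyGauge (polyFun 4 φ 2) z ≤ c ↔
      |z.re| ≤ c * Real.cos (Real.pi / 4) ∧ |z.im| ≤ c * Real.cos (Real.pi / 4) := by
  obtain ⟨m, hm⟩ := h.nrmAngle_eq
  have hstep : polyGauge (polyFun 4 φ 2) z ≤ c ↔
      ∀ j : ℤ, comp (j * (Real.pi / 2)) z ≤ c * Real.cos (Real.pi / 4) := by
    rw [polyGauge_polyFun_le_iff φ two_pos]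
    simp only [div_self (two_ne_zero' ℝ), one_mul, Nat.cast_ofNat]
    constructor
    · intro h j
      obtain ⟨i, q, hi⟩ := exists_fin_add_mul (k := 4) (by norm_num) (j - m)
      have h1 := h i
      rw [← comp_nrmAngle_add_mul (by norm_num) φ _ q, ← hi, hm] at h1
      simpa using h1
    · intro h i
      rw [hm]
      exact h _
  rw [hstep]
  constructor
  · intro h
    have h0 := h 0
    have h1 := h 1
    have h2 := h 2
    have h3 := h 3
    have e2 : ((2 : ℤ) : ℝ) * (Real.pi / 2) = Real.pi := by push_cast; ring
    have e3 : ((3 : ℤ) : ℝ) * (Real.pi / 2) = Real.pi / 2 + Real.pi := by push_cast; ring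
    rw [e2] at h2
    rw [e3] at h3
    simp only [comp_eq, Int.cast_zero, zero_mul, Real.cos_zero, Real.sin_zero, Int.cast_one, one_mul,
      Real.cos_pi_div_two, Real.sin_pi_div_two, Real.cos_pi, Real.sin_pi, Real.cos_add_pi,
      Real.sin_add_pi] at h0 h1 h2 h3
    constructor <;> rw [abs_le] <;> constructor <;> linarith
  · rintro ⟨h1, h2⟩ j
    rw [abs_le] at h1 h2
    rcases comp_int_mul_pi_div_two j z with h | h | h | h <;> rw [h] <;> linarith

theorem AxisParallel.polyGauge_eq {φ : ℝ} (h : AxisParallel φ) (z : ℂ) :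
    polyGauge (polyFun 4 φ 2) z = max |z.re| |z.im| / Real.cos (Real.pi / 4) := by
  have hr : 0 < Real.cos (Real.pi / 4) := cos_pi_div_pos (k := 4) le_rfl
  apply eq_of_forall_ge_iff
  intro c
  rw [h.polyGauge_le_iff, div_le_iff₀ hr, max_le_iff]

theorem cos_pi_div_four_bounds :
    0.7 ≤ Real.cos (Real.pi / 4) ∧ Real.cos (Real.pi / 4) ≤ 0.71 := by
  rw [Real.cos_pi_div_four]
  have h2 : (0 : ℝ) ≤ √2 := Real.sqrt_nonneg 2
  have h3 : √2 ^ 2 = (2 : ℝ) := Real.sq_sqrt (by norm_num)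
  constructor <;> nlinarith

theorem AxisParallel.reachable_box {φ : ℝ} (h : AxisParallel φ) {lo hi : ℝ} (hlo : 3 / 8 ≤ lo)
    (hhi : hi ≤ 7 / 8) : ∃ A, Reachable (polyFun 4 φ 2) (box lo hi) A := by
  have hr : 0 < Real.cos (Real.pi / 4) := cos_pi_div_pos (k := 4) le_rfl
  obtain ⟨hr1, hr2⟩ := cos_pi_div_four_bounds
  have hpos := polyFun_pos (k := 4) φ
  have hgauge := h.polyGauge_eq
  set r := Real.cos (Real.pi / 4) with hrdef
  refine ⟨⟨-r, -r⟩, hpos, ?_, ?_, ?_, ?_⟩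
  · rw [hgauge]
    simp only [abs_neg, max_self, abs_of_pos hr]
    exact div_self hr.ne'
  · rintro e ⟨h1, h2, h3, h4⟩
    rw [hgauge, div_lt_one hr]
    simp only [Complex.add_re, Complex.add_im]
    rw [max_lt_iff, abs_lt, abs_lt]
    refine ⟨⟨?_, ?_⟩, ?_, ?_⟩ <;> linarith
  · rintro e ⟨h1, h2, h3, h4⟩ κ hκ hκ1
    have hκ' : κ = 1 := by
      rw [polyGauge_smul _ hκ.le, hgauge] at hκ1
      simp only [Complex.neg_re, Complex.neg_im, neg_neg, max_self, abs_of_pos hr] at hκ1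
      rwa [div_self hr.ne', mul_one] at hκ1
    rw [hκ', one_smul, hgauge, lt_div_iff₀ hr, one_mul, lt_max_iff]
    left
    simp only [Complex.add_re, Complex.neg_re, neg_neg]
    rw [abs_of_pos (by linarith)]
    linarith
  · rintro e ⟨h1, h2, h3, h4⟩ B hB hBe x y hxy ⟨hx, hy⟩
    have e1 := congrArg Complex.re hxy
    have e2 := congrArg Complex.im hxy
    simp only [Complex.add_re, Complex.smul_re, Complex.add_im, Complex.smul_im, smul_eq_mul] at e1 e2
    rw [hgauge, div_eq_one_iff_eq hr.ne'] at hB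
    rw [hgauge, div_le_one hr, max_le_iff, abs_le, abs_le, Complex.add_re, Complex.add_im] at hBe
    have hxr : 0 ≤ x * r := by positivity
    have hB1 : 0 < B.re := by
      have : 0 < y * B.re := by linarith
      exact pos_of_mul_pos_right this hy
    have hB2 : 0 < B.im := by
      have : 0 < y * B.im := by linarith
      exact pos_of_mul_pos_right this hy
    rw [abs_of_pos hB1, abs_of_pos hB2] at hB
    rcases max_choice B.re B.im with h | h <;> rw [h] at hB <;> linarith [hBe.1.2, hBe.2.2]

theorem AxisParallel.noSqueeze_box {φ : ℝ} (h : AxisParallel φ) {lo hi : ℝ} (hlo : 3 / 8 ≤ lo) :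
    NoSqueeze (polyFun 4 φ 2) (box lo hi) := by
  rintro i j p ⟨p1, p2, p3, p4⟩ v ⟨v1, v2, v3, v4⟩ - a - x y - - - - - hip hiv - - - -
  have hr : 0 < Real.cos (Real.pi / (4 : ℕ)) := cos_pi_div_pos le_rfl
  obtain ⟨m, hm⟩ := h.nrmAngle_eq
  have hden : 0 < (2 : ℝ) / 2 * Real.cos (Real.pi / (4 : ℕ)) := by positivity
  rw [polyFun_apply] at hip hiv
  rw [le_div_iff₀ hden, zero_mul, hm, comp_eq] at hip
  rw [div_le_iff₀ hden, zero_mul, hm, comp_eq] at hiv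
  -- an axis-parallel functional has the same sign on all points of the open quadrant
  have hp := comp_int_mul_pi_div_two (m + (i : ℕ)) ⟨1, 2⟩
  rw [comp_eq] at hp
  have hs := Real.cos_sq_add_sin_sq ((m + (i : ℕ) : ℤ) * (Real.pi / 2))
  have hu := comp_int_mul_pi_div_two (m + (i : ℕ)) 1
  have hw := comp_int_mul_pi_div_two (m + (i : ℕ)) Complex.I
  rw [comp_eq] at hu hw
  simp only [Complex.one_re, Complex.one_im, Complex.I_re, Complex.I_im] at hu hw hp
  set c := Real.cos ((m + (i : ℕ) : ℤ) * (Real.pi / 2))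
  set s := Real.sin ((m + (i : ℕ) : ℤ) * (Real.pi / 2))
  have hc : c = 1 ∨ c = 0 ∨ c = -1 := by
    rcases hu with h | h | h | h
    · left; linarith
    · right; left; linarith
    · right; right; linarith
    · right; left; linarith
  have hs' : s = 1 ∨ s = 0 ∨ s = -1 := by
    rcases hw with h | h | h | h
    · right; left; linarith
    · left; linarith
    · right; left; linarith
    · right; right; linarith
  rcases hc with h | h | h <;> rcases hs' with h' | h' | h' <;> rw [h, h'] at hs hip hiv <;>
    norm_num at hs <;> linarith

/-! ### All tiles and quadrant centres -/

theorem dir_int_mul_pi_div_two (τ : ℕ) : dir (τ * (Real.pi / 2)) = Complex.I ^ τ := by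
  rw [dir]
  have : ((τ * (Real.pi / 2) : ℝ) : ℂ) * Complex.I = τ * (Real.pi / 2 * Complex.I) := by
    push_cast; ring
  rw [this, Complex.exp_nat_mul, Complex.exp_pi_div_two_mul_I]

theorem dir_pi : dir Real.pi = -1 := by rw [dir, Complex.exp_pi_mul_I]

theorem comp_dir_mul (θ ω : ℝ) (w : ℂ) : comp θ (dir ω * w) = comp (θ - ω) w := by
  rw [comp, comp, mul_comm (dir ω), mul_assoc, ← dir_add]
  congr 3; ring

theorem polyFun_similarity (k : ℕ) (φ ω : ℝ) {l : ℝ} (hl : 0 < l) (i : Fin k) (w : ℂ) :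
    polyFun k φ (2 * l) i ((l : ℂ) * dir ω * w) = polyFun k (φ - ω) 2 i w := by
  rw [polyFun_apply, polyFun_apply, mul_assoc, comp_real_mul, comp_dir_mul]
  have : nrmAngle k φ (i : ℕ) - ω = nrmAngle k (φ - ω) (i : ℕ) := by unfold nrmAngle; ring
  rw [this]
  have h2 : (2 * l / 2 * Real.cos (Real.pi / k)) = l * (2 / 2 * Real.cos (Real.pi / k)) := by ring
  rw [h2, mul_div_mul_left _ _ hl.ne']

section Similarity

variable {ι : Type} [Fintype ι] [Nonempty ι] {n n' : ι → ℂ →L[ℝ] ℝ} {m : ℂ}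

theorem polyGauge_similarity (h : ∀ i w, n i (m * w) = n' i w) (w : ℂ) :
    polyGauge n (m * w) = polyGauge n' w := by
  simp only [polyGauge, h]

theorem Reachable.mono {E E' : Set ℂ} {A : ℂ} (h : Reachable n E A) (hE : E' ⊆ E) :
    Reachable n E' A :=
  ⟨h.pos, h.gauge_eq, fun e he => h.near e (hE he), fun e he => h.far e (hE he),
    fun e he => h.cone e (hE he)⟩

theorem NoSqueeze.mono {E E' : Set ℂ} (h : NoSqueeze n E) (hE : E' ⊆ E) : NoSqueeze n E' :=
  fun i j p hp v hv => h i j p (hE hp) v (hE hv)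

theorem Reachable.similarity (h : ∀ i w, n i (m * w) = n' i w) (hm : m ≠ 0) {E : Set ℂ} {A : ℂ}
    (hA : Reachable n' E A) : Reachable n ((fun w => m * w) '' E) (m * A) := by
  have hg := polyGauge_similarity h
  refine ⟨?_, ?_, ?_, ?_, ?_⟩
  · intro z hz
    obtain ⟨i, hi⟩ := hA.pos (z / m) (div_ne_zero hz hm)
    refine ⟨i, ?_⟩
    rwa [← h, mul_div_cancel₀ _ hm] at hi
  · rw [hg, hA.gauge_eq]
  · rintro _ ⟨e, he, rfl⟩
    change polyGauge n (m * A + m * e) < 1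
    rw [← mul_add, hg]
    exact hA.near e he
  · rintro _ ⟨e, he, rfl⟩ κ hκ hκ1
    change 1 < polyGauge n (κ • -(m * A) + m * e)
    have e1 : κ • -(m * A) = m * (κ • -A) := by
      simp only [Complex.real_smul]; ring
    rw [e1, hg] at hκ1
    rw [e1, ← mul_add, hg]
    exact hA.far e he κ hκ hκ1
  · rintro _ ⟨e, he, rfl⟩ B hB hBe x y hxy
    change polyGauge n (B + m * e) ≤ 1 at hBe
    change m * e = _ at hxy
    obtain ⟨B, rfl⟩ : ∃ B', B = m * B' := ⟨B / m, (mul_div_cancel₀ _ hm).symm⟩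
    rw [hg] at hB
    rw [← mul_add, hg] at hBe
    refine hA.cone e he B hB hBe x y (mul_left_cancel₀ hm ?_)
    rw [hxy]
    simp only [Complex.real_smul]; ring

theorem NoSqueeze.similarity (h : ∀ i w, n i (m * w) = n' i w) (hm : m ≠ 0) {E : Set ℂ}
    (hE : NoSqueeze n' E) : NoSqueeze n ((fun w => m * w) '' E) := by
  have hg := polyGauge_similarity h
  rintro i j _ ⟨p, hp, rfl⟩ _ ⟨v, hv, rfl⟩ hpv a ha x y hx hy hxy h1 h2 h3 h4 h5 h6 h7 h8
  obtain ⟨a, rfl⟩ : ∃ a', a = m * a' := ⟨a / m, (mul_div_cancel₀ _ hm).symm⟩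
  have e1 : x • (m * p) + y • (m * v) = m * (x • p + y • v) := by
    simp only [Complex.real_smul]; ring
  simp only [← mul_add, e1, h] at h1 h2 h3 h4 h5 h6 h7 h8
  rw [hg] at ha
  refine hE i j p hp v hv ?_ a ha x y hx hy hxy h1 h2 h3 h4 h5 h6 h7 h8
  intro h0
  apply hpv
  have : cross (m * p) (m * v) = (m.re ^ 2 + m.im ^ 2) * cross p v := by
    simp only [cross, Complex.mul_re, Complex.mul_im]; ring
  change cross (m * p) (m * v) = 0
  rw [this, h0, mul_zero]

end Similarity

/-- The least coordinate of the points of a tile, seen from a quadrant centre. -/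
noncomputable def boxLo (k : ℕ) : ℝ := superSide k / 4 - tileSide k / 2

/-- The supremum of the coordinates of the points of a tile, seen from a quadrant centre. -/
noncomputable def boxHi (k : ℕ) : ℝ := superSide k / 4 + tileSide k / 2

theorem boxLo_ge (k : ℕ) : 3 / 8 ≤ boxLo k := by
  unfold boxLo superSide tileSide
  split_ifs <;> norm_num

theorem boxHi_le (k : ℕ) : boxHi k ≤ 7 / 8 := by
  unfold boxHi superSide tileSide
  split_ifs <;> norm_num

theorem four_fifths_le_cos {k : ℕ} (hk : 5 ≤ k) : 4 / 5 ≤ Real.cos (Real.pi / k) := by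
  have := le_cos_pi_div (by norm_num) hk
  norm_num at this
  linarith

theorem one_sub_cos_sq_lt {k : ℕ} (hk : 5 ≤ k) :
    1 - Real.cos (Real.pi / k) ^ 2 < 2 * boxLo k ^ 2 := by
  unfold boxLo superSide tileSide
  split_ifs with h
  · have := four_fifths_le_cos hk
    nlinarith
  · have := le_cos_pi_div (m := 7) (k := k) (by norm_num) (by omega)
    norm_num at this
    nlinarith

theorem half_diagonal_lt_cos {k : ℕ} (hk : 5 ≤ k) :
    2 * (superSide k / 4) ^ 2 < Real.cos (Real.pi / k) ^ 2 := by
  unfold superSide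
  split_ifs with h
  · have := four_fifths_le_cos hk
    nlinarith
  · have := le_cos_pi_div (m := 7) (k := k) (by norm_num) (by omega)
    norm_num at this
    nlinarith

theorem superSide_eq (k : ℕ) : superSide k = tileSide k + 2 := by
  unfold superSide tileSide
  split_ifs <;> norm_num

theorem tileSide_pos (k : ℕ) : 0 < tileSide k := by
  unfold tileSide
  split_ifs <;> norm_num

theorem layerScale_pos (j : ℕ) : 0 < layerScale j := by unfold layerScale; positivity

theorem two_mul_layerScale (j : ℕ) : 2 * layerScale j = 2 ^ j := by unfold layerScale; ring

section

variable {k : ℕ} [hk : Fact (4 ≤ k)]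

theorem geometry_box {φ : ℝ} (h4 : k = 4 → AxisParallel φ) :
    (∃ A, Reachable (polyFun k φ 2) (box (boxLo k) (boxHi k)) A) ∧
      NoSqueeze (polyFun k φ 2) (box (boxLo k) (boxHi k)) := by
  rcases hk.out.eq_or_lt with h | h
  · subst h
    exact ⟨(h4 rfl).reachable_box (boxLo_ge 4) (boxHi_le 4), (h4 rfl).noSqueeze_box (boxLo_ge 4)⟩
  · exact ⟨reachable_box φ (boxLo_ge k) (boxHi_le k) (four_fifths_le_cos h) (one_sub_cos_sq_lt h),
      noSqueeze_box φ (boxLo_ge k) (boxHi_le k) (four_fifths_le_cos h)⟩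

end

/-- The similarity that maps the box of positions to the tile, seen from its quadrant centre `τ`. -/
noncomputable def tileSim (ψ : ℝ) (j : ℕ) (τ : Fin 4) : ℂ :=
  (layerScale j : ℂ) * dir (ψ + Real.pi + (τ : ℕ) * (Real.pi / 2))

theorem tileSim_eq (ψ : ℝ) (j : ℕ) (τ : Fin 4) :
    tileSim ψ j τ = -(layerScale j * dir ψ * Complex.I ^ (τ : ℕ)) := by
  rw [tileSim, dir_add, dir_add, dir_pi, dir_int_mul_pi_div_two]; ring

theorem tileSim_ne_zero (ψ : ℝ) (j : ℕ) (τ : Fin 4) : tileSim ψ j τ ≠ 0 := by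
  rw [tileSim]
  refine mul_ne_zero (by exact_mod_cast (layerScale_pos j).ne') ?_
  rw [← norm_ne_zero_iff, norm_dir]; exact one_ne_zero

theorem sub_quadCenter_mem (k : ℕ) (ψ : ℝ) (z₀ : ℂ) (j : ℕ) (t : ℤ × ℤ) (τ : Fin 4) {q : ℂ}
    (hq : q ∈ layerTile k ψ z₀ j t) :
    ∃ w ∈ box (boxLo k) (boxHi k), q - quadCenter k ψ z₀ j t τ = tileSim ψ j τ * w := by
  obtain ⟨h1, h2, h3, h4⟩ := hq
  have hl := layerScale_pos j
  set l := layerScale j with hldef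
  set u := (q - z₀) * dir (-ψ) with hu
  set d : ℂ := u - ⟨(t.1 + 1 / 2) * (l * tileSide k), (t.2 + 1 / 2) * (l * tileSide k)⟩ with hd
  have hqu : q = z₀ + dir ψ * u := by
    rw [hu, mul_comm (q - z₀), ← mul_assoc, dir_mul_dir_neg]; ring
  have hlC : (l : ℂ) ≠ 0 := by exact_mod_cast hl.ne'
  have hdre : |d.re / l| ≤ tileSide k / 2 := by
    rw [abs_div, abs_of_pos hl, div_le_iff₀ hl, abs_le, hd]
    simp only [Complex.sub_re]
    constructor <;> linarith
  have hdim : |d.im / l| ≤ tileSide k / 2 := by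
    rw [abs_div, abs_of_pos hl, div_le_iff₀ hl, abs_le, hd]
    simp only [Complex.sub_im]
    constructor <;> linarith
  rw [abs_le] at hdre hdim
  refine ⟨(superSide k / 4 : ℝ) * (1 + Complex.I) - d / (l : ℂ) * (-Complex.I) ^ (τ : ℕ), ?_, ?_⟩
  · have hre : (d / (l : ℂ)).re = d.re / l := Complex.div_ofReal_re _ _
    have him : (d / (l : ℂ)).im = d.im / l := Complex.div_ofReal_im _ _
    unfold box boxLo boxHi
    generalize d / (l : ℂ) = w at hre him
    rw [← hre] at hdre
    rw [← him] at hdim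
    fin_cases τ
    · refine ⟨?_, ?_, ?_, ?_⟩ <;> simp <;> linarith
    · refine ⟨?_, ?_, ?_, ?_⟩ <;> simp <;> linarith
    · refine ⟨?_, ?_, ?_, ?_⟩ <;> simp <;> linarith
    · have h3 : (-Complex.I) ^ 3 = Complex.I := by
        rw [pow_succ, neg_sq, Complex.I_sq]; ring
      refine ⟨?_, ?_, ?_, ?_⟩ <;> simp [h3] <;> linarith
  · have hI : Complex.I ^ (τ : ℕ) * (-Complex.I) ^ (τ : ℕ) = 1 := by
      rw [← mul_pow]; simp
    rw [tileSim_eq, quadCenter, tileCenter, hqu, ← hldef]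
    have hu' : u = d + ⟨(t.1 + 1 / 2) * (l * tileSide k), (t.2 + 1 / 2) * (l * tileSide k)⟩ := by
      rw [hd]; ring
    rw [hu']
    have e1 : -(↑l * dir ψ * Complex.I ^ (τ : ℕ)) * (((superSide k / 4 : ℝ) : ℂ) * (1 + Complex.I)
        - d / ↑l * (-Complex.I) ^ (τ : ℕ))
        = dir ψ * (d / l * l) * (Complex.I ^ (τ : ℕ) * (-Complex.I) ^ (τ : ℕ)) -
          dir ψ * ((l : ℂ) * ((superSide k / 4 : ℝ) : ℂ) * ((1 + Complex.I) * Complex.I ^ (τ : ℕ))) := by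
      ring
    rw [e1, hI, div_mul_cancel₀ _ hlC, mul_one]
    push_cast
    ring

/-! ### Types, extreme points and angles in a layer -/

/-- Squares have their sides parallel to the sides of the tiles. -/
def Aligned (k : ℕ) (φ ψ : ℝ) : Prop :=
  k = 4 → ∃ i : ℤ, ψ = φ + Real.pi / 4 + i * (Real.pi / 2)

theorem Aligned.axisParallel {k : ℕ} {φ ψ : ℝ} (h : Aligned k φ ψ) (hk : k = 4) (τ : ℕ) :
    AxisParallel (φ - (ψ + Real.pi + τ * (Real.pi / 2))) := by
  obtain ⟨i, hi⟩ := h hk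
  exact ⟨-i - 2 - τ, by rw [hi]; push_cast; ring⟩

section

variable {k : ℕ} [hk : Fact (4 ≤ k)] {φ ψ : ℝ}

theorem polyFun_tileSim (k : ℕ) (φ ψ : ℝ) (j : ℕ) (τ : Fin 4) (i : Fin k) (w : ℂ) :
    polyFun k φ (2 ^ j) i (tileSim ψ j τ * w) =
      polyFun k (φ - (ψ + Real.pi + (τ : ℕ) * (Real.pi / 2))) 2 i w := by
  rw [← two_mul_layerScale, tileSim, polyFun_similarity k φ _ (layerScale_pos j)]

theorem tile_reachable (h : Aligned k φ ψ) (P : Finset ℂ) (z₀ : ℂ) (j : ℕ) (t : ℤ × ℤ) (τ : Fin 4) :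
    (∃ A, Reachable (polyFun k φ (2 ^ j))
        ((fun q => q - quadCenter k ψ z₀ j t τ) '' (P ∩ layerTile k ψ z₀ j t)) A) ∧
      NoSqueeze (polyFun k φ (2 ^ j))
        ((fun q => q - quadCenter k ψ z₀ j t τ) '' (P ∩ layerTile k ψ z₀ j t)) := by
  have hsub : (fun q => q - quadCenter k ψ z₀ j t τ) '' (P ∩ layerTile k ψ z₀ j t) ⊆
      (fun w => tileSim ψ j τ * w) '' box (boxLo k) (boxHi k) := by
    rintro _ ⟨q, ⟨-, hq⟩, rfl⟩
    obtain ⟨w, hw, e⟩ := sub_quadCenter_mem k ψ z₀ j t τ hq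
    exact ⟨w, hw, e.symm⟩
  obtain ⟨⟨A, hA⟩, hS⟩ := geometry_box (k := k) fun h4 => h.axisParallel h4 τ
  exact ⟨⟨_, (hA.similarity (polyFun_tileSim k φ ψ j τ) (tileSim_ne_zero ψ j τ)).mono hsub⟩,
    (hS.similarity (polyFun_tileSim k φ ψ j τ) (tileSim_ne_zero ψ j τ)).mono hsub⟩

theorem tile_two_edges (φ ψ : ℝ) (P : Finset ℂ) (z₀ : ℂ) (j : ℕ) (t : ℤ × ℤ)
    (τ : Fin 4) (i l : Fin k) (hil : polyFun k φ (2 ^ j) i ≠ polyFun k φ (2 ^ j) l)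
    (e : ℂ) (he : e ∈ (fun q => q - quadCenter k ψ z₀ j t τ) '' (P ∩ layerTile k ψ z₀ j t))
    (e' : ℂ) (he' : e' ∈ (fun q => q - quadCenter k ψ z₀ j t τ) '' (P ∩ layerTile k ψ z₀ j t)) :
    {a : ℂ | polyFun k φ (2 ^ j) i (a + e) = 1 ∧
      polyFun k φ (2 ^ j) l (a + e') = 1}.Subsingleton := by
  obtain ⟨q, ⟨-, hq⟩, rfl⟩ := he
  obtain ⟨q', ⟨-, hq'⟩, rfl⟩ := he'
  obtain ⟨w, hw, e⟩ := sub_quadCenter_mem k ψ z₀ j t τ hq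
  obtain ⟨w', hw', e'⟩ := sub_quadCenter_mem k ψ z₀ j t τ hq'
  have hm := tileSim_ne_zero ψ j τ
  have hsim := polyFun_tileSim k φ ψ j τ
  have hil' : polyFun k (φ - (ψ + Real.pi + (τ : ℕ) * (Real.pi / 2))) 2 i ≠
      polyFun k (φ - (ψ + Real.pi + (τ : ℕ) * (Real.pi / 2))) 2 l := by
    intro h0
    apply hil
    ext z
    obtain ⟨z, rfl⟩ : ∃ z', z = tileSim ψ j τ * z' := ⟨z / _, (mul_div_cancel₀ _ hm).symm⟩
    rw [hsim, hsim, h0]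
  rintro a ⟨ha, ha'⟩ b ⟨hb, hb'⟩
  obtain ⟨a, rfl⟩ : ∃ a', a = tileSim ψ j τ * a' := ⟨a / _, (mul_div_cancel₀ _ hm).symm⟩
  obtain ⟨b, rfl⟩ : ∃ a', b = tileSim ψ j τ * a' := ⟨b / _, (mul_div_cancel₀ _ hm).symm⟩
  simp only [e, e', ← mul_add, hsim] at ha ha' hb hb'
  rw [subsingleton_two_edges _ (boxLo_ge k) (boxHi_le k) hil' hw hw' ⟨ha, ha'⟩ ⟨hb, hb'⟩]

theorem mem_body_layer {j : ℕ} {σ : KGon} (hσ : σ.diam = 2 ^ j) {z : ℂ} :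
    z ∈ σ.body k φ ↔ polyGauge (polyFun k φ (2 ^ j)) (z - σ.center) ≤ 1 := by
  rw [mem_body_iff_polyGauge φ (by rw [hσ]; positivity), hσ]

/-- An object that contains a quadrant centre of a tile and a point of `P` in the tile contains an
extreme point for this quadrant centre. -/
theorem exists_layerExtreme_mem (h : Aligned k φ ψ) (P : Finset ℂ) (z₀ : ℂ) (j : ℕ) (t : ℤ × ℤ)
    (τ : Fin 4) {σ : KGon} (hσ : σ.diam = 2 ^ j) (ho : quadCenter k ψ z₀ j t τ ∈ σ.body k φ)
    (hne : (σ.body k φ ∩ P ∩ layerTile k ψ z₀ j t).Nonempty) :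
    ∃ v ∈ layerExtreme k φ ψ P z₀ j t τ, v ∈ σ.body k φ := by
  obtain ⟨⟨A, hA⟩, -⟩ := tile_reachable h P z₀ j t τ
  rw [mem_body_layer hσ] at ho
  obtain ⟨q, ⟨hq1, hq2⟩, hq3⟩ := hne
  rw [mem_body_layer hσ] at hq1
  obtain ⟨v, hv, hv'⟩ := hA.exists_mem_extremePoints
    (P.finite_toSet.subset Set.inter_subset_left)
    (tile_two_edges φ ψ P z₀ j t τ) ho ⟨q, ⟨hq2, hq3⟩, hq1⟩
  refine ⟨v, ?_, (mem_body_layer hσ).2 hv'⟩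
  rw [layerExtreme, body_eq_polyGauge φ (by positivity)]
  exact hv

end

theorem cross_eq_norm_mul_sin (z w : ℂ) :
    cross z w = ‖z‖ * ‖w‖ * Real.sin (w.arg - z.arg) := by
  rw [Real.sin_sub, cross, ← Complex.norm_mul_cos_arg z, ← Complex.norm_mul_cos_arg w,
    ← Complex.norm_mul_sin_arg z, ← Complex.norm_mul_sin_arg w]
  simp only [Complex.norm_mul_cos_arg, Complex.norm_mul_sin_arg]
  have h1 := Complex.norm_mul_cos_arg z
  have h2 := Complex.norm_mul_cos_arg w
  have h3 := Complex.norm_mul_sin_arg z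
  have h4 := Complex.norm_mul_sin_arg w
  rw [← h1, ← h2, ← h3, ← h4]; ring

theorem cross_pos_of_arg_lt {z w : ℂ} (him : 0 < z.im ∧ 0 < w.im ∨ z.im < 0 ∧ w.im < 0)
    (h : z.arg < w.arg) : 0 < cross z w := by
  have hz : z ≠ 0 := by rintro rfl; simp at him
  have hw : w ≠ 0 := by rintro rfl; simp at him
  rw [cross_eq_norm_mul_sin]
  have hz' := norm_pos_iff.2 hz
  have hw' := norm_pos_iff.2 hw
  have : w.arg - z.arg < Real.pi := by
    rcases him with ⟨h1, h2⟩ | ⟨h1, h2⟩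
    · have h3 := Complex.arg_nonneg_iff.2 h1.le
      have h4 := Complex.arg_lt_pi_iff.2 (Or.inr h2.ne')
      linarith
    · have h3 := Complex.arg_neg_iff.2 h2
      have h4 := Complex.neg_pi_lt_arg z
      linarith
  have := Real.sin_pos_of_pos_of_lt_pi (sub_pos.2 h) this
  positivity

/-- All points of a tile are on the same side of the horizontal line through a quadrant centre. -/
theorem im_sub_quadCenter (k : ℕ) (ψ : ℝ) (z₀ : ℂ) (j : ℕ) (t : ℤ × ℤ) (τ : Fin 4) {q q' : ℂ}
    (hq : q ∈ layerTile k ψ z₀ j t) (hq' : q' ∈ layerTile k ψ z₀ j t) :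
    0 < ((q - quadCenter k ψ z₀ j t τ) * dir (-ψ)).im ∧
        0 < ((q' - quadCenter k ψ z₀ j t τ) * dir (-ψ)).im ∨
      ((q - quadCenter k ψ z₀ j t τ) * dir (-ψ)).im < 0 ∧
        ((q' - quadCenter k ψ z₀ j t τ) * dir (-ψ)).im < 0 := by
  obtain ⟨w, ⟨h1, h2, h3, h4⟩, e⟩ := sub_quadCenter_mem k ψ z₀ j t τ hq
  obtain ⟨w', ⟨h1', h2', h3', h4'⟩, e'⟩ := sub_quadCenter_mem k ψ z₀ j t τ hq'
  have hlo := boxLo_ge k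
  have hl := layerScale_pos j
  have hrot : ∀ w, tileSim ψ j τ * w * dir (-ψ) = (layerScale j : ℂ) * (-Complex.I ^ (τ : ℕ) * w) := by
    intro w
    rw [tileSim_eq]
    linear_combination (-(layerScale j : ℂ) * Complex.I ^ (τ : ℕ) * w) * dir_mul_dir_neg ψ
  rw [e, e', hrot, hrot, Complex.im_ofReal_mul, Complex.im_ofReal_mul]
  have k1 : 0 < w.re := by linarith
  have k2 : 0 < w.im := by linarith
  have k3 : 0 < w'.re := by linarith
  have k4 : 0 < w'.im := by linarith
  have m1 := mul_pos hl k1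
  have m2 := mul_pos hl k2
  have m3 := mul_pos hl k3
  have m4 := mul_pos hl k4
  fin_cases τ
  · right; simp; constructor <;> linarith
  · right; simp; constructor <;> linarith
  · left; simp; constructor <;> linarith
  · left; simp; constructor <;> linarith

theorem cross_mul_dir (a : ℝ) (z w : ℂ) : cross (z * dir a) (w * dir a) = cross z w := by
  simp only [cross, Complex.mul_re, Complex.mul_im, dir_re, dir_im]
  linear_combination (z.re * w.im - z.im * w.re) * Real.cos_sq_add_sin_sq a

section

variable {k : ℕ} {φ ψ : ℝ}

theorem cross_pos_of_quadAngle_lt {z₀ : ℂ} {j : ℕ} {t : ℤ × ℤ} {τ : Fin 4} {q q' : ℂ}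
    (hq : q ∈ layerTile k ψ z₀ j t) (hq' : q' ∈ layerTile k ψ z₀ j t)
    (h : quadAngle k ψ z₀ j t τ q < quadAngle k ψ z₀ j t τ q') :
    0 < cross (q - quadCenter k ψ z₀ j t τ) (q' - quadCenter k ψ z₀ j t τ) := by
  rw [← cross_mul_dir (-ψ)]
  exact cross_pos_of_arg_lt (im_sub_quadCenter k ψ z₀ j t τ hq hq') h

theorem mem_tile_of_mem_layerExtreme {P : Finset ℂ} {z₀ : ℂ} {j : ℕ} {t : ℤ × ℤ}
    {τ : Fin 4} {v : ℂ} (hv : v ∈ layerExtreme k φ ψ P z₀ j t τ) :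
    v ∈ P ∧ v ∈ layerTile k ψ z₀ j t := ⟨hv.1.1, hv.1.2⟩

/-- Different extreme points are seen from the quadrant centre in different directions. -/
theorem quadAngle_injOn (P : Finset ℂ) (z₀ : ℂ) (j : ℕ) (t : ℤ × ℤ) (τ : Fin 4) :
    Set.InjOn (quadAngle k ψ z₀ j t τ) (layerExtreme k φ ψ P z₀ j t τ) := by
  have hmain : ∀ v ∈ layerExtreme k φ ψ P z₀ j t τ, ∀ w ∈ layerExtreme k φ ψ P z₀ j t τ,
      quadAngle k ψ z₀ j t τ v = quadAngle k ψ z₀ j t τ w →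
      ‖v - quadCenter k ψ z₀ j t τ‖ ≤ ‖w - quadCenter k ψ z₀ j t τ‖ → v = w := by
    intro v hv w hw h hle
    refine hw.2.2 v hv.1 ?_
    set o := quadCenter k ψ z₀ j t τ
    have hw0 : (w - o) * dir (-ψ) ≠ 0 := by
      intro h0
      have := im_sub_quadCenter k ψ z₀ j t τ hw.1.2 hw.1.2
      rw [h0] at this
      simp at this
    have hv0 : (v - o) * dir (-ψ) ≠ 0 := by
      intro h0
      have := im_sub_quadCenter k ψ z₀ j t τ hv.1.2 hv.1.2
      rw [h0] at this
      simp at this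
    have h1 := (Complex.arg_eq_arg_iff hw0 hv0).1 h.symm
    rw [norm_mul, norm_mul, norm_dir, mul_one, mul_one] at h1
    have hwn : 0 < ‖w - o‖ := by
      rw [norm_pos_iff]; rintro h0; rw [h0, zero_mul] at hw0; exact hw0 rfl
    have h2 : v - o = (‖v - o‖ / ‖w - o‖ : ℝ) * (w - o) := by
      have hd : dir (-ψ) ≠ 0 := by rw [← norm_ne_zero_iff, norm_dir]; exact one_ne_zero
      apply mul_right_cancel₀ hd
      rw [← h1]; push_cast; ring
    refine ⟨1 - ‖v - o‖ / ‖w - o‖, ‖v - o‖ / ‖w - o‖, ?_, by positivity, by ring, ?_⟩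
    · rw [sub_nonneg, div_le_one hwn]; exact hle
    · have : v = o + (‖v - o‖ / ‖w - o‖ : ℝ) * (w - o) := by rw [← h2]; ring
      conv_rhs => rw [this]
      simp only [Complex.real_smul]; push_cast; ring
  intro v hv w hw h
  rcases le_total ‖v - quadCenter k ψ z₀ j t τ‖ ‖w - quadCenter k ψ z₀ j t τ‖ with hle | hle
  · exact hmain v hv w hw h hle
  · exact (hmain w hw v hv h.symm hle).symm

end

section

variable {k : ℕ} [hk : Fact (4 ≤ k)] {φ ψ : ℝ}

/-- If two objects contain a quadrant centre of a tile and share a point of `P` in the tile, their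
union contains a contiguous part of the extreme points. -/
theorem mem_or_mem_of_quadAngle (h : Aligned k φ ψ) {P : Finset ℂ} {z₀ : ℂ} {j : ℕ} {t : ℤ × ℤ}
    {τ : Fin 4} {σ₁ σ₂ : KGon} (hσ₁ : σ₁.diam = 2 ^ j) (hσ₂ : σ₂.diam = 2 ^ j)
    (ho₁ : quadCenter k ψ z₀ j t τ ∈ σ₁.body k φ) (ho₂ : quadCenter k ψ z₀ j t τ ∈ σ₂.body k φ)
    {q : ℂ} (hqP : q ∈ P) (hqt : q ∈ layerTile k ψ z₀ j t) (hq₁ : q ∈ σ₁.body k φ)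
    (hq₂ : q ∈ σ₂.body k φ) {v₁ v₂ z : ℂ} (hv₁ : v₁ ∈ layerExtreme k φ ψ P z₀ j t τ)
    (hv₂ : v₂ ∈ layerExtreme k φ ψ P z₀ j t τ) (hz : z ∈ layerExtreme k φ ψ P z₀ j t τ)
    (hvσ₁ : v₁ ∈ σ₁.body k φ) (hvσ₂ : v₂ ∈ σ₂.body k φ)
    (h₁ : quadAngle k ψ z₀ j t τ v₁ < quadAngle k ψ z₀ j t τ z)
    (h₂ : quadAngle k ψ z₀ j t τ z < quadAngle k ψ z₀ j t τ v₂) :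
    z ∈ σ₁.body k φ ∨ z ∈ σ₂.body k φ := by
  obtain ⟨⟨A, hA⟩, hS⟩ := tile_reachable h P z₀ j t τ
  rw [mem_body_layer hσ₁] at ho₁ hq₁ hvσ₁ ⊢
  rw [mem_body_layer hσ₂] at ho₂ hq₂ hvσ₂ ⊢
  have c₁ := cross_pos_of_quadAngle_lt hv₁.1.2 hz.1.2 h₁
  have c₂ := cross_pos_of_quadAngle_lt hz.1.2 hv₂.1.2 h₂
  rw [layerExtreme, body_eq_polyGauge φ (by positivity)] at hz
  refine hS.mem_or_mem_of_between hA.pos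
    (L := (Complex.reCLM + Complex.imCLM).comp (ContinuousLinearMap.mul ℝ ℂ (tileSim ψ j τ)⁻¹))
    ?_ ⟨hqP, hqt⟩ hv₁.1 hv₂.1 hz ho₁ ho₂ hq₁ hq₂ hvσ₁ hvσ₂ c₁ c₂
  rintro p ⟨-, hp⟩
  obtain ⟨w, ⟨k1, k2, k3, k4⟩, e⟩ := sub_quadCenter_mem k ψ z₀ j t τ hp
  rw [e]
  simp only [ContinuousLinearMap.comp_apply, ContinuousLinearMap.mul_apply',
    inv_mul_cancel_left₀ (tileSim_ne_zero ψ j τ), add_apply, Complex.reCLM_apply,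
    Complex.imCLM_apply]
  have := boxLo_ge k
  linarith

/-- An object of the layer that meets a tile contains one of the four quadrant centres of the
tile. -/
theorem exists_quadCenter_mem (h : Aligned k φ ψ) (z₀ : ℂ) (j : ℕ) (t : ℤ × ℤ) {σ : KGon}
    (hσ : σ.diam = 2 ^ j) (hne : (σ.body k φ ∩ layerTile k ψ z₀ j t).Nonempty) :
    ∃ τ : Fin 4, quadCenter k ψ z₀ j t τ ∈ σ.body k φ := by
  obtain ⟨q, hqσ, h1, h2, h3, h4⟩ := hne
  have hl := layerScale_pos j
  have hd := two_mul_layerScale j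
  have hdiam : σ.diam = 2 * layerScale j := by rw [hσ, hd]
  have hlC : (layerScale j : ℂ) ≠ 0 := by exact_mod_cast hl.ne'
  set l := layerScale j with hldef
  -- the coordinates of the centre and of `q` relative to the centre of the tile
  set cen : ℂ := ⟨(t.1 + 1 / 2) * (l * tileSide k), (t.2 + 1 / 2) * (l * tileSide k)⟩ with hcen
  obtain ⟨c, hc⟩ : ∃ c : ℂ, σ.center = z₀ + dir ψ * cen + l * dir ψ * c :=
    ⟨((σ.center - z₀) * dir (-ψ) - cen) / l, by
      rw [mul_right_comm, mul_div_cancel₀ _ hlC]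
      linear_combination (z₀ - σ.center) * dir_mul_dir_neg ψ⟩
  obtain ⟨u, hu⟩ : ∃ u : ℂ, q = z₀ + dir ψ * cen + l * dir ψ * u :=
    ⟨((q - z₀) * dir (-ψ) - cen) / l, by
      rw [mul_right_comm, mul_div_cancel₀ _ hlC]
      linear_combination (z₀ - q) * dir_mul_dir_neg ψ⟩
  have huval : (q - z₀) * dir (-ψ) = cen + l * u := by
    rw [hu]; linear_combination (cen + l * u) * dir_mul_dir_neg ψ
  rw [huval, Complex.add_re, Complex.re_ofReal_mul, hcen] at h1 h2
  rw [huval, Complex.add_im, Complex.im_ofReal_mul, hcen] at h3 h4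
  simp only at h1 h2 h3 h4
  have u1 : -(tileSide k / 2) ≤ u.re := by
    have : l * (-(tileSide k / 2)) ≤ l * u.re := by linarith
    exact le_of_mul_le_mul_left this hl
  have u2 : u.re ≤ tileSide k / 2 := by
    have : l * u.re ≤ l * (tileSide k / 2) := by linarith
    exact le_of_mul_le_mul_left this hl
  have u3 : -(tileSide k / 2) ≤ u.im := by
    have : l * (-(tileSide k / 2)) ≤ l * u.im := by linarith
    exact le_of_mul_le_mul_left this hl
  have u4 : u.im ≤ tileSide k / 2 := by
    have : l * u.im ≤ l * (tileSide k / 2) := by linarith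
    exact le_of_mul_le_mul_left this hl
  have hquad : ∀ τ : Fin 4, quadCenter k ψ z₀ j t τ - σ.center =
      l * dir ψ * ((superSide k / 4 : ℝ) * ((1 + Complex.I) * Complex.I ^ (τ : ℕ)) - c) := by
    intro τ
    rw [quadCenter, tileCenter, hc, ← hldef, hcen]
    push_cast
    ring
  -- the quadrant whose centre is closest to the centre of the object
  have hclose : ∀ B : ℝ, superSide k / 4 ≤ B → |c.re| ≤ B + superSide k / 4 →
      |c.im| ≤ B + superSide k / 4 → ∃ τ : Fin 4,
      |((superSide k / 4 : ℝ) * ((1 + Complex.I) * Complex.I ^ (τ : ℕ)) - c).re| ≤ B ∧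
      |((superSide k / 4 : ℝ) * ((1 + Complex.I) * Complex.I ^ (τ : ℕ)) - c).im| ≤ B := by
    intro B hB hre him
    rw [abs_le] at hre him
    rcases le_total 0 c.re with hr | hr <;> rcases le_total 0 c.im with hi | hi
    · refine ⟨0, ?_, ?_⟩ <;> simp [abs_le] <;> constructor <;> linarith
    · refine ⟨3, ?_, ?_⟩ <;> simp [abs_le, Complex.I_pow_three] <;> constructor <;> linarith
    · refine ⟨1, ?_, ?_⟩ <;> simp [abs_le] <;> constructor <;> linarith
    · refine ⟨2, ?_, ?_⟩ <;> simp [abs_le] <;> constructor <;> linarith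
  have hqc : q - σ.center = l * dir ψ * (u - c) := by rw [hu, hc]; ring
  have hss := superSide_eq k
  rcases hk.out.eq_or_lt with h4 | h4
  · subst h4
    have hax : AxisParallel (φ - ψ) := by
      obtain ⟨i, hi⟩ := h rfl
      exact ⟨-i, by rw [hi]; push_cast; ring⟩
    have hsim := polyGauge_similarity (polyFun_similarity 4 φ ψ hl)
    rw [mem_body_layer hσ, ← hd, hqc, hsim, hax.polyGauge_le_iff, one_mul, Complex.sub_re,
      Complex.sub_im, abs_le, abs_le] at hqσ
    obtain ⟨⟨q1, q2⟩, q3, q4⟩ := hqσ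
    obtain ⟨r1, r2⟩ := cos_pi_div_four_bounds
    have ht : tileSide 4 = 1 / 2 := by unfold tileSide; norm_num
    rw [ht] at u1 u2 u3 u4 hss
    obtain ⟨τ, hτ⟩ := hclose (Real.cos (Real.pi / 4)) (by linarith)
      (by rw [abs_le]; constructor <;> linarith) (by rw [abs_le]; constructor <;> linarith)
    refine ⟨τ, ?_⟩
    rw [mem_body_layer hσ, ← hd, hquad, hsim, hax.polyGauge_le_iff, one_mul]
    exact hτ
  · have hn := norm_le_of_mem_body (by rw [hσ]; positivity) hqσ
    have hnd : ∀ w : ℂ, ‖(l : ℂ) * dir ψ * w‖ = l * ‖w‖ := fun w => by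
      rw [norm_mul, norm_mul, norm_dir, mul_one, Complex.norm_real, Real.norm_eq_abs, abs_of_pos hl]
    rw [hqc, hnd, hdiam] at hn
    have hn1 : ‖u - c‖ ≤ 1 := by
      have : l * ‖u - c‖ ≤ l * 1 := by linarith
      exact le_of_mul_le_mul_left this hl
    have n1 := (Complex.abs_re_le_norm (u - c)).trans hn1
    have n2 := (Complex.abs_im_le_norm (u - c)).trans hn1
    rw [Complex.sub_re, abs_le] at n1
    rw [Complex.sub_im, abs_le] at n2
    obtain ⟨τ, hτ1, hτ2⟩ := hclose (superSide k / 4) le_rfl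
      (by rw [abs_le]; constructor <;> linarith) (by rw [abs_le]; constructor <;> linarith)
    refine ⟨τ, mem_body_of_norm_le hk.out φ (by rw [hσ]; positivity) ?_⟩
    rw [hquad, hnd, hdiam, mul_div_cancel_left₀ _ (two_ne_zero' ℝ)]
    gcongr
    have hr0 := cos_pi_div_pos hk.out
    refine le_of_lt (lt_of_pow_lt_pow_left₀ 2 hr0.le ?_)
    rw [norm_sq_eq]
    have hhd := half_diagonal_lt_cos (k := k) h4
    have s1 := sq_le_sq' (abs_le.1 hτ1).1 (abs_le.1 hτ1).2
    have s2 := sq_le_sq' (abs_le.1 hτ2).1 (abs_le.1 hτ2).2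
    linarith

end

/-! ### Vertex rankings of paths -/

theorem le_floorLog2 {m : ℕ} {x : ℝ} (h : 2 ^ m ≤ x) : m ≤ floorLog2 x := by
  apply Nat.le_floor
  rw [Real.le_logb_iff_rpow_le one_lt_two (lt_of_lt_of_le (by positivity) h), Real.rpow_natCast]
  exact h

theorem floorLog2_mono {x y : ℝ} (hx : 0 ≤ x) (h : x ≤ y) : floorLog2 x ≤ floorLog2 y := by
  rcases hx.lt_or_eq with hx | rfl
  · exact Nat.floor_mono (Real.logb_le_logb_of_le one_lt_two hx h)
  · simp [floorLog2]

/-- Between two numbers with the same power of two there is one with a larger power. -/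
theorem exists_between_padicValNat_lt {a b : ℕ} (ha : 0 < a) (hab : a < b)
    (h : padicValNat 2 a = padicValNat 2 b) :
    ∃ m, a < m ∧ m < b ∧ padicValNat 2 a < padicValNat 2 m := by
  have h2 : Fact (Nat.Prime 2) := ⟨Nat.prime_two⟩
  set e := padicValNat 2 a with he
  obtain ⟨a', ha'⟩ : 2 ^ e ∣ a := pow_padicValNat_dvd
  obtain ⟨b', hb'⟩ : 2 ^ e ∣ b := h ▸ pow_padicValNat_dvd
  have hodd : ∀ x x' : ℕ, 0 < x → x = 2 ^ e * x' → padicValNat 2 x = e → ¬ 2 ∣ x' := by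
    rintro x x' hx hxx hv ⟨y, rfl⟩
    have hdvd : 2 ^ (e + 1) ∣ x := ⟨y, by rw [hxx]; ring⟩
    have := (padicValNat_dvd_iff_le hx.ne').1 hdvd
    omega
  have h3 := hodd a a' ha ha' rfl
  have h4 := hodd b b' (by omega) hb' h.symm
  have hpos : 0 < 2 ^ e := by positivity
  have hlt : a' < b' := by
    rw [ha', hb'] at hab
    exact lt_of_mul_lt_mul_left hab hpos.le
  refine ⟨2 ^ e * (a' + 1), ?_, ?_, ?_⟩
  · rw [ha']; exact Nat.mul_lt_mul_of_pos_left (by omega) hpos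
  · rw [hb']; exact Nat.mul_lt_mul_of_pos_left (by omega) hpos
  · obtain ⟨y, hy⟩ : 2 ∣ a' + 1 := by omega
    have hdvd : 2 ^ (e + 1) ∣ 2 ^ e * (a' + 1) := ⟨y, by rw [hy]; ring⟩
    have := (padicValNat_dvd_iff_le (by positivity)).1 hdvd
    omega

/-- A walk in the path graph passes all points between its ends. -/
theorem mem_support_of_between {V : Set ℂ} {θ : ℂ → ℝ} (hinj : Set.InjOn θ V) {x y : V}
    (w : (pathGraph V θ).Walk x y) {z : V} (h1 : θ x < θ z) (h2 : θ z < θ y) : z ∈ w.support := by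
  induction w with
  | nil => exact absurd (h1.trans h2) (lt_irrefl _)
  | @cons u v y hadj p ih =>
    rw [SimpleGraph.Walk.support_cons, List.mem_cons]
    right
    rcases lt_trichotomy (θ v) (θ z) with h | h | h
    · exact ih h h2
    · have : v = z := Subtype.ext (hinj v.2 z.2 h)
      rw [← this]
      exact SimpleGraph.Walk.start_mem_support p
    · obtain ⟨-, ⟨-, h3⟩ | ⟨h3, -⟩⟩ := (SimpleGraph.fromRel_adj _ _ _).1 hadj
      · exact absurd ⟨h1, h⟩ (h3 z z.2)
      · exact absurd (h3.trans (h1.trans h)) (lt_irrefl _)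

/-- Between two points of the path there is a path without further detours. -/
theorem exists_monotone_path {V : Set ℂ} (hV : V.Finite) {θ : ℂ → ℝ} {x y : V} (h : θ x < θ y) :
    ∃ w : (pathGraph V θ).Walk x y, w.IsPath ∧ ∀ z ∈ w.support, θ x ≤ θ z ∧ θ z ≤ θ y := by
  induction hn : {v : ℂ | v ∈ V ∧ θ x < θ v ∧ θ v ≤ θ y}.ncard using Nat.strong_induction_on
    generalizing x with
  | _ N ih =>
  have hfin : {v : ℂ | v ∈ V ∧ θ x < θ v ∧ θ v ≤ θ y}.Finite := hV.subset fun v hv => hv.1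
  obtain ⟨u, ⟨huV, hxu, huy⟩, humin⟩ := Set.exists_min_image _ θ hfin ⟨y, y.2, h, le_rfl⟩
  have hadj : (pathGraph V θ).Adj x ⟨u, huV⟩ := by
    refine (SimpleGraph.fromRel_adj _ _ _).2 ⟨?_, Or.inl ⟨hxu, ?_⟩⟩
    · rintro rfl; exact lt_irrefl _ hxu
    · rintro r hr ⟨h1, h2⟩
      exact absurd (humin r ⟨hr, h1, h2.le.trans huy⟩) (not_le.2 h2)
  rcases huy.lt_or_eq with hlt | heq
  · obtain ⟨w, hw, hsupp⟩ := ih _ (by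
      rw [← hn]
      refine Set.ncard_lt_ncard ⟨fun v hv => ⟨hv.1, hxu.trans hv.2.1, hv.2.2⟩, fun hsub => ?_⟩ hfin
      exact lt_irrefl _ (hsub ⟨huV, hxu, huy⟩).2.1) (x := ⟨u, huV⟩) hlt rfl
    refine ⟨SimpleGraph.Walk.cons hadj w, ?_, ?_⟩
    · rw [SimpleGraph.Walk.cons_isPath_iff]
      exact ⟨hw, fun hx => absurd (hsupp x hx).1 (not_le.2 hxu)⟩
    · intro z hz
      rw [SimpleGraph.Walk.support_cons, List.mem_cons] at hz
      rcases hz with rfl | hz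
      · exact ⟨le_rfl, h.le⟩
      · exact ⟨hxu.le.trans (hsupp z hz).1, (hsupp z hz).2⟩
  · have hadj' : (pathGraph V θ).Adj x y := by
      refine (SimpleGraph.fromRel_adj _ _ _).2 ⟨?_, Or.inl ⟨h, ?_⟩⟩
      · rintro rfl; exact lt_irrefl _ h
      · rintro r hr ⟨h1, h2⟩
        exact absurd (humin r ⟨hr, h1, h2.le⟩) (not_le.2 (heq ▸ h2))
    refine ⟨SimpleGraph.Walk.cons hadj' SimpleGraph.Walk.nil, ?_, ?_⟩
    · rw [SimpleGraph.Walk.cons_isPath_iff]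
      refine ⟨SimpleGraph.Walk.IsPath.nil, ?_⟩
      rw [SimpleGraph.Walk.support_nil, List.mem_singleton]
      rintro rfl; exact lt_irrefl _ h
    · intro z hz
      rw [SimpleGraph.Walk.support_cons, SimpleGraph.Walk.support_nil, List.mem_cons,
        List.mem_singleton] at hz
      rcases hz with rfl | rfl
      · exact ⟨le_rfl, h.le⟩
      · exact ⟨h.le, le_rfl⟩

theorem IsVertexRanking.exists_between {V : Set ℂ} (hV : V.Finite) {θ : ℂ → ℝ}
    (hinj : Set.InjOn θ V) {N : ℕ} {c : V → ℕ} (hc : IsVertexRanking (pathGraph V θ) N c) {x y : V}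
    (h : θ x < θ y) (hxy : c x = c y) : ∃ z : V, θ x < θ z ∧ θ z < θ y ∧ c x < c z := by
  obtain ⟨w, hw, hsupp⟩ := exists_monotone_path hV h
  obtain ⟨z, hz, hzx, hzy, hlt⟩ := hc.2 x y (by rintro rfl; exact lt_irrefl _ h) w hw hxy
  obtain ⟨h1, h2⟩ := hsupp z hz
  refine ⟨z, lt_of_le_of_ne h1 fun h0 => hzx ?_, lt_of_le_of_ne h2 fun h0 => hzy ?_, hlt⟩
  · exact Subtype.ext (hinj z.2 x.2 h0.symm)
  · exact Subtype.ext (hinj z.2 y.2 h0)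

/-- The ruler sequence, one plus the exponent of two in the position, is a vertex ranking. -/
theorem exists_isVertexRanking {V : Set ℂ} (hV : V.Finite) {θ : ℂ → ℝ} (hinj : Set.InjOn θ V) :
    ∃ c : V → ℕ, IsVertexRanking (pathGraph V θ) (floorLog2 (2 * V.ncard)) c := by
  classical
  have h2 : Fact (Nat.Prime 2) := ⟨Nat.prime_two⟩
  set S : Finset ℝ := hV.toFinset.image θ with hS
  have hcard : S.card = V.ncard := by
    rw [hS, Finset.card_image_of_injOn (by simpa using hinj), Set.ncard_eq_toFinset_card V hV]
  have hmem : ∀ v : V, θ v ∈ S := fun v =>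
    Finset.mem_image.2 ⟨v, hV.mem_toFinset.2 v.2, rfl⟩
  set f := S.orderIsoOfFin hcard with hf
  set idx : V → ℕ := fun v => (f.symm ⟨θ v, hmem v⟩ : Fin V.ncard) + 1 with hidx
  have hidx_lt : ∀ v w : V, θ v < θ w ↔ idx v < idx w := by
    intro v w
    simp only [hidx, add_lt_add_iff_right, Fin.val_fin_lt]
    rw [f.symm.lt_iff_lt, Subtype.mk_lt_mk]
  have hidx_le : ∀ v, idx v ≤ V.ncard := fun v => (f.symm ⟨θ v, hmem v⟩ : Fin V.ncard).2
  have hsurj : ∀ m, 0 < m → m ≤ V.ncard → ∃ v, idx v = m := by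
    intro m h0 h1
    obtain ⟨v, hv, hv'⟩ := Finset.mem_image.1 (f ⟨m - 1, by omega⟩).2
    refine ⟨⟨v, hV.mem_toFinset.1 hv⟩, ?_⟩
    have : (⟨θ v, hmem ⟨v, hV.mem_toFinset.1 hv⟩⟩ : S) = f ⟨m - 1, by omega⟩ := Subtype.ext hv'
    simp only [hidx, this, OrderIso.symm_apply_apply]
    omega
  have hkey : ∀ (x y : V) (w : (pathGraph V θ).Walk x y), idx x < idx y →
      padicValNat 2 (idx x) = padicValNat 2 (idx y) →
      ∃ z ∈ w.support, z ≠ x ∧ z ≠ y ∧ padicValNat 2 (idx x) < padicValNat 2 (idx z) := by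
    intro x y w hlt heq
    obtain ⟨m, h1, h2, h3⟩ := exists_between_padicValNat_lt (by simp [hidx]) hlt heq
    obtain ⟨z, rfl⟩ := hsurj m (by omega) (h2.le.trans (hidx_le y))
    refine ⟨z, mem_support_of_between hinj w ((hidx_lt _ _).2 h1) ((hidx_lt _ _).2 h2), ?_, ?_, h3⟩
    · rintro rfl; exact lt_irrefl _ h1
    · rintro rfl; exact lt_irrefl _ h2
  refine ⟨fun v => padicValNat 2 (idx v) + 1, fun v => ⟨Nat.le_add_left _ _, ?_⟩, ?_⟩
  · apply le_floorLog2
    have h3 : 2 ^ padicValNat 2 (idx v) ≤ idx v :=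
      Nat.le_of_dvd (by simp [hidx]) pow_padicValNat_dvd
    have h4 : (2 : ℝ) ^ padicValNat 2 (idx v) ≤ V.ncard := by exact_mod_cast h3.trans (hidx_le v)
    rw [pow_succ]
    linarith
  · intro x y hxy w _ heq
    have heq' : padicValNat 2 (idx x) = padicValNat 2 (idx y) := by simpa using heq
    rcases lt_trichotomy (idx x) (idx y) with h | h | h
    · obtain ⟨z, hz, h1, h2, h3⟩ := hkey x y w h heq'
      exact ⟨z, hz, h1, h2, by simpa using h3⟩
    · exfalso
      have h1 := (hidx_lt x y).not.2 h.not_lt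
      have h2 := (hidx_lt y x).not.2 h.not_gt
      exact hxy (Subtype.ext (hinj x.2 y.2 (le_antisymm (not_lt.1 h2) (not_lt.1 h1))))
    · obtain ⟨z, hz, h1, h2, h3⟩ := hkey y x w.reverse h heq'.symm
      rw [SimpleGraph.Walk.support_reverse, List.mem_reverse] at hz
      exact ⟨z, hz, h2, h1, by simpa [heq'] using h3⟩

/-! ### The preprocessing -/

theorem finite_layerExtreme (k : ℕ) (φ ψ : ℝ) (P : Finset ℂ) (z₀ : ℂ) (j : ℕ) (t : ℤ × ℤ)
    (τ : Fin 4) : (layerExtreme k φ ψ P z₀ j t τ).Finite :=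
  P.finite_toSet.subset fun _ hv => hv.1.1

theorem ncard_layerExtreme_le (k : ℕ) (φ ψ : ℝ) (P : Finset ℂ) (z₀ : ℂ) (j : ℕ) (t : ℤ × ℤ)
    (τ : Fin 4) : (layerExtreme k φ ψ P z₀ j t τ).ncard ≤ P.card := by
  rw [← Set.ncard_coe_finset]
  exact Set.ncard_le_ncard (fun _ hv => hv.1.1) P.finite_toSet

/-- A grid with the mesh `L` can be shifted such that finitely many numbers avoid it. -/
theorem exists_shift {L : ℝ} (S : Finset ℝ) : ∃ a : ℝ, ∀ x ∈ S, ∀ m : ℤ, x - a ≠ m * L := by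
  have hcount : (⋃ x ∈ S, Set.range fun m : ℤ => x - m * L).Countable :=
    S.countable_toSet.biUnion fun x _ => Set.countable_range _
  obtain ⟨a, ha⟩ : ∃ a, a ∉ ⋃ x ∈ S, Set.range fun m : ℤ => x - m * L := by
    by_contra! hcon
    exact Cardinal.not_countable_real ((hcount.mono fun a _ => hcon a))
  refine ⟨a, fun x hx m h => ha ?_⟩
  simp only [Set.mem_iUnion, Set.mem_range]
  exact ⟨x, hx, m, by rw [← h]; ring⟩

theorem exists_origin (k : ℕ) (ψ : ℝ) (P : Finset ℂ) (j : ℕ) :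
    ∃ z₀ : ℂ, ∀ p ∈ P, ∃ t, p ∈ interior (layerTile k ψ z₀ j t) := by
  classical
  have hL : 0 < layerScale j * tileSide k := mul_pos (layerScale_pos j) (tileSide_pos k)
  obtain ⟨a, ha⟩ := exists_shift (L := layerScale j * tileSide k)
    (P.image fun p => (p * dir (-ψ)).re)
  obtain ⟨b, hb⟩ := exists_shift (L := layerScale j * tileSide k)
    (P.image fun p => (p * dir (-ψ)).im)
  simp only [Finset.forall_mem_image] at ha hb
  have hfloor : ∀ x : ℝ, (∀ m : ℤ, x ≠ m * (layerScale j * tileSide k)) →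
      ∃ m : ℤ, m * (layerScale j * tileSide k) < x ∧ x < (m + 1) * (layerScale j * tileSide k) := by
    intro x hx
    refine ⟨⌊x / (layerScale j * tileSide k)⌋, lt_of_le_of_ne ?_ (hx _).symm, ?_⟩
    · rw [← le_div_iff₀ hL]; exact Int.floor_le _
    · rw [← div_lt_iff₀ hL]; exact Int.lt_floor_add_one _
  refine ⟨dir ψ * ⟨a, b⟩, fun p hp => ?_⟩
  have hcoord : (p - dir ψ * ⟨a, b⟩) * dir (-ψ) = p * dir (-ψ) - ⟨a, b⟩ := by
    linear_combination (-(⟨a, b⟩ : ℂ)) * dir_mul_dir_neg ψ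
  obtain ⟨t₁, h1, h2⟩ := hfloor _ (ha hp)
  obtain ⟨t₂, h3, h4⟩ := hfloor _ (hb hp)
  refine ⟨(t₁, t₂), mem_interior.2 ⟨{z | t₁ * (layerScale j * tileSide k) <
      ((z - dir ψ * ⟨a, b⟩) * dir (-ψ)).re ∧ ((z - dir ψ * ⟨a, b⟩) * dir (-ψ)).re <
      (t₁ + 1) * (layerScale j * tileSide k) ∧ t₂ * (layerScale j * tileSide k) <
      ((z - dir ψ * ⟨a, b⟩) * dir (-ψ)).im ∧ ((z - dir ψ * ⟨a, b⟩) * dir (-ψ)).im <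
      (t₂ + 1) * (layerScale j * tileSide k)}, ?_, ?_, ?_⟩⟩
  · rintro z ⟨q1, q2, q3, q4⟩
    exact ⟨q1.le, q2, q3.le, q4⟩
  · have hre : Continuous fun z : ℂ => ((z - dir ψ * ⟨a, b⟩) * dir (-ψ)).re := by fun_prop
    have him : Continuous fun z : ℂ => ((z - dir ψ * ⟨a, b⟩) * dir (-ψ)).im := by fun_prop
    exact (isOpen_lt continuous_const hre).inter ((isOpen_lt hre continuous_const).inter
      ((isOpen_lt continuous_const him).inter (isOpen_lt him continuous_const)))
  · change _ ∧ _ ∧ _ ∧ _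
    rw [hcoord]
    exact ⟨h1, h2, h3, h4⟩

theorem nonempty_preprocessing (k : ℕ) (φ ψ : ℝ) (P : Finset ℂ) :
    Nonempty (Preprocessing k φ ψ P) := by
  choose z₀ hz₀ using exists_origin k ψ P
  choose c hc using fun (j : ℕ) (t : ℤ × ℤ) (τ : Fin 4) =>
    exists_isVertexRanking (finite_layerExtreme k φ ψ P (z₀ j) j t τ)
      (quadAngle_injOn (φ := φ) P (z₀ j) j t τ)
  exact ⟨⟨z₀, hz₀, c, hc⟩⟩

/-! ### The tiles that an object meets -/

theorem tile_unique {ψ : ℝ} {z₀ : ℂ} {ℓ : ℝ} (hℓ : 0 < ℓ) {t t' : ℤ × ℤ} {z : ℂ}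
    (h : z ∈ tile ψ z₀ ℓ t) (h' : z ∈ tile ψ z₀ ℓ t') : t = t' := by
  have key : ∀ {x : ℝ} {m n : ℤ}, m * ℓ ≤ x → x < (n + 1) * ℓ → m ≤ n := by
    intro x m n h1 h2
    have h3 := lt_of_mul_lt_mul_right (h1.trans_lt h2) hℓ.le
    exact Int.lt_add_one_iff.1 (by exact_mod_cast h3)
  obtain ⟨a1, a2, a3, a4⟩ := h
  obtain ⟨b1, b2, b3, b4⟩ := h'
  exact Prod.ext (le_antisymm (key a1 b2) (key b1 a2)) (le_antisymm (key a3 b4) (key b3 a4))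

theorem layerTile_unique {k : ℕ} {ψ : ℝ} {z₀ : ℂ} {j : ℕ} {t t' : ℤ × ℤ} {z : ℂ}
    (h : z ∈ layerTile k ψ z₀ j t) (h' : z ∈ layerTile k ψ z₀ j t') : t = t' :=
  tile_unique (mul_pos (layerScale_pos j) (tileSide_pos k)) h h'

theorem exists_layerTile_mem {k : ℕ} {φ ψ : ℝ} {P : Finset ℂ} (D : Preprocessing k φ ψ P) (j : ℕ)
    {p : ℂ} (hp : p ∈ P) : ∃ t, p ∈ layerTile k ψ (D.origin j) j t :=
  (D.mem_interior j p hp).imp fun _ h => interior_subset h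

theorem quarter_le_tileSide (k : ℕ) : 1 / 4 ≤ tileSide k := by
  unfold tileSide; split_ifs <;> norm_num

theorem metTiles_subset (k : ℕ) (φ ψ : ℝ) (x : ℂ) : ∃ a b : ℤ,
    {t : ℤ × ℤ | (KGon.body k φ ⟨x, 2⟩ ∩ tile ψ 0 (tileSide k) t).Nonempty} ⊆
      (Finset.Ico a (a + 9) ×ˢ Finset.Ico b (b + 9) : Finset (ℤ × ℤ)) := by
  have hs := quarter_le_tileSide k
  have hs0 := tileSide_pos k
  have key : ∀ {x y : ℝ} {m : ℤ}, |y - x| ≤ 1 → m * tileSide k ≤ y → y < (m + 1) * tileSide k →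
      m ∈ Finset.Ico ⌊(x - 1) / tileSide k⌋ (⌊(x - 1) / tileSide k⌋ + 9) := by
    intro x y m hxy h1 h2
    obtain ⟨h3, h4⟩ := abs_le.1 hxy
    have h5 := Int.lt_floor_add_one ((x - 1) / tileSide k)
    have h6 := Int.floor_le ((x - 1) / tileSide k)
    have e : (x - 1) / tileSide k * tileSide k = x - 1 := div_mul_cancel₀ _ hs0.ne'
    rw [Finset.mem_Ico]
    constructor
    · have : ((⌊(x - 1) / tileSide k⌋ : ℤ) : ℝ) < m + 1 :=
        lt_of_mul_lt_mul_right (by nlinarith) hs0.le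
      exact Int.lt_add_one_iff.1 (by exact_mod_cast this)
    · have : (m : ℝ) < ⌊(x - 1) / tileSide k⌋ + 9 :=
        lt_of_mul_lt_mul_right (by nlinarith) hs0.le
      exact_mod_cast this
  refine ⟨⌊((x * dir (-ψ)).re - 1) / tileSide k⌋, ⌊((x * dir (-ψ)).im - 1) / tileSide k⌋, ?_⟩
  rintro ⟨t₁, t₂⟩ ⟨z, hz, h1, h2, h3, h4⟩
  have hn : ‖(z - x) * dir (-ψ)‖ ≤ 1 := by
    rw [norm_mul, norm_dir, mul_one]
    simpa using norm_le_of_mem_body (by norm_num) hz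
  rw [sub_zero] at h1 h2 h3 h4
  rw [Finset.mem_coe, Finset.mem_product]
  refine ⟨key ?_ h1 h2, key ?_ h3 h4⟩
  · rw [← Complex.sub_re, ← sub_mul]; exact (Complex.abs_re_le_norm _).trans hn
  · rw [← Complex.sub_im, ← sub_mul]; exact (Complex.abs_im_le_norm _).trans hn

theorem ncard_metTiles_le (k : ℕ) (φ ψ : ℝ) (x : ℂ) :
    {t : ℤ × ℤ | (KGon.body k φ ⟨x, 2⟩ ∩ tile ψ 0 (tileSide k) t).Nonempty}.ncard ≤ 81 := by
  obtain ⟨a, b, h⟩ := metTiles_subset k φ ψ x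
  refine (Set.ncard_le_ncard h (Finset.finite_toSet _)).trans ?_
  rw [Set.ncard_coe_finset, Finset.card_product, Int.card_Ico, Int.card_Ico]
  simp

theorem maxTiles_le (k : ℕ) (φ ψ : ℝ) : maxTiles k φ ψ ≤ 81 :=
  ciSup_le fun x => ncard_metTiles_le k φ ψ x

theorem mem_body_scale {k : ℕ} (hk : 4 ≤ k) {φ : ℝ} (j : ℕ) (c z z₀ : ℂ) :
    z ∈ KGon.body k φ ⟨c, 2 ^ j⟩ ↔
      ((1 / layerScale j : ℝ) : ℂ) * (z - z₀) ∈
        KGon.body k φ ⟨((1 / layerScale j : ℝ) : ℂ) * (c - z₀), 2⟩ := by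
  have hl := layerScale_pos j
  rw [mem_body_iff hk φ (by positivity), mem_body_iff hk φ (by norm_num)]
  refine forall_congr' fun i => ?_
  have e : ((1 / layerScale j : ℝ) : ℂ) * (z - z₀) - ((1 / layerScale j : ℝ) : ℂ) * (c - z₀) =
      ((1 / layerScale j : ℝ) : ℂ) * (z - c) := by ring
  simp only
  rw [e, comp_real_mul, ← two_mul_layerScale, one_div, inv_mul_le_iff₀ hl]
  ring_nf

theorem mem_layerTile_scale {k : ℕ} {ψ : ℝ} {j : ℕ} {t : ℤ × ℤ} (z z₀ : ℂ) :
    z ∈ layerTile k ψ z₀ j t ↔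
      ((1 / layerScale j : ℝ) : ℂ) * (z - z₀) ∈ tile ψ 0 (tileSide k) t := by
  have hl := layerScale_pos j
  have h1 : ∀ a x : ℝ, a * (layerScale j * tileSide k) ≤ x ↔
      a * tileSide k ≤ 1 / layerScale j * x := by
    intro a x
    rw [one_div, le_inv_mul_iff₀ hl]; ring_nf
  have h2 : ∀ a x : ℝ, x < a * (layerScale j * tileSide k) ↔
      1 / layerScale j * x < a * tileSide k := by
    intro a x
    rw [one_div, inv_mul_lt_iff₀ hl]; ring_nf
  simp only [layerTile, tile, Set.mem_ofPred_eq, sub_zero, mul_assoc, Complex.re_ofReal_mul,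
    Complex.im_ofReal_mul]
  rw [h1, h1, h2, h2]

/-- A translate of diameter `2 ^ j` meets at most `maxTiles k φ ψ` tiles of its layer. -/
theorem layerMetTiles_bound {k : ℕ} (hk : 4 ≤ k) (φ ψ : ℝ) (z₀ : ℂ) (j : ℕ) {σ : KGon}
    (hσ : σ.diam = 2 ^ j) :
    {t : ℤ × ℤ | (σ.body k φ ∩ layerTile k ψ z₀ j t).Nonempty}.Finite ∧
      {t : ℤ × ℤ | (σ.body k φ ∩ layerTile k ψ z₀ j t).Nonempty}.ncard ≤ maxTiles k φ ψ := by
  obtain ⟨c, w⟩ := σ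
  obtain rfl : w = 2 ^ j := hσ
  set x := ((1 / layerScale j : ℝ) : ℂ) * (c - z₀) with hx
  have hsub : {t : ℤ × ℤ | (KGon.body k φ ⟨c, 2 ^ j⟩ ∩ layerTile k ψ z₀ j t).Nonempty} ⊆
      {t : ℤ × ℤ | (KGon.body k φ ⟨x, 2⟩ ∩ tile ψ 0 (tileSide k) t).Nonempty} := by
    rintro t ⟨z, h1, h2⟩
    exact ⟨_, (mem_body_scale hk j c z z₀).1 h1, (mem_layerTile_scale z z₀).1 h2⟩
  obtain ⟨a, b, h⟩ := metTiles_subset k φ ψ x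
  have hfin := (Finset.finite_toSet _).subset h
  refine ⟨hfin.subset hsub, (Set.ncard_le_ncard hsub hfin).trans ?_⟩
  exact le_ciSup (f := fun x : ℂ =>
      {t : ℤ × ℤ | (KGon.body k φ ⟨x, 2⟩ ∩ tile ψ 0 (tileSide k) t).Nonempty}.ncard)
    ⟨81, by rintro _ ⟨y, rfl⟩; exact ncard_metTiles_le k φ ψ y⟩ x

/-! ### Algorithm ES and its potential -/

section

variable {k : ℕ} {φ ψ : ℝ} {P : Finset ℂ}

theorem IsType.unique {D : Preprocessing k φ ψ P} {j : ℕ} {t : ℤ × ℤ} {σ : KGon} {τ τ' : Fin 4}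
    (h : IsType D j t σ τ) (h' : IsType D j t σ τ') : τ = τ' := by
  rcases lt_trichotomy τ τ' with hlt | heq | hlt
  · exact absurd h.1 (h'.2 _ hlt)
  · exact heq
  · exact absurd h'.1 (h.2 _ hlt)

theorem exists_isType [hk : Fact (4 ≤ k)] (h : Aligned k φ ψ) (D : Preprocessing k φ ψ P) (j : ℕ)
    (t : ℤ × ℤ) {σ : KGon} (hσ : σ.diam = 2 ^ j)
    (hne : (σ.body k φ ∩ layerTile k ψ (D.origin j) j t).Nonempty) :
    ∃ τ, IsType D j t σ τ := by
  classical
  have hex := exists_quadCenter_mem h (D.origin j) j t hσ hne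
  exact ⟨Fin.find _ hex, Fin.find_spec hex, fun _ hlt => Fin.find_min hex hlt⟩

/-- `v` has the largest colour among the extreme points in `σ`, and `σ` has type `τ`. -/
def IsTop (D : Preprocessing k φ ψ P) (j : ℕ) (t : ℤ × ℤ) (σ : KGon) (τ : Fin 4) (v : ℂ) : Prop :=
  IsType D j t σ τ ∧
    ∃ hv : v ∈ layerExtreme k φ ψ P (D.origin j) j t τ, v ∈ σ.body k φ ∧
      ∀ (w : ℂ) (hw : w ∈ layerExtreme k φ ψ P (D.origin j) j t τ), w ∈ σ.body k φ →
        D.rank j t τ ⟨w, hw⟩ ≤ D.rank j t τ ⟨v, hv⟩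

theorem isSelected_iff {D : Preprocessing k φ ψ P} {j : ℕ} {t : ℤ × ℤ} {σ : KGon} {v : ℂ} :
    IsSelected D j t σ v ↔ ∃ τ, IsTop D j t σ τ v := Iff.rfl

/-- Two objects of the same type with a common point of `P` in the tile cannot have different
points of the same largest colour: an extreme point of larger colour between these two points
would lie in one of the objects. -/
theorem IsTop.eq_of_rank_eq [hk : Fact (4 ≤ k)] (h : Aligned k φ ψ) {D : Preprocessing k φ ψ P}
    {j : ℕ} {t : ℤ × ℤ} {σ₁ σ₂ : KGon} {τ : Fin 4} {v₁ v₂ q : ℂ}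
    (hσ₁ : σ₁.diam = 2 ^ j) (hσ₂ : σ₂.diam = 2 ^ j)
    (h₁ : IsTop D j t σ₁ τ v₁) (h₂ : IsTop D j t σ₂ τ v₂) (hqP : q ∈ P)
    (hqt : q ∈ layerTile k ψ (D.origin j) j t) (hq₁ : q ∈ σ₁.body k φ) (hq₂ : q ∈ σ₂.body k φ)
    (hr : D.rank j t τ ⟨v₁, h₁.2.1⟩ = D.rank j t τ ⟨v₂, h₂.2.1⟩) : v₁ = v₂ := by
  have ⟨⟨ho₁, _⟩, hv₁, hvσ₁, hmax₁⟩ := h₁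
  have ⟨⟨ho₂, _⟩, hv₂, hvσ₂, hmax₂⟩ := h₂
  have hfin := finite_layerExtreme k φ ψ P (D.origin j) j t τ
  have hinj := quadAngle_injOn (k := k) (φ := φ) (ψ := ψ) P (D.origin j) j t τ
  by_contra hne
  rcases lt_trichotomy (quadAngle k ψ (D.origin j) j t τ v₁)
    (quadAngle k ψ (D.origin j) j t τ v₂) with hlt | heq | hlt
  · obtain ⟨z, hz₁, hz₂, hc⟩ := (D.isRanking j t τ).exists_between hfin hinj
      (x := ⟨v₁, hv₁⟩) (y := ⟨v₂, hv₂⟩) hlt hr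
    rcases mem_or_mem_of_quadAngle h hσ₁ hσ₂ ho₁ ho₂ hqP hqt hq₁ hq₂ hv₁ hv₂ z.2 hvσ₁ hvσ₂ hz₁ hz₂
      with hm | hm
    · exact absurd (hmax₁ z z.2 hm) (not_le.2 hc)
    · exact absurd (hmax₂ z z.2 hm) (not_le.2 (hr ▸ hc))
  · exact hne (hinj hv₁ hv₂ heq)
  · obtain ⟨z, hz₂, hz₁, hc⟩ := (D.isRanking j t τ).exists_between hfin hinj
      (x := ⟨v₂, hv₂⟩) (y := ⟨v₁, hv₁⟩) hlt hr.symm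
    rcases mem_or_mem_of_quadAngle h hσ₂ hσ₁ ho₂ ho₁ hqP hqt hq₂ hq₁ hv₂ hv₁ z.2 hvσ₂ hvσ₁ hz₂ hz₁
      with hm | hm
    · exact absurd (hmax₂ z z.2 hm) (not_le.2 hc)
    · exact absurd (hmax₁ z z.2 hm) (not_le.2 (hr ▸ hc))

theorem exists_isTop [hk : Fact (4 ≤ k)] (h : Aligned k φ ψ) (D : Preprocessing k φ ψ P) (j : ℕ)
    (t : ℤ × ℤ) {σ : KGon} (hσ : σ.diam = 2 ^ j)
    (hne : (σ.body k φ ∩ P ∩ layerTile k ψ (D.origin j) j t).Nonempty) :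
    ∃ τ v, IsTop D j t σ τ v := by
  obtain ⟨τ, hτ⟩ := exists_isType h D j t hσ (hne.mono fun z hz => ⟨hz.1.1, hz.2⟩)
  obtain ⟨v₀, hv₀, hv₀σ⟩ := exists_layerExtreme_mem h P (D.origin j) j t τ hσ hτ.1 hne
  have hfin : {v : layerExtreme k φ ψ P (D.origin j) j t τ | (v : ℂ) ∈ σ.body k φ}.Finite :=
    have := (finite_layerExtreme k φ ψ P (D.origin j) j t τ).to_subtype
    Set.toFinite _
  obtain ⟨v, hvσ, hmax⟩ := Set.exists_max_image _ (D.rank j t τ) hfin ⟨⟨v₀, hv₀⟩, hv₀σ⟩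
  exact ⟨τ, v, hτ, v.2, hvσ, fun w hw hwσ => hmax ⟨w, hw⟩ hwσ⟩

theorem IsSelected.unique [hk : Fact (4 ≤ k)] (h : Aligned k φ ψ) {D : Preprocessing k φ ψ P}
    {j : ℕ} {t : ℤ × ℤ} {σ : KGon} (hσ : σ.diam = 2 ^ j)
    {v w : ℂ} (hv : IsSelected D j t σ v) (hw : IsSelected D j t σ w) : v = w := by
  obtain ⟨τ, hv⟩ := isSelected_iff.1 hv
  obtain ⟨τ', hw⟩ := isSelected_iff.1 hw
  obtain rfl := hv.1.unique hw.1
  have hvP := mem_tile_of_mem_layerExtreme hv.2.1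
  exact hv.eq_of_rank_eq h hσ hσ hw hvP.1 hvP.2 hv.2.2.1 hv.2.2.1
    (le_antisymm (hw.2.2.2 _ hv.2.1 hv.2.2.1) (hv.2.2.2 _ hw.2.1 hw.2.2.1))

theorem IsSelected.mem {D : Preprocessing k φ ψ P} {j : ℕ} {t : ℤ × ℤ} {σ : KGon} {v : ℂ}
    (hv : IsSelected D j t σ v) :
    v ∈ P ∧ v ∈ layerTile k ψ (D.origin j) j t ∧ v ∈ σ.body k φ := by
  obtain ⟨τ, -, hv, hvσ, -⟩ := hv
  have := mem_tile_of_mem_layerExtreme hv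
  exact ⟨this.1, this.2, hvσ⟩

theorem subset_esStep (D : Preprocessing k φ ψ P) (j : ℕ) (H : Finset ℂ) (σ : KGon) :
    H ⊆ esStep D j H σ := by
  unfold esStep
  split_ifs
  · exact subset_rfl
  · exact Finset.subset_union_left

theorem esStep_subset (D : Preprocessing k φ ψ P) (j : ℕ) {H : Finset ℂ} (hH : H ⊆ P) (σ : KGon) :
    esStep D j H σ ⊆ P := by
  classical
  unfold esStep
  split_ifs
  · exact hH
  · exact Finset.union_subset hH (Finset.filter_subset _ _)

theorem esStep_of_disjoint (D : Preprocessing k φ ψ P) (j : ℕ) (H : Finset ℂ) {σ : KGon}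
    (hσ : ¬ (σ.body k φ ∩ P).Nonempty) : esStep D j H σ = H := by
  classical
  unfold esStep
  split_ifs
  · rfl
  · rw [Finset.filter_false_of_mem, Finset.union_empty]
    rintro v - ⟨t, ⟨z, hz, -⟩, -⟩
    exact hσ ⟨z, hz⟩

theorem mem_esStep_of_isTop {D : Preprocessing k φ ψ P} {j : ℕ} {H : Finset ℂ} {σ : KGon}
    (hH : ∀ p ∈ H, p ∉ σ.body k φ) {t : ℤ × ℤ} {τ : Fin 4} {v : ℂ} (hv : IsTop D j t σ τ v) :
    v ∈ esStep D j H σ := by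
  classical
  have hsel : IsSelected D j t σ v := ⟨τ, hv⟩
  obtain ⟨h1, h2, h3⟩ := hsel.mem
  unfold esStep
  rw [if_neg (by push Not; exact hH), Finset.mem_union, Finset.mem_filter]
  exact Or.inr ⟨h1, t, ⟨v, ⟨h3, h1⟩, h2⟩, hsel⟩

theorem exists_mem_esStep [hk : Fact (4 ≤ k)] (h : Aligned k φ ψ) (D : Preprocessing k φ ψ P)
    (j : ℕ) (H : Finset ℂ) {σ : KGon} (hσ : σ.diam = 2 ^ j) (hne : (σ.body k φ ∩ P).Nonempty) :
    ∃ v ∈ esStep D j H σ, v ∈ σ.body k φ := by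
  by_cases hH : ∃ p ∈ H, p ∈ σ.body k φ
  · obtain ⟨p, hp, hpσ⟩ := hH
    exact ⟨p, subset_esStep D j H σ hp, hpσ⟩
  · push Not at hH
    obtain ⟨p, hpσ, hpP⟩ := hne
    obtain ⟨t, ht⟩ := exists_layerTile_mem D j hpP
    obtain ⟨τ, v, hv⟩ := exists_isTop h D j t hσ ⟨p, ⟨hpσ, hpP⟩, ht⟩
    exact ⟨v, mem_esStep_of_isTop hH hv, hv.2.2.1⟩

theorem card_esStep_le [hk : Fact (4 ≤ k)] (h : Aligned k φ ψ) (D : Preprocessing k φ ψ P)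
    (j : ℕ) (H : Finset ℂ) {σ : KGon} (hσ : σ.diam = 2 ^ j) :
    (esStep D j H σ).card ≤ H.card + maxTiles k φ ψ := by
  classical
  unfold esStep
  split_ifs
  · exact Nat.le_add_right _ _
  · refine (Finset.card_union_le _ _).trans (Nat.add_le_add_left ?_ _)
    obtain ⟨hfin, hle⟩ := layerMetTiles_bound hk.out φ ψ (D.origin j) j hσ
    refine le_trans ?_ hle
    rw [Set.ncard_eq_toFinset_card _ hfin]
    -- a point that is added is determined by its tile
    have hex : ∀ v, ∃ t, (∃ t, IsSelected D j t σ v) → IsSelected D j t σ v := fun v => by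
      by_cases hv : ∃ t, IsSelected D j t σ v
      · exact hv.imp fun _ h _ => h
      · exact ⟨0, fun h => absurd h hv⟩
    choose f hf using hex
    refine Finset.card_le_card_of_injOn f ?_ ?_
    · intro v hv
      obtain ⟨-, t, -, hv⟩ := Finset.mem_filter.1 hv
      have := (hf v ⟨t, hv⟩).mem
      simp only [Set.Finite.coe_toFinset]
      exact ⟨v, this.2.2, this.2.1⟩
    · intro v hv w hw hvw
      obtain ⟨-, t, -, hv⟩ := Finset.mem_filter.1 hv
      obtain ⟨-, t', -, hw⟩ := Finset.mem_filter.1 hw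
      exact (hf v ⟨t, hv⟩).unique h hσ (hvw ▸ hf w ⟨t', hw⟩)

/-- The colours of those points of `H` that ES could have selected for a translate of type `τ` that
contains `p`, in the tile of `p`. -/
def usedColours (D : Preprocessing k φ ψ P) (j : ℕ) (p : ℂ) (τ : Fin 4) (H : Finset ℂ) : Set ℕ :=
  {n | ∃ (t : ℤ × ℤ) (σ : KGon) (v : ℂ) (hv : IsTop D j t σ τ v),
    p ∈ layerTile k ψ (D.origin j) j t ∧ p ∈ σ.body k φ ∧ σ.diam = 2 ^ j ∧ v ∈ H ∧
      D.rank j t τ ⟨v, hv.2.1⟩ = n}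

/-- The number of colours that are still unused for `p`, summed over the four types. -/
noncomputable def potential (D : Preprocessing k φ ψ P) (j : ℕ) (p : ℂ) (H : Finset ℂ) : ℕ :=
  ∑ τ : Fin 4, (floorLog2 (2 * P.card) - (usedColours D j p τ H).ncard)

theorem usedColours_subset (D : Preprocessing k φ ψ P) (j : ℕ) (p : ℂ) (τ : Fin 4)
    (H : Finset ℂ) :
    usedColours D j p τ H ⊆ (Finset.Icc 1 (floorLog2 (2 * P.card)) : Finset ℕ) := by
  rintro n ⟨t, σ, v, hv, -, -, -, -, rfl⟩
  have h1 := (D.isRanking j t τ).1 ⟨v, hv.2.1⟩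
  have h2 : ((layerExtreme k φ ψ P (D.origin j) j t τ).ncard : ℝ) ≤ P.card := by
    exact_mod_cast ncard_layerExtreme_le k φ ψ P (D.origin j) j t τ
  rw [Finset.coe_Icc]
  exact ⟨h1.1, h1.2.trans (floorLog2_mono (by positivity) (by linarith))⟩

theorem finite_usedColours (D : Preprocessing k φ ψ P) (j : ℕ) (p : ℂ) (τ : Fin 4)
    (H : Finset ℂ) : (usedColours D j p τ H).Finite :=
  (Finset.finite_toSet _).subset (usedColours_subset D j p τ H)

theorem ncard_usedColours_le (D : Preprocessing k φ ψ P) (j : ℕ) (p : ℂ) (τ : Fin 4)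
    (H : Finset ℂ) : (usedColours D j p τ H).ncard ≤ floorLog2 (2 * P.card) := by
  refine (Set.ncard_le_ncard (usedColours_subset D j p τ H) (Finset.finite_toSet _)).trans ?_
  rw [Set.ncard_coe_finset, Nat.card_Icc, Nat.add_sub_cancel]

theorem usedColours_mono (D : Preprocessing k φ ψ P) (j : ℕ) (p : ℂ) (τ : Fin 4)
    {H H' : Finset ℂ} (hH : H ⊆ H') : usedColours D j p τ H ⊆ usedColours D j p τ H' := by
  rintro n ⟨t, σ, v, hv, h1, h2, h3, h4, h5⟩
  exact ⟨t, σ, v, hv, h1, h2, h3, hH h4, h5⟩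

theorem potential_anti (D : Preprocessing k φ ψ P) (j : ℕ) (p : ℂ)
    {H H' : Finset ℂ} (hH : H ⊆ H') : potential D j p H' ≤ potential D j p H :=
  Finset.sum_le_sum fun τ _ => Nat.sub_le_sub_left
    (Set.ncard_le_ncard (usedColours_mono D j p τ hH) (finite_usedColours D j p τ H')) _

theorem potential_le (D : Preprocessing k φ ψ P) (j : ℕ) (p : ℂ) (H : Finset ℂ) :
    potential D j p H ≤ 4 * floorLog2 (2 * P.card) := by
  refine (Finset.sum_le_sum fun τ _ => Nat.sub_le _ _).trans ?_
  simp

/-- Whenever an object that contains `p` is not yet stabbed, ES uses a new colour for `p`. -/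
theorem potential_esStep_lt [hk : Fact (4 ≤ k)] (h : Aligned k φ ψ) (D : Preprocessing k φ ψ P)
    (j : ℕ) {H : Finset ℂ} {σ : KGon} (hσ : σ.diam = 2 ^ j) {p : ℂ} (hpP : p ∈ P)
    (hpσ : p ∈ σ.body k φ) (hH : ∀ q ∈ H, q ∉ σ.body k φ) :
    potential D j p (esStep D j H σ) < potential D j p H := by
  obtain ⟨t, ht⟩ := exists_layerTile_mem D j hpP
  obtain ⟨τ, v, hv⟩ := exists_isTop h D j t hσ ⟨p, ⟨hpσ, hpP⟩, ht⟩
  have hsub := subset_esStep D j H σ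
  refine Finset.sum_lt_sum (fun τ _ => Nat.sub_le_sub_left
    (Set.ncard_le_ncard (usedColours_mono D j p τ hsub) (finite_usedColours D j p τ _)) _)
    ⟨τ, Finset.mem_univ _, ?_⟩
  have hlt : (usedColours D j p τ H).ncard < (usedColours D j p τ (esStep D j H σ)).ncard := by
    refine Set.ncard_lt_ncard ⟨usedColours_mono D j p τ hsub, fun hcon => ?_⟩
      (finite_usedColours D j p τ _)
    obtain ⟨t', σ', v', hv', ht', hpσ', hσ', hvH, hr⟩ :=
      hcon ⟨t, σ, v, hv, ht, hpσ, hσ, mem_esStep_of_isTop hH hv, rfl⟩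
    obtain rfl := layerTile_unique ht ht'
    obtain rfl := hv'.eq_of_rank_eq h hσ' hσ hv hpP ht hpσ' hpσ hr
    exact hH _ hvH hv.2.2.1
  have := ncard_usedColours_le D j p τ (esStep D j H σ)
  omega

/-! ### Sequences of translates -/

theorem subset_foldl_esStep (D : Preprocessing k φ ψ P) (j : ℕ) (l : List KGon) (H : Finset ℂ) :
    H ⊆ l.foldl (esStep D j) H := by
  induction l generalizing H with
  | nil => exact subset_rfl
  | cons σ l ih => exact (subset_esStep D j H σ).trans (ih _)

theorem foldl_esStep_subset (D : Preprocessing k φ ψ P) (j : ℕ) (l : List KGon) {H : Finset ℂ}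
    (hH : H ⊆ P) : l.foldl (esStep D j) H ⊆ P := by
  induction l generalizing H with
  | nil => exact hH
  | cons σ l ih => exact ih (esStep_subset D j hH σ)

theorem foldl_esStep_of_disjoint (D : Preprocessing k φ ψ P) (j : ℕ) {l : List KGon} (H : Finset ℂ)
    (hl : ∀ σ ∈ l, ¬ (σ.body k φ ∩ P).Nonempty) : l.foldl (esStep D j) H = H := by
  induction l generalizing H with
  | nil => rfl
  | cons σ l ih =>
    rw [List.foldl_cons, esStep_of_disjoint D j H (hl σ List.mem_cons_self)]
    exact ih _ fun σ' h' => hl σ' (List.mem_cons_of_mem _ h')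

theorem exists_mem_foldl_esStep [hk : Fact (4 ≤ k)] (h : Aligned k φ ψ)
    (D : Preprocessing k φ ψ P) (j : ℕ) {l : List KGon} (H : Finset ℂ)
    (hl : ∀ σ ∈ l, σ.diam = 2 ^ j) {σ : KGon} (hσl : σ ∈ l) (hσ : (σ.body k φ ∩ P).Nonempty) :
    ∃ v ∈ l.foldl (esStep D j) H, v ∈ σ.body k φ := by
  induction l generalizing H with
  | nil => simp at hσl
  | cons σ' l ih =>
    rcases List.mem_cons.1 hσl with rfl | hmem
    · obtain ⟨v, hv, hvσ⟩ := exists_mem_esStep h D j H (hl _ List.mem_cons_self) hσ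
      exact ⟨v, subset_foldl_esStep D j l _ hv, hvσ⟩
    · exact ih _ (fun σ' h' => hl σ' (List.mem_cons_of_mem _ h')) hmem

theorem card_foldl_esStep_le [hk : Fact (4 ≤ k)] (h : Aligned k φ ψ)
    (D : Preprocessing k φ ψ P) (j : ℕ) {l : List KGon} (H : Finset ℂ)
    (hl : ∀ σ ∈ l, σ.diam = 2 ^ j) :
    (l.foldl (esStep D j) H).card ≤ H.card + l.length * maxTiles k φ ψ := by
  induction l generalizing H with
  | nil => simp
  | cons σ l ih =>
    refine (ih _ fun σ' h' => hl σ' (List.mem_cons_of_mem _ h')).trans ?_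
    have := card_esStep_le h D j H (hl σ List.mem_cons_self)
    rw [List.length_cons, add_mul, one_mul]
    omega

theorem potential_foldl_esStep_lt [hk : Fact (4 ≤ k)] (h : Aligned k φ ψ)
    (D : Preprocessing k φ ψ P) (j : ℕ) {l : List KGon} {H : Finset ℂ} {σ : KGon}
    (hσ : σ.diam = 2 ^ j) {p : ℂ} (hpP : p ∈ P) (hpσ : p ∈ σ.body k φ)
    (hH : ∀ q ∈ H, q ∉ σ.body k φ) :
    potential D j p ((σ :: l).foldl (esStep D j) H) < potential D j p H :=
  (potential_anti D j p (subset_foldl_esStep D j l _)).trans_lt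
    (potential_esStep_lt h D j hσ hpP hpσ hH)

end

/-! ### The shrunk set of an object -/

theorem two_pow_layer_le {w : ℝ} (hw : 1 ≤ w) : 2 ^ layer w ≤ w := by
  have h0 : 0 ≤ Real.logb 2 w := Real.logb_nonneg (by norm_num) hw
  rw [← Real.rpow_natCast, ← Real.le_logb_iff_rpow_le (by norm_num) (by linarith)]
  exact Nat.floor_le h0

theorem lt_two_pow_layer_succ {w : ℝ} (hw : 1 ≤ w) : w < 2 ^ (layer w + 1) := by
  rw [← Real.rpow_natCast, ← Real.logb_lt_iff_lt_rpow (by norm_num) (by linarith)]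
  exact_mod_cast Nat.lt_floor_add_one (Real.logb 2 w)

theorem layer_lt {w M : ℝ} (hw : 1 ≤ w) (hM : w ≤ M) : layer w < floorLog2 (2 * M) := by
  apply le_floorLog2
  rw [pow_succ]
  have := two_pow_layer_le hw
  linarith

theorem diam_of_mem_shrunkSet {k : ℕ} {φ : ℝ} {σ σ' : KGon} (h : σ' ∈ shrunkSet k φ σ) :
    σ'.diam = 2 ^ layer σ.diam := by
  unfold shrunkSet at h
  split_ifs at h with hd
  · rw [List.mem_singleton.1 h]; exact hd
  · rcases List.mem_cons.1 h with rfl | h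
    · rfl
    · obtain ⟨i, rfl⟩ := List.mem_ofFn.1 h
      rfl

theorem length_shrunkSet (k : ℕ) (φ : ℝ) (σ : KGon) :
    0 < (shrunkSet k φ σ).length ∧ (shrunkSet k φ σ).length ≤ k + 1 := by
  unfold shrunkSet
  split_ifs <;> simp

theorem corner_eq (k : ℕ) (φ : ℝ) (σ : KGon) (i : Fin k) :
    σ.corner k φ i = σ.center + (σ.diam / 2 : ℝ) * vtx k φ (i : ℕ) := by
  simp [KGon.corner, vtx]

/-- The objects of the shrunk set are contained in the object. -/
theorem body_subset_of_mem_shrunkSet {k : ℕ} (hk : 4 ≤ k) (φ : ℝ) {σ σ' : KGon}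
    (hσ : 1 ≤ σ.diam) (h : σ' ∈ shrunkSet k φ σ) : σ'.body k φ ⊆ σ.body k φ := by
  have hd : 0 < σ.diam := by linarith
  have hle := two_pow_layer_le hσ
  have hr := cos_pi_div_pos hk
  have hpow : (0 : ℝ) < 2 ^ layer σ.diam := by positivity
  unfold shrunkSet at h
  split_ifs at h with hdiam
  · rw [List.mem_singleton.1 h]
  intro z hz
  refine (mem_body_iff hk φ hd).2 fun l => ?_
  rcases List.mem_cons.1 h with rfl | h
  · have := (mem_body_iff hk φ hpow).1 hz l
    simp only at this
    nlinarith
  · obtain ⟨i, rfl⟩ := List.mem_ofFn.1 h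
    have h1 := (mem_body_iff hk φ hpow).1 hz l
    simp only at h1
    have hv := comp_vtx_le (by omega : 0 < k) φ l (i : ℕ)
    set ρ : ℝ := 2 ^ layer σ.diam / σ.diam with hρ
    have hρ1 : ρ ≤ 1 := (div_le_one hd).2 hle
    have hρd : (2 : ℝ) ^ layer σ.diam = ρ * σ.diam := by rw [hρ]; field_simp
    rw [hρd] at h1
    have e : z - σ.center = (z - (σ.corner k φ i + (ρ : ℂ) * (σ.center - σ.corner k φ i))) +
        ((1 - ρ) * (σ.diam / 2) : ℝ) * vtx k φ (i : ℕ) := by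
      rw [corner_eq]; push_cast; ring
    rw [e, comp_add, comp_real_mul]
    have h2 : (1 - ρ) * (σ.diam / 2) * comp (nrmAngle k φ l) (vtx k φ (i : ℕ)) ≤
        (1 - ρ) * (σ.diam / 2) * Real.cos (Real.pi / k) :=
      mul_le_mul_of_nonneg_left hv (mul_nonneg (by linarith) (by linarith))
    nlinarith

/-- The distance of consecutive corners is at most the diameter of the incircle. -/
theorem norm_vtx_succ_sub_le {k : ℕ} (hk : 4 ≤ k) (φ : ℝ) (i : ℤ) :
    ‖vtx k φ (i + 1) - vtx k φ i‖ ≤ 2 * Real.cos (Real.pi / k) := by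
  have hr := cos_pi_div_pos hk
  have h2 := half_le_cos_sq hk
  have hk' : (0 : ℝ) < k := by exact_mod_cast (by omega : 0 < k)
  refine abs_le_of_sq_le_sq' ?_ (by positivity) |>.2
  have e : vtx k φ (i + 1) = vtx k φ i * dir (2 * (Real.pi / k)) := by
    rw [vtx, vtx, ← dir_add]; congr 1; push_cast; field_simp; ring
  rw [e, show vtx k φ i * dir (2 * (Real.pi / k)) - vtx k φ i =
    vtx k φ i * (dir (2 * (Real.pi / k)) - 1) by ring, norm_mul, vtx, norm_dir, one_mul, norm_sq_eq]
  simp only [Complex.sub_re, Complex.sub_im, Complex.one_re, Complex.one_im, dir_re, dir_im]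
  have h3 := Real.cos_sq_add_sin_sq (2 * (Real.pi / k))
  have h4 := Real.cos_two_mul (Real.pi / k)
  nlinarith

/-- If `v` and `v'` are consecutive corners of a polygon and `s ≥ t`, then the point `s v + t v'`
that is not in the concentric copy of ratio `ρ ≥ 1 / 2` is in the copy at the corner `v`. -/
theorem comp_shrunk_le {θ r ρ s t : ℝ} {v v' : ℂ} (hr : 0 ≤ r) (hv : comp θ v ≤ r)
    (hv' : comp θ v' ≤ r) (hd : ‖v' - v‖ ≤ 2 * r) (hρ : 1 / 2 ≤ ρ) (ht : 0 ≤ t) (hts : t ≤ s)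
    (h1 : s + t ≤ 1) (h2 : ρ ≤ s + t) :
    comp θ ((s : ℂ) * v + t * v' - ((1 - ρ : ℝ) : ℂ) * v) ≤ ρ * r := by
  rw [comp_sub, comp_add, comp_real_mul, comp_real_mul, comp_real_mul]
  rcases le_total (1 - ρ) s with h | h
  · have e1 := mul_le_mul_of_nonneg_left hv (sub_nonneg.2 h)
    have e2 := mul_le_mul_of_nonneg_left hv' ht
    nlinarith
  · have h3 := (comp_le_norm θ (v' - v)).trans hd
    rw [comp_sub] at h3
    have e1 := mul_le_mul_of_nonneg_left h3 (sub_nonneg.2 h)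
    have e2 := mul_le_mul_of_nonneg_left hv' (by linarith : 0 ≤ s + t - (1 - ρ))
    have e3 : 0 ≤ (2 * ρ - 1 + s - t) * r := mul_nonneg (by linarith) hr
    nlinarith

/-- The objects of the shrunk set cover the object. -/
theorem exists_mem_shrunkSet {k : ℕ} (hk : 4 ≤ k) (φ : ℝ) {σ : KGon} (hσ : 1 ≤ σ.diam) {z : ℂ}
    (hz : z ∈ σ.body k φ) : ∃ σ' ∈ shrunkSet k φ σ, z ∈ σ'.body k φ := by
  have hk0 : 0 < k := by omega
  have hd : 0 < σ.diam := by linarith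
  have hr := cos_pi_div_pos hk
  have hpow : (0 : ℝ) < 2 ^ layer σ.diam := by positivity
  unfold shrunkSet
  split_ifs with hdiam
  · exact ⟨σ, List.mem_singleton_self _, hz⟩
  set ρ : ℝ := 2 ^ layer σ.diam / σ.diam with hρ
  have hρd : (2 : ℝ) ^ layer σ.diam = ρ * σ.diam := by rw [hρ]; field_simp
  have hρ2 : 1 / 2 ≤ ρ := by
    have := lt_two_pow_layer_succ hσ
    rw [pow_succ] at this
    rw [hρ, le_div_iff₀ hd]; linarith
  obtain ⟨i, s, t, hs, ht, hw⟩ := exists_sector hk φ ((z - σ.center) / (σ.diam / 2 : ℝ))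
  have hd' : ((σ.diam / 2 : ℝ) : ℂ) ≠ 0 := by exact_mod_cast (by positivity : σ.diam / 2 ≠ 0)
  have hzc : z - σ.center = (σ.diam / 2 : ℝ) * ((s : ℂ) * vtx k φ i + t * vtx k φ (i + 1)) := by
    rw [← hw]; field_simp
  have hst : s + t ≤ 1 := by
    have h1 := (mem_body_iff hk φ hd).1 hz i
    rw [hzc, comp_real_mul, comp_add, comp_real_mul, comp_real_mul,
      comp_vtx_self hk0, comp_vtx_succ hk0, ← add_mul] at h1
    have h2 := le_of_mul_le_mul_left h1 (by positivity)
    exact le_of_mul_le_mul_right (by linarith) hr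
  -- membership in the copy at the corner `i'`
  have hcorner : ∀ i' : ℤ,
      (∀ l : ℤ, comp (nrmAngle k φ l) ((s : ℂ) * vtx k φ i + t * vtx k φ (i + 1) -
        ((1 - ρ : ℝ) : ℂ) * vtx k φ i') ≤ ρ * Real.cos (Real.pi / k)) →
      ∃ σ' ∈ (⟨σ.center, 2 ^ layer σ.diam⟩ :: List.ofFn fun i : Fin k =>
        ⟨σ.corner k φ i + (ρ : ℂ) * (σ.center - σ.corner k φ i), 2 ^ layer σ.diam⟩ : List KGon),
        z ∈ σ'.body k φ := by
    intro i' hi'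
    obtain ⟨m, q, rfl⟩ := exists_fin_add_mul hk0 i'
    rw [vtx_add_mul hk0] at hi'
    refine ⟨_, List.mem_cons_of_mem _ (List.mem_ofFn.2 ⟨m, rfl⟩),
      (mem_body_iff hk φ hpow).2 fun l => ?_⟩
    have e : z - (σ.corner k φ m + (ρ : ℂ) * (σ.center - σ.corner k φ m)) =
        (σ.diam / 2 : ℝ) * ((s : ℂ) * vtx k φ i + t * vtx k φ (i + 1) -
          ((1 - ρ : ℝ) : ℂ) * vtx k φ (m : ℕ)) := by
      rw [corner_eq]; push_cast at hzc ⊢; linear_combination hzc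
    simp only
    rw [e, comp_real_mul, hρd]
    have := mul_le_mul_of_nonneg_left (hi' l) (by positivity : 0 ≤ σ.diam / 2)
    linarith
  rcases le_total (s + t) ρ with h | h
  · refine ⟨_, List.mem_cons_self, (mem_body_iff hk φ hpow).2 fun l => ?_⟩
    simp only
    rw [hzc, comp_real_mul, comp_add, comp_real_mul, comp_real_mul, hρd]
    have e1 := mul_le_mul_of_nonneg_left (comp_vtx_le hk0 φ l i) hs
    have e2 := mul_le_mul_of_nonneg_left (comp_vtx_le hk0 φ l (i + 1)) ht
    have e3 : s * comp (nrmAngle k φ l) (vtx k φ i) + t * comp (nrmAngle k φ l) (vtx k φ (i + 1)) ≤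
        ρ * Real.cos (Real.pi / k) := by
      have := mul_le_mul_of_nonneg_right h hr.le
      linarith
    have := mul_le_mul_of_nonneg_left e3 (by positivity : 0 ≤ σ.diam / 2)
    linarith
  · have hdist := norm_vtx_succ_sub_le hk φ i
    rcases le_total t s with hts | hts
    · exact hcorner i fun l => comp_shrunk_le hr.le (comp_vtx_le hk0 φ l i)
        (comp_vtx_le hk0 φ l (i + 1)) hdist hρ2 ht hts hst h
    · refine hcorner (i + 1) fun l => ?_
      rw [add_comm ((s : ℂ) * _)]
      exact comp_shrunk_le hr.le (comp_vtx_le hk0 φ l (i + 1)) (comp_vtx_le hk0 φ l i)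
        (by rwa [norm_sub_rev]) hρ2 hs hts (by linarith) (by linarith)

/-! ### Random orders -/

/-- In a random order of `n` things, a given one comes first with probability at least `1 / n`. -/
theorem card_perm_le {n : ℕ} (z i₀ : Fin n) :
    Fintype.card (Equiv.Perm (Fin n)) ≤
      n * (Finset.univ.filter fun π : Equiv.Perm (Fin n) => π z = i₀).card := by
  rw [← Finset.card_univ, Finset.card_eq_sum_card_fiberwise
    (f := fun π : Equiv.Perm (Fin n) => π z) (t := Finset.univ)
    (fun _ _ => Finset.mem_coe.2 (Finset.mem_univ _))]
  calc _ ≤ ∑ _i : Fin n, (Finset.univ.filter fun π : Equiv.Perm (Fin n) => π z = i₀).card := by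
        refine Finset.sum_le_sum fun i _ => ?_
        refine Finset.card_le_card_of_injOn (fun π => Equiv.swap i i₀ * π) ?_ ?_
        · intro π hπ
          have hπ' : π z = i := by simpa using hπ
          simp [hπ']
        · intro π _ π' _ h
          exact mul_left_cancel h
    _ = _ := by simp

theorem exists_ofFn_eq_cons {α : Type*} {n : ℕ} (h : 0 < n) (f : Fin n → α) :
    ∃ l, List.ofFn f = f ⟨0, h⟩ :: l := by
  obtain ⟨m, rfl⟩ := Nat.exists_eq_succ_of_ne_zero h.ne'
  exact ⟨_, List.ofFn_succ⟩

theorem mem_ofFn_get_perm {α : Type*} {l : List α} (π : Equiv.Perm (Fin l.length)) {a : α} :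
    a ∈ List.ofFn (fun i => l.get (π i)) ↔ a ∈ l := by
  rw [List.mem_ofFn, List.mem_iff_get]
  constructor
  · rintro ⟨i, rfl⟩; exact ⟨π i, rfl⟩
  · rintro ⟨i, rfl⟩; exact ⟨π.symm i, by simp⟩

/-! ### Expected sizes -/

theorem expectedSize_pure (H : ℕ → Finset ℂ) :
    expectedSize (PMF.pure H) = ((output H).encard : ℝ≥0∞) := by
  classical
  unfold expectedSize
  rw [tsum_eq_single H]
  · simp
  · intro H' h
    simp [PMF.pure_apply, h]

theorem expectedSize_bind {α : Type*} (μ : PMF α) (f : α → PMF (ℕ → Finset ℂ)) :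
    expectedSize (μ.bind f) = ∑' a, μ a * expectedSize (f a) := by
  unfold expectedSize
  simp only [PMF.bind_apply, ← ENNReal.tsum_mul_right, ← ENNReal.tsum_mul_left]
  rw [ENNReal.tsum_comm]
  simp only [mul_assoc]

theorem expectedSize_uniform_bind {α : Type*} [Fintype α] [Nonempty α]
    (f : α → PMF (ℕ → Finset ℂ)) :
    expectedSize ((PMF.uniformOfFintype α).bind f) =
      (Fintype.card α : ℝ≥0∞)⁻¹ * ∑ a, expectedSize (f a) := by
  rw [expectedSize_bind, tsum_fintype, Finset.mul_sum]
  simp only [PMF.uniformOfFintype_apply]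

theorem encard_output_update_le {H : ℕ → Finset ℂ} {j a : ℕ} {X : Finset ℂ} (hX : H j ⊆ X)
    (hcard : X.card ≤ (H j).card + a) :
    (output (Function.update H j X)).encard ≤ (output H).encard + a := by
  classical
  have hsub : output (Function.update H j X) ⊆ output H ∪ ((X \ H j : Finset ℂ) : Set ℂ) := by
    intro z hz
    obtain ⟨i, hi⟩ := Set.mem_iUnion.1 hz
    rcases eq_or_ne i j with rfl | hij
    · rw [Function.update_self] at hi
      by_cases hzH : z ∈ H i
      · exact Or.inl (Set.mem_iUnion.2 ⟨i, hzH⟩)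
      · exact Or.inr (by simpa using ⟨hi, hzH⟩)
    · rw [Function.update_of_ne hij] at hi
      exact Or.inl (Set.mem_iUnion.2 ⟨i, hi⟩)
  refine (Set.encard_le_encard hsub).trans ((Set.encard_union_le _ _).trans ?_)
  gcongr
  rw [Set.encard_coe_eq_coe_finsetCard, Finset.card_sdiff_of_subset hX]
  exact_mod_cast (by omega)

/-! ### Algorithm HHR -/

section

variable {k : ℕ} {φ ψ : ℝ} {P : Finset ℂ}

/-- The result of HHR for `σ` when the shrunk set is fed to ES in the order `π`. -/
noncomputable def hhrResult (D : Preprocessing k φ ψ P) (H : ℕ → Finset ℂ) (σ : KGon)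
    (π : Equiv.Perm (Fin (shrunkSet k φ σ).length)) : ℕ → Finset ℂ :=
  Function.update H (layer σ.diam)
    ((List.ofFn fun i => (shrunkSet k φ σ).get (π i)).foldl (esStep D (layer σ.diam))
      (H (layer σ.diam)))

theorem hhrStep_of_hit (D : Preprocessing k φ ψ P) {H : ℕ → Finset ℂ} {σ : KGon}
    (h : (σ.body k φ ∩ output H).Nonempty) : hhrStep D H σ = PMF.pure H := if_pos h

theorem hhrStep_of_not_hit (D : Preprocessing k φ ψ P) {H : ℕ → Finset ℂ} {σ : KGon}
    (h : ¬ (σ.body k φ ∩ output H).Nonempty) :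
    hhrStep D H σ = (PMF.uniformOfFintype _).map (hhrResult D H σ) := if_neg h

theorem subset_output (H : ℕ → Finset ℂ) (j : ℕ) : (H j : Set ℂ) ⊆ output H :=
  Set.subset_iUnion (fun j => (H j : Set ℂ)) j

theorem le_hhrResult (D : Preprocessing k φ ψ P) (H : ℕ → Finset ℂ) (σ : KGon)
    (π : Equiv.Perm (Fin (shrunkSet k φ σ).length)) : H ≤ hhrResult D H σ π := by
  intro j
  unfold hhrResult
  rcases eq_or_ne j (layer σ.diam) with rfl | hj
  · rw [Function.update_self]
    exact subset_foldl_esStep D _ _ _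
  · rw [Function.update_of_ne hj]

theorem hhrResult_le (D : Preprocessing k φ ψ P) {H : ℕ → Finset ℂ} (hH : ∀ j, H j ⊆ P) (σ : KGon)
    (π : Equiv.Perm (Fin (shrunkSet k φ σ).length)) (j : ℕ) : hhrResult D H σ π j ⊆ P := by
  unfold hhrResult
  rcases eq_or_ne j (layer σ.diam) with rfl | hj
  · rw [Function.update_self]
    exact foldl_esStep_subset D _ _ (hH _)
  · rw [Function.update_of_ne hj]
    exact hH j

theorem hhrResult_hits [hk : Fact (4 ≤ k)] (h : Aligned k φ ψ) (D : Preprocessing k φ ψ P)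
    (H : ℕ → Finset ℂ) {σ : KGon} (hσ : 1 ≤ σ.diam) (hne : (σ.body k φ ∩ P).Nonempty)
    (π : Equiv.Perm (Fin (shrunkSet k φ σ).length)) :
    (σ.body k φ ∩ output (hhrResult D H σ π)).Nonempty := by
  obtain ⟨p, hpσ, hpP⟩ := hne
  obtain ⟨σ', hσ', hpσ'⟩ := exists_mem_shrunkSet hk.out φ hσ hpσ
  obtain ⟨v, hv, hvσ⟩ := exists_mem_foldl_esStep h D (layer σ.diam) (H (layer σ.diam))
    (fun τ hτ => diam_of_mem_shrunkSet ((mem_ofFn_get_perm π).1 hτ)) ((mem_ofFn_get_perm π).2 hσ')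
    ⟨p, hpσ', hpP⟩
  refine ⟨v, body_subset_of_mem_shrunkSet hk.out φ hσ hσ' hvσ,
    subset_output _ (layer σ.diam) ?_⟩
  unfold hhrResult
  rwa [Function.update_self]

theorem hhrResult_of_disjoint [hk : Fact (4 ≤ k)] (D : Preprocessing k φ ψ P)
    (H : ℕ → Finset ℂ) {σ : KGon} (hσ : 1 ≤ σ.diam) (hne : ¬ (σ.body k φ ∩ P).Nonempty)
    (π : Equiv.Perm (Fin (shrunkSet k φ σ).length)) : hhrResult D H σ π = H := by
  unfold hhrResult
  rw [foldl_esStep_of_disjoint, Function.update_eq_self]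
  intro σ' hσ' h
  exact hne (h.mono (Set.inter_subset_inter_left _
    (body_subset_of_mem_shrunkSet hk.out φ hσ ((mem_ofFn_get_perm π).1 hσ'))))

/-- The states of HHR grow, stay in `P`, and hit all objects that can be hit. -/
theorem hhrFrom_invariant [hk : Fact (4 ≤ k)] (h : Aligned k φ ψ) (D : Preprocessing k φ ψ P)
    (I : List KGon) (hI : ∀ σ ∈ I, 1 ≤ σ.diam) (H : ℕ → Finset ℂ) (hH : ∀ j, H j ⊆ P) :
    ∀ H' ∈ (hhrFrom D H I).support,
      H ≤ H' ∧ (∀ j, H' j ⊆ P) ∧ Hits k φ P I (output H') := by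
  induction I generalizing H with
  | nil =>
    intro H' hH'
    rw [hhrFrom, PMF.mem_support_pure_iff] at hH'
    subst hH'
    exact ⟨le_rfl, hH, by intro σ hσ; simp at hσ⟩
  | cons σ I ih =>
    intro H' hH'
    rw [hhrFrom, PMF.mem_support_bind_iff] at hH'
    obtain ⟨H₁, hH₁, hH'⟩ := hH'
    have hσ := hI σ List.mem_cons_self
    have hstep : H ≤ H₁ ∧ (∀ j, H₁ j ⊆ P) ∧
        ((σ.body k φ ∩ P).Nonempty → (σ.body k φ ∩ output H₁).Nonempty) := by
      by_cases hhit : (σ.body k φ ∩ output H).Nonempty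
      · rw [hhrStep_of_hit D hhit, PMF.mem_support_pure_iff] at hH₁
        subst hH₁
        exact ⟨le_rfl, hH, fun _ => hhit⟩
      · rw [hhrStep_of_not_hit D hhit, PMF.mem_support_map_iff] at hH₁
        obtain ⟨π, -, rfl⟩ := hH₁
        exact ⟨le_hhrResult D H σ π, hhrResult_le D hH σ π,
          fun hne => hhrResult_hits h D H hσ hne π⟩
    obtain ⟨h1, h2, h3⟩ := hstep
    obtain ⟨g1, g2, g3⟩ := ih (fun σ' h' => hI σ' (List.mem_cons_of_mem _ h')) H₁ h2 H' hH'
    refine ⟨h1.trans g1, g2, fun σ' hσ' hne => ?_⟩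
    rcases List.mem_cons.1 hσ' with rfl | hmem
    · exact (h3 hne).mono (Set.inter_subset_inter_right _
        (Set.iUnion_mono fun j => Finset.coe_subset.2 (g1 j)))
    · exact g3 σ' hmem hne

/-- The potential of all layers below `J` and all points of `T`. -/
noncomputable def totalPotential (D : Preprocessing k φ ψ P) (J : ℕ) (T : Finset ℂ)
    (H : ℕ → Finset ℂ) : ℕ :=
  ∑ j ∈ Finset.range J, ∑ p ∈ T, potential D j p (H j)

theorem totalPotential_anti (D : Preprocessing k φ ψ P) (J : ℕ) (T : Finset ℂ)
    {H H' : ℕ → Finset ℂ} (hH : H ≤ H') : totalPotential D J T H' ≤ totalPotential D J T H :=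
  Finset.sum_le_sum fun j _ => Finset.sum_le_sum fun p _ => potential_anti D j p (hH j)

theorem totalPotential_lt (D : Preprocessing k φ ψ P) {J : ℕ} {T : Finset ℂ}
    {H H' : ℕ → Finset ℂ} (hH : H ≤ H') {j : ℕ} (hj : j < J) {p : ℂ} (hp : p ∈ T)
    (hlt : potential D j p (H' j) < potential D j p (H j)) :
    totalPotential D J T H' < totalPotential D J T H := by
  refine Finset.sum_lt_sum (fun j _ => Finset.sum_le_sum fun p _ => potential_anti D j p (hH j))
    ⟨j, Finset.mem_range.2 hj, ?_⟩
  exact Finset.sum_lt_sum (fun p _ => potential_anti D j p (hH j)) ⟨p, hp, hlt⟩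

theorem totalPotential_le (D : Preprocessing k φ ψ P) (J : ℕ) (T : Finset ℂ)
    (H : ℕ → Finset ℂ) :
    totalPotential D J T H ≤ J * (T.card * (4 * floorLog2 (2 * P.card))) := by
  refine (Finset.sum_le_sum fun j _ => Finset.sum_le_sum fun p _ =>
    potential_le D j p (H j)).trans ?_
  simp

theorem encard_output_hhrResult_le [hk : Fact (4 ≤ k)] (h : Aligned k φ ψ)
    (D : Preprocessing k φ ψ P) (H : ℕ → Finset ℂ) (σ : KGon)
    (π : Equiv.Perm (Fin (shrunkSet k φ σ).length)) :
    (output (hhrResult D H σ π)).encard ≤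
      (output H).encard + ((k + 1) * maxTiles k φ ψ : ℕ) := by
  refine encard_output_update_le (subset_foldl_esStep D _ _ _) ?_
  refine (card_foldl_esStep_le h D _ _ fun τ hτ =>
    diam_of_mem_shrunkSet ((mem_ofFn_get_perm π).1 hτ)).trans ?_
  rw [List.length_ofFn]
  gcongr
  exact (length_shrunkSet k φ σ).2

/-- If the first object of the shrunk set contains `p ∈ T`, then the potential drops, and this
happens with probability at least `1 / (k + 1)`. -/
theorem sum_totalPotential_le [hk : Fact (4 ≤ k)] (h : Aligned k φ ψ)
    (D : Preprocessing k φ ψ P) {J : ℕ} {T : Finset ℂ} (hT : T ⊆ P) {H : ℕ → Finset ℂ}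
    {σ : KGon} (hσ : 1 ≤ σ.diam) (hJ : layer σ.diam < J)
    (hhit : ¬ (σ.body k φ ∩ output H).Nonempty) {p : ℂ} (hp : p ∈ T) (hpσ : p ∈ σ.body k φ) :
    (k + 1) * ∑ π, totalPotential D J T (hhrResult D H σ π) +
        Fintype.card (Equiv.Perm (Fin (shrunkSet k φ σ).length)) ≤
      (k + 1) * (Fintype.card (Equiv.Perm (Fin (shrunkSet k φ σ).length)) *
        totalPotential D J T H) := by
  classical
  obtain ⟨hlen0, hlen⟩ := length_shrunkSet k φ σ
  obtain ⟨σ', hσ', hpσ'⟩ := exists_mem_shrunkSet hk.out φ hσ hpσ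
  obtain ⟨i₀, hi₀⟩ := List.mem_iff_get.1 hσ'
  have hcount := card_perm_le ⟨0, hlen0⟩ i₀
  set good := Finset.univ.filter fun π : Equiv.Perm (Fin (shrunkSet k φ σ).length) =>
    π ⟨0, hlen0⟩ = i₀ with hgood
  have hdrop : ∀ π, totalPotential D J T (hhrResult D H σ π) + (if π ∈ good then 1 else 0) ≤
      totalPotential D J T H := by
    intro π
    split_ifs with hπ
    · refine totalPotential_lt D (le_hhrResult D H σ π) hJ hp ?_
      have hπ' : π ⟨0, hlen0⟩ = i₀ := by simpa [hgood] using hπ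
      obtain ⟨l, hl⟩ := exists_ofFn_eq_cons hlen0 fun i => (shrunkSet k φ σ).get (π i)
      rw [hhrResult, Function.update_self, hl, hπ', hi₀]
      refine potential_foldl_esStep_lt h D _ (diam_of_mem_shrunkSet hσ') (hT hp) hpσ' ?_
      intro q hq hqσ
      exact hhit ⟨q, body_subset_of_mem_shrunkSet hk.out φ hσ hσ' hqσ, subset_output H _ hq⟩
    · exact totalPotential_anti D J T (le_hhrResult D H σ π)
  have hsum := Finset.sum_le_sum fun π (_ : π ∈ Finset.univ) => hdrop π
  rw [Finset.sum_add_distrib, Finset.sum_ite_mem, Finset.univ_inter, Finset.sum_const,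
    Finset.sum_const, smul_eq_mul, smul_eq_mul, mul_one, Finset.card_univ] at hsum
  calc _ ≤ (k + 1) * ∑ π, totalPotential D J T (hhrResult D H σ π) + (k + 1) * good.card := by
        have := Nat.mul_le_mul_right good.card hlen
        omega
    _ ≤ _ := by rw [← mul_add]; exact Nat.mul_le_mul_left _ hsum

/-- The expected number of points that HHR still adds is controlled by the potential: one
step adds at most `(k + 1) m` points and lowers the expected potential by at least
`1 / (k + 1)`. -/
theorem expectedSize_hhrFrom_le [hk : Fact (4 ≤ k)] (h : Aligned k φ ψ)
    (D : Preprocessing k φ ψ P) {M : ℝ} {T : Finset ℂ} (hT : T ⊆ P) (I : List KGon)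
    (hI : ∀ σ ∈ I, 1 ≤ σ.diam ∧ σ.diam ≤ M) (hTI : Hits k φ P I T) (H : ℕ → Finset ℂ) :
    expectedSize (hhrFrom D H I) ≤ ((output H).encard : ℝ≥0∞) +
      ((maxTiles k φ ψ * (k + 1) ^ 2 * totalPotential D (floorLog2 (2 * M)) T H : ℕ) : ℝ≥0∞) := by
  induction I generalizing H with
  | nil =>
    rw [hhrFrom, expectedSize_pure]
    exact le_self_add
  | cons σ I ih =>
    have ih' := ih (fun σ' h' => hI σ' (List.mem_cons_of_mem _ h'))
      fun σ' h' => hTI σ' (List.mem_cons_of_mem _ h')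
    obtain ⟨hσ, hσM⟩ := hI σ List.mem_cons_self
    set J := floorLog2 (2 * M)
    rw [hhrFrom]
    by_cases hhit : (σ.body k φ ∩ output H).Nonempty
    · rw [hhrStep_of_hit D hhit, PMF.pure_bind]
      exact ih' H
    rw [hhrStep_of_not_hit D hhit, PMF.bind_map, expectedSize_uniform_bind]
    set N := Fintype.card (Equiv.Perm (Fin (shrunkSet k φ σ).length)) with hN
    have hN0 : (N : ℝ≥0∞) ≠ 0 := by
      rw [hN]; exact_mod_cast Fintype.card_ne_zero
    rw [← ENNReal.div_eq_inv_mul]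
    refine ENNReal.div_le_of_le_mul' ?_
    by_cases hne : (σ.body k φ ∩ P).Nonempty
    · obtain ⟨p, hpσ, hpT⟩ := hTI σ List.mem_cons_self hne
      have hpot := sum_totalPotential_le h D hT hσ (layer_lt hσ hσM) hhit hpT hpσ
      rw [← hN] at hpot
      set m := maxTiles k φ ψ
      have hpot' : N * ((k + 1) * m) +
          ∑ π, m * (k + 1) ^ 2 * totalPotential D J T (hhrResult D H σ π) ≤
          N * (m * (k + 1) ^ 2 * totalPotential D J T H) := by
        rw [← Finset.mul_sum]
        have := Nat.mul_le_mul_left (m * (k + 1)) hpot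
        linarith
      calc _ ≤ ∑ π, (((output H).encard : ℝ≥0∞) + (((k + 1) * m : ℕ) : ℝ≥0∞) +
            ((m * (k + 1) ^ 2 * totalPotential D J T (hhrResult D H σ π) : ℕ) : ℝ≥0∞)) := by
            -- one step adds at most `(k + 1) m` points
            refine Finset.sum_le_sum fun π _ => (ih' (hhrResult D H σ π)).trans ?_
            gcongr
            exact_mod_cast ENat.toENNReal_mono (encard_output_hhrResult_le h D H σ π)
        _ = N * ((output H).encard : ℝ≥0∞) + ((N * ((k + 1) * m) +
            ∑ π, m * (k + 1) ^ 2 * totalPotential D J T (hhrResult D H σ π) : ℕ) : ℝ≥0∞) := by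
            rw [Finset.sum_add_distrib, Finset.sum_const, Finset.card_univ, nsmul_eq_mul, ← hN]
            push_cast
            ring
        _ ≤ _ := by
            rw [mul_add]
            gcongr
            exact_mod_cast hpot'
    · calc _ = ∑ _π : Equiv.Perm (Fin (shrunkSet k φ σ).length), expectedSize (hhrFrom D H I) := by
            refine Finset.sum_congr rfl fun π _ => ?_
            rw [Function.comp_apply, hhrResult_of_disjoint D H hσ hne]
        _ = N * expectedSize (hhrFrom D H I) := by
            rw [Finset.sum_const, Finset.card_univ, nsmul_eq_mul]
        _ ≤ _ := by gcongr; exact ih' H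

theorem exists_card_eq_opt (k : ℕ) (φ : ℝ) (P : Finset ℂ) (I : List KGon) :
    ∃ T : Finset ℂ, T ⊆ P ∧ Hits k φ P I T ∧ T.card = opt k φ P I :=
  Nat.sInf_mem (s := {n | ∃ T : Finset ℂ, T ⊆ P ∧ Hits k φ P I T ∧ T.card = n})
    ⟨_, P, subset_rfl, fun _ _ h => h, rfl⟩

theorem expectedSize_hhr_le [hk : Fact (4 ≤ k)] (h : Aligned k φ ψ)
    (D : Preprocessing k φ ψ P) {M : ℝ} (I : List KGon)
    (hI : ∀ σ ∈ I, 1 ≤ σ.diam ∧ σ.diam ≤ M) :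
    expectedSize (hhr D I) ≤
      ((4 * maxTiles k φ ψ * (k + 1) ^ 2 * floorLog2 (2 * M) * floorLog2 (2 * P.card) *
        opt k φ P I : ℕ) : ℝ≥0∞) := by
  obtain ⟨T, hTP, hTI, hT⟩ := exists_card_eq_opt k φ P I
  refine (expectedSize_hhrFrom_le h D hTP I hI hTI _).trans ?_
  have h0 : output (fun _ => ∅) = ∅ := by simp [output]
  rw [h0, Set.encard_empty, ENat.toENNReal_zero, zero_add]
  have := Nat.mul_le_mul_left (maxTiles k φ ψ * (k + 1) ^ 2)
    (totalPotential_le D (floorLog2 (2 * M)) T fun _ => ∅)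
  rw [← hT]
  rw [Nat.cast_le]
  exact this.trans_eq (by ring)

end

theorem floorLog2_two_mul_le {x : ℝ} (hx : 2 ≤ x) :
    (floorLog2 (2 * x) : ℝ) ≤ 2 / Real.log 2 * Real.log x := by
  have h2 : 0 < Real.log 2 := Real.log_pos (by norm_num)
  have hle : Real.log 2 ≤ Real.log x := Real.log_le_log (by norm_num) hx
  refine (Nat.floor_le (Real.logb_nonneg (by norm_num) (by linarith))).trans ?_
  rw [Real.logb, Real.log_mul (by norm_num) (by linarith), div_mul_eq_mul_div]
  gcongr
  linarith

end OnlineHitting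

theorem mainTheorem4 (k : ℕ) (hk : 4 ≤ k) :
    -- `m` and `C` depend only on `k`
    ∃ (m : ℕ) (C : ℝ),
    ∀ (φ ψ : ℝ), (k = 4 → ∃ i : ℤ, ψ = φ + Real.pi / 4 + i * (Real.pi / 2)) →
      maxTiles k φ ψ ≤ m ∧
      ∀ P : Finset ℂ,
        -- the preprocessing can be carried out
        Nonempty (Preprocessing k φ ψ P) ∧
        ∀ (D : Preprocessing k φ ψ P) (M : ℝ), 1 ≤ M →
        ∀ I : List KGon, (∀ σ ∈ I, 1 ≤ σ.diam ∧ σ.diam ≤ M) →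
          -- the output is always a hitting set
          (∀ H ∈ (hhr D I).support, output H ⊆ P ∧ Hits k φ P I (output H)) ∧
          -- the competitive ratio
          expectedSize (hhr D I) ≤
            ((4 * maxTiles k φ ψ * (k + 1) ^ 2 * floorLog2 (2 * M) * floorLog2 (2 * P.card) *
              opt k φ P I : ℕ) : ℝ≥0∞) ∧
          -- which is `O(log n log M)`
          (2 ≤ P.card → 2 ≤ M →
            expectedSize (hhr D I) ≤
              ENNReal.ofReal (C * Real.log P.card * Real.log M) * (opt k φ P I : ℝ≥0∞)) := by
  refine ⟨81, 16 * 81 * (k + 1) ^ 2 / Real.log 2 ^ 2, fun φ ψ hal => ⟨maxTiles_le k φ ψ, fun P =>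
    ⟨nonempty_preprocessing k φ ψ P, fun D M hM I hI => ?_⟩⟩⟩
  have hfact : Fact (4 ≤ k) := ⟨hk⟩
  have hbound := expectedSize_hhr_le hal D I hI
  refine ⟨fun H hH => ?_, hbound, fun hP hM2 => hbound.trans ?_⟩
  · obtain ⟨-, hHP, hhits⟩ := hhrFrom_invariant hal D I (fun σ hσ => (hI σ hσ).1) (fun _ => ∅)
      (fun _ => Finset.empty_subset _) H hH
    exact ⟨Set.iUnion_subset fun j => Finset.coe_subset.2 (hHP j), hhits⟩
  · have h1 := floorLog2_two_mul_le hM2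
    have h2 := floorLog2_two_mul_le (x := P.card) (by exact_mod_cast hP)
    have h3 : (maxTiles k φ ψ : ℝ) ≤ 81 := by exact_mod_cast maxTiles_le k φ ψ
    have hlog : 0 < Real.log 2 := Real.log_pos (by norm_num)
    have hlogM : 0 ≤ Real.log M := Real.log_nonneg hM
    rw [Nat.cast_mul]
    gcongr
    rw [← ENNReal.ofReal_natCast]
    apply ENNReal.ofReal_le_ofReal
    push_cast
    calc (4 * maxTiles k φ ψ * (k + 1) ^ 2 * floorLog2 (2 * M) * floorLog2 (2 * P.card) : ℝ)
        ≤ 4 * 81 * (k + 1) ^ 2 * (2 / Real.log 2 * Real.log M) *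
          (2 / Real.log 2 * Real.log P.card) := by gcongr
      _ = _ := by field_simp; ring
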